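/- Let $f=(f_1,f_2)$ be a polynomial map of $\mathbb{C}^2$ of algebraic degree $D$, extended to a meromorphic map of $\mathbb{P}^2$ with coordinates $[Z:W:T]$, where $[z:w:1]$ corresponds to $(z,w)\in\mathbb C^2$. Let $I(f)$ be its indeterminacy set and $L_\infty=(T=0)$. Write the degree $D$ parts of $f_1,f_2$ as $gP_1,gP_2$ with $P_1,P_2$ homogeneous of the same degree without common factor, and let $f_\infty=[P_1:P_2]:L_\infty\to L_\infty$ be the restriction of $f$ to $L_\infty$, extended through the indeterminacy points. Assume that: - $L_\infty$ is attracting: there are $C>1$ and $M$ with $\|f(x)\|\ge C\|x\|$ (Euclidean norm) whenever $\|x\|\ge M$; - $I(f)\neq\varnothing$ and $f_\infty$ is not constant; - $f_\infty$ is hyperbolic: it has an attracting periodic orbit, and the forward orbit of each critical point converges to some attracting periodic orbit (the existence of an attracting periodic orbit is automatic if $\deg f_\infty\ge2$; if $\deg f_\infty=1$ it means that $f_\infty$ is loxodromic); - no point of $I(f)$ lies in the Julia set $J_\infty$ of $f_\infty$, and no point of $I(f)$ is periodic for $f_\infty$. Let $E=\bigcup_{n\ge0}f_\infty^{-n}(I(f))\subset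 L_\infty$. For a unitary change of coordinates $(Z,W)=U(Z',W')$ put $(u,v)=(Z'/W',T/W')$; these are coordinates off the line $W'=0$, with $L_\infty=(v=0)$. A bidisk centered at the point $(a,0)$ is $\Delta=\{|u-a|<r,\ |v|<s\}$ with $r,s>0$, and its vertical boundary is $\partial_v\Delta=\{|u-a|=r,\ |v|<s\}$. The image $f(A)$ of a set $A\subset\mathbb{P}^2$ is the set of $y$ such that $(x,y)$ is in the closure of the graph of $f|_{\mathbb{P}^2\setminus I(f)}$ for some $x\in A$. The map $f$ restricts to a horizontal-like map from $\Delta_1$ to $\Delta_2$ if $f$ is dominating (its image lies in no algebraic curve), $I(f)\cap\partial_v\Delta_1=\varnothing$, $f(\partial_v\Delta_1)\cap\overline{\Delta_2}=\varnothing$, $f(\overline{\Delta_1})\cap\partial\Delta_2\subset\partial_v\Delta_2$ and $f(\Delta_1)\cap\Delta_2\ne\varnothing$. Then there are unitary coordinates $(Z',W')$ such that the point $[Z':W':T]=[1:0:0]$ is not in $J_\infty\cup E$. For all such coordinates and every $\delta>0$, there are bidisks $\Delta_p$ centered at $p$, for $p\in E$, with all radii $r,s$ smaller than $\delta$, such that: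 1. if $p\in I(f)$, then $f$ restricts to a horizontal-like map from $\Delta_p$ to $\Delta_q$ for every $q\in E$; 2. if $p\in E\setminus I(f)$, then $f$ restricts to a horizontal-like map from $\Delta_p$ to $\Delta_{f_\infty(p)}$; 3. $\Delta_I\cap\Delta_q=\varnothing$ for all $I\in I(f)$ and all $q\in E\setminus\{I\}$; 4. $\Delta_q\cap\Delta_{q'}=\varnothing$ for all $p\in E$ and all distinct $q,q'\in f_\infty^{-1}(p)$. -/

import Mathlib

open scoped LinearAlgebra.Projectivization

namespace PolyDyn

noncomputable section

/-- The projective line, identified throughout with the line at infinity `L_∞` of the plane: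
`[z : w]` corresponds to `[z : w : 0]`. -/
abbrev P1 : Type := ℙ ℂ (Fin 2 → ℂ)

/-- The projective plane, with homogeneous coordinates `[Z : W : T]` and `L_∞ = (T = 0)`. -/
abbrev P2 : Type := ℙ ℂ (Fin 3 → ℂ)

/-- The usual (quotient) topology of the projective plane. -/
instance instTopologicalSpaceP2 : TopologicalSpace P2 :=
  inferInstanceAs (TopologicalSpace (Quotient (projectivizationSetoid ℂ (Fin 3 → ℂ))))

open Classical in
/-- The point of projective space with homogeneous coordinates `v` (an irrelevant default value
for `v = 0`). -/
def toProj {n : ℕ} (v : Fin (n + 1) → ℂ) : ℙ ℂ (Fin (n + 1) → ℂ) :=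
  if h : v ≠ 0 then Projectivization.mk ℂ v h
  else Projectivization.mk ℂ (fun _ => 1) (fun h1 => one_ne_zero (congrFun h1 0))

/-- The Euclidean (Hermitian) norm on `ℂ²`. -/
def euclNorm (v : Fin 2 → ℂ) : ℝ := Real.sqrt (‖v 0‖ ^ 2 + ‖v 1‖ ^ 2)

/-- The inclusion of `L_∞` in the plane. -/
def lineAtInfinity (p : P1) : P2 := toProj ![p.rep 0, p.rep 1, 0]

/-! ### Polynomial maps of `ℂ²` and their extension to the plane -/

/-- The polynomial map of `ℂ²` given by a pair of polynomials. -/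
def polyMap (F : Fin 2 → MvPolynomial (Fin 2) ℂ) (x : Fin 2 → ℂ) : Fin 2 → ℂ :=
  fun i => MvPolynomial.eval x (F i)

/-- The algebraic degree of a polynomial map. -/
def algDegree (F : Fin 2 → MvPolynomial (Fin 2) ℂ) : ℕ :=
  max (F 0).totalDegree (F 1).totalDegree

/-- The homogenization `T ^ D * F_i (Z / T, W / T)` of the component `F i`, where `D` is the
algebraic degree of `F`, as a function of `(Z, W, T)`. -/
def homogenize (F : Fin 2 → MvPolynomial (Fin 2) ℂ) (i : Fin 2) (X : Fin 3 → ℂ) : ℂ :=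
  ∑ k ∈ Finset.range (algDegree F + 1),
    X 2 ^ (algDegree F - k) *
      MvPolynomial.eval ![X 0, X 1] (MvPolynomial.homogeneousComponent k (F i))

/-- The homogeneous lift to `ℂ³` of the meromorphic extension of `F` to the plane. -/
def homLift (F : Fin 2 → MvPolynomial (Fin 2) ℂ) (X : Fin 3 → ℂ) : Fin 3 → ℂ :=
  ![homogenize F 0 X, homogenize F 1 X, X 2 ^ algDegree F]

/-- The indeterminacy set of the meromorphic extension: the common zeros of the three components
of the homogeneous lift (these components have no common factor, since `F` has degree exactly
`algDegree F`). -/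
def indetSet (F : Fin 2 → MvPolynomial (Fin 2) ℂ) : Set P2 :=
  {x | homLift F x.rep = 0}

/-- The graph of the extension over the complement of the indeterminacy set. -/
def regularGraph (F : Fin 2 → MvPolynomial (Fin 2) ℂ) : Set (P2 × P2) :=
  {xy | xy.1 ∉ indetSet F ∧ xy.2 = toProj (homLift F xy.1.rep)}

/-- The image `f(A)` of a set under the meromorphic extension, as usual through the closure of the
graph; away from the indeterminacy set it is the image under a map, and the image of an
indeterminacy point is a set of more than one point. -/
def meroImage (F : Fin 2 → MvPolynomial (Fin 2) ℂ) (A : Set P2) : Set P2 :=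
  {y | ∃ x ∈ A, (x, y) ∈ closure (regularGraph F)}

/-- `F` is dominating: its image lies in no algebraic curve. -/
def IsDominating (F : Fin 2 → MvPolynomial (Fin 2) ℂ) : Prop :=
  ∀ R : MvPolynomial (Fin 2) ℂ, (∀ x, MvPolynomial.eval (polyMap F x) R = 0) → R = 0

/-- `L_∞` is attracting. -/
def IsInfinityAttracting (F : Fin 2 → MvPolynomial (Fin 2) ℂ) : Prop :=
  ∃ C M : ℝ, 1 < C ∧
    ∀ x : Fin 2 → ℂ, M ≤ euclNorm x → C * euclNorm x ≤ euclNorm (polyMap F x)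

/-! ### The restriction to the line at infinity -/

/-- The homogeneous part of maximal degree of `F` written as `(g * P 0, g * P 1)`, with `P 0`,
`P 1` homogeneous of the same degree and without common factor. Every nonconstant polynomial map
has such a form, and `g`, `P` are unique up to multiplication by constants. -/
structure LeadingForm (F : Fin 2 → MvPolynomial (Fin 2) ℂ) where
  /-- the common factor -/
  g : MvPolynomial (Fin 2) ℂ
  /-- the coprime part -/
  P : Fin 2 → MvPolynomial (Fin 2) ℂ
  /-- the degree of the common factor -/
  d : ℕ
  /-- the degree of the coprime part -/
  d' : ℕ
  g_ne_zero : g ≠ 0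
  g_homogeneous : g.IsHomogeneous d
  P_homogeneous : ∀ i, (P i).IsHomogeneous d'
  P_relPrime : IsRelPrime (P 0) (P 1)
  remainder : ∀ i, (F i - g * P i).totalDegree < d + d'

variable {F : Fin 2 → MvPolynomial (Fin 2) ℂ}

/-- The map `f_∞ = [P 0 : P 1]`, the restriction of the extension of `F` to `L_∞` (extended
through the indeterminacy points). -/
def LeadingForm.fInfty (L : LeadingForm F) (p : P1) : P1 :=
  toProj (fun i => MvPolynomial.eval p.rep (L.P i))

/-- The critical points of `f_∞`: the zeros of the Jacobian determinant of the homogeneous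
lift `(P 0, P 1)`. -/
def LeadingForm.criticalPoints (L : LeadingForm F) : Set P1 :=
  {p | MvPolynomial.eval p.rep
    (MvPolynomial.pderiv 0 (L.P 0) * MvPolynomial.pderiv 1 (L.P 1) -
      MvPolynomial.pderiv 1 (L.P 0) * MvPolynomial.pderiv 0 (L.P 1)) = 0}

/-- The class `𝒢`: `L_∞` is attracting, the extension of `F` has indeterminacy points, and `f_∞` is
not constant. -/
structure InClassG (F : Fin 2 → MvPolynomial (Fin 2) ℂ) (L : LeadingForm F) : Prop where
  attracting : IsInfinityAttracting F
  indet_nonempty : (indetSet F).Nonempty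
  not_constant : ∃ p q : P1, L.fInfty p ≠ L.fInfty q

/-- The indeterminacy points, as points of the line at infinity (they all lie on it when `F` is
not constant). -/
def indetPoints (F : Fin 2 → MvPolynomial (Fin 2) ℂ) : Set P1 :=
  {p | lineAtInfinity p ∈ indetSet F}

/-- The set `E` of the indeterminacy points and all their iterated preimages under `f_∞`. -/
def LeadingForm.E (L : LeadingForm F) : Set P1 :=
  {p | ∃ n : ℕ, L.fInfty^[n] p ∈ indetPoints F}

/-! ### Dynamics on the projective line -/

/-- The chordal distance on the projective line (it does not depend on the representatives). -/
def chordal (p q : P1) : ℝ :=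
  ‖p.rep 0 * q.rep 1 - p.rep 1 * q.rep 0‖ / (euclNorm p.rep * euclNorm q.rep)

/-- The Fatou set: the points with a neighbourhood on which the iterates form an equicontinuous
(equivalently, by compactness, normal) family. -/
def fatouSet (h : P1 → P1) : Set P1 :=
  {p | ∃ ρ > 0, ∀ x, chordal x p < ρ →
    ∀ ε > 0, ∃ δ > 0, ∀ n : ℕ, ∀ y, chordal y x < δ → chordal (h^[n] y) (h^[n] x) < ε}

/-- The Julia set. -/
def juliaSet (h : P1 → P1) : Set P1 := (fatouSet h)ᶜ

/-- `p` is an attracting periodic point of `h`, with (not necessarily minimal) period `n`. For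
holomorphic `h`, the quotient `chordal (h^[n] y) p / chordal y p` tends to the modulus of the
multiplier as `y` tends to `p`, so the last condition says that this modulus is less than 1. -/
def IsAttractingPeriodic (h : P1 → P1) (n : ℕ) (p : P1) : Prop :=
  0 < n ∧ h^[n] p = p ∧
    ∃ κ < 1, ∃ ρ > 0, ∀ y, chordal y p < ρ → chordal (h^[n] y) p ≤ κ * chordal y p

/-- `f_∞` is (uniformly) hyperbolic: the forward orbit of each critical point converges to some
attracting periodic orbit. The existence of an attracting periodic orbit follows from this as soon
as there is a critical point, that is, in degree at least 2; in degree 1 it says that the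
homography `f_∞` is loxodromic. -/
def LeadingForm.IsHyperbolic (L : LeadingForm F) : Prop :=
  (∃ n p, IsAttractingPeriodic L.fInfty n p) ∧
    ∀ c ∈ L.criticalPoints, ∃ n p, IsAttractingPeriodic L.fInfty n p ∧
      Filter.Tendsto (fun k : ℕ => chordal (L.fInfty^[n * k] c) p) Filter.atTop (nhds 0)

/-! ### Bidisks and horizontal-like maps -/

/-- The point with affine coordinates `(u, v) = (Z' / W', T / W')`, where `(Z', W')` are the
coordinates of `ℂ²` with `(Z, W) = U (Z', W')`. For unitary `U` this parametrizes the complement of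
the line `W' = 0`, and `L_∞` is `v = 0`. -/
def chart (U : Matrix (Fin 2) (Fin 2) ℂ) (x : ℂ × ℂ) : P2 :=
  toProj ![U.mulVec ![x.1, 1] 0, U.mulVec ![x.1, 1] 1, x.2]

/-- The point of `L_∞` that the coordinates `(u, v)` miss: `[1 : 0 : 0]` in the coordinates
`[Z' : W' : T]`. -/
def missedPoint (U : Matrix (Fin 2) (Fin 2) ℂ) : P1 := toProj (U.mulVec ![1, 0])

/-- The data of a bidisk `{|u - center| < r, |v| < s}` in the coordinates `(u, v)`. -/
structure Bidisk where
  /-- the `u`-coordinate of the centre, which lies on `v = 0` -/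
  center : ℂ
  /-- the horizontal radius -/
  r : ℝ
  /-- the vertical radius -/
  s : ℝ
  r_pos : 0 < r
  s_pos : 0 < s

/-- The open bidisk as a subset of the plane. -/
def Bidisk.carrier (B : Bidisk) (U : Matrix (Fin 2) (Fin 2) ℂ) : Set P2 :=
  chart U '' (Metric.ball B.center B.r ×ˢ Metric.ball 0 B.s)

/-- The vertical boundary `{|u - center| = r, |v| < s}` of the bidisk. -/
def Bidisk.verticalBoundary (B : Bidisk) (U : Matrix (Fin 2) (Fin 2) ℂ) : Set P2 :=
  chart U '' (Metric.sphere B.center B.r ×ˢ Metric.ball 0 B.s)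

/-- `(f, Δ₁, Δ₂)` defines a horizontal-like map, where `f` is the meromorphic extension of `F` and
`Δ₁`, `Δ₂` are bidisks in the coordinates `(u, v)` given by `U`. -/
structure IsHorizontalLike (F : Fin 2 → MvPolynomial (Fin 2) ℂ)
    (U : Matrix (Fin 2) (Fin 2) ℂ) (Δ₁ Δ₂ : Bidisk) : Prop where
  dominating : IsDominating F
  no_indet : Disjoint (indetSet F) (Δ₁.verticalBoundary U)
  vertical : Disjoint (meroImage F (Δ₁.verticalBoundary U)) (closure (Δ₂.carrier U))
  horizontal :
    meroImage F (closure (Δ₁.carrier U)) ∩ frontier (Δ₂.carrier U) ⊆ Δ₂.verticalBoundary U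
  meets : (meroImage F (Δ₁.carrier U) ∩ Δ₂.carrier U).Nonempty

end

end PolyDyn

/-!
The disks on `L_∞`. The heart of the matter is one-dimensional: find radii `r p`, for the possibly
infinitely many `p ∈ E`, such that the image under `f_∞` of the circle of radius `r p` about `p`
stays, with a uniform margin `μ`, outside the disk of radius `r (f_∞ p)` about `f_∞ p`. By
hyperbolicity the critical points lie in the basins of the attracting periodic orbits. So do the
indeterminacy points and the missed point of the chart, because the Fatou set is contained in these
basins (`LeadingForm.IsHyperbolic.fatouSet_subset`). On the basins there is a Lyapunov function `w`
(`IsTrap`, `exists_isTrap_of_isCompact`) and a level `σ` such that `{w < σ}` contains all these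
points and `f_∞` maps `{w ≤ σ}` into `{w < σ}`. In the chart, the complement `W = {w > σ}` is
bounded, and `f_∞` is a holomorphic covering of `W` by `X = f_∞⁻¹ W`, which lies in `W` together
with its neighbourhood of some fixed size. Let `S x` be the supremum of `‖φ' 0‖` over the
holomorphic maps `φ` of the unit disk to `W` with `φ 0 = x` (`innerRadius`), that is, the inverse of
the Kobayashi density. Disks in `W` lift to `X`, and in `X` they may be dilated by a fixed factor
within `W`; so there is `lam > 1` with `lam * S (f_∞ x) ≤ ‖f_∞' x‖ * S x`
(`innerRadius_expansion`). This is a form of the Schwarz-Pick lemma that needs no hyperbolic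
metric. The same inequality, iterated and compared with Cauchy's estimate, yields the inclusion of
the Fatou set in the basins.

Hence the radii `r p = ε * S p`, with small `ε`, do for the points `p ∈ E` that are mapped into `W`.
Only finitely many points of `E` are not (`ExpansionSetup.finite_far`), since the indeterminacy
points are not periodic and orbits in the trap accumulate only on periodic points. As none of the
remaining points is periodic, their radii can be chosen one after the other along the orbits, each
much smaller than the preceding ones (`exists_radii_of_finite`). Everything is put together in
`exists_radii`.

The bidisks. By compactness the margin `μ` on the circles persists for `f` at all small heights
(`exists_height`), which takes care of the vertical boundaries. In the coordinates `(u, v)` the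
distance from the origin is `‖(u, 1)‖ / ‖v‖`, and `f` multiplies it by at least `C > 1`; so for
bidisks of height `η * ‖(a, 1)‖` about `(a, 0)`, with the same small `η` for all, `f` maps a bidisk
strictly below the top of the next one (`exists_contracted_heights`). Finally, `f` is dominating
because a polynomial relation between its components would make the nonconstant map `f_∞` finite
valued (`LeadingForm.isDominating`), and the image of a bidisk about an indeterminacy point meets
all of them by the open mapping theorem (`exists_mem_closure_regularGraph_near`).
-/

namespace PolyDyn

section

open Metric Set Filter Topology

open scoped Matrix

/-! ### Holomorphic disks and expansion -/

/-- A proper local homeomorphism is a covering, and disks lift through coverings: if the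
holomorphic map `h : X → W` is proper and has no critical points, then every holomorphic disk in
`W` centred at `h x` lifts to a holomorphic disk in `X` centred at `x`. -/
theorem exists_holomorphic_lift {W X : Set ℂ} {h h' : ℂ → ℂ} (hW : IsOpen W) (hX : IsOpen X)
    (hd : ∀ x ∈ X, HasStrictDerivAt h (h' x) x) (hne : ∀ x ∈ X, h' x ≠ 0)
    (hmaps : MapsTo h X W)
    (hproper : ∀ K ⊆ W, IsCompact K → IsCompact (X ∩ h ⁻¹' K))
    {φ : ℂ → ℂ} (hφ : DifferentiableOn ℂ φ (ball 0 1)) (hφW : MapsTo φ (ball 0 1) W)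
    {x : ℂ} (hx : x ∈ X) (hφ0 : φ 0 = h x) :
    ∃ ψ : ℂ → ℂ, DifferentiableOn ℂ ψ (ball 0 1) ∧ MapsTo ψ (ball 0 1) X ∧ ψ 0 = x ∧
      ∀ z ∈ ball (0 : ℂ) 1, h (ψ z) = φ z := by
  have hcont : ContinuousOn h X := fun y hy => (hd y hy).hasDerivAt.continuousAt.continuousWithinAt
  let p : X → W := hmaps.restrict h X W
  have hpc : Continuous p := hcont.mapsToRestrict hmaps
  have hloc : IsLocalHomeomorphOn h X := fun y hy =>
    ⟨_, ((hd y hy).hasStrictFDerivAt_equiv (hne y hy)).mem_toOpenPartialHomeomorph_source, by simp⟩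
  have hlocX : IsLocalHomeomorph (fun y : X => h y) := by
    have h1 : IsLocalHomeomorph (Subtype.val : X → ℂ) :=
      hX.isOpenEmbedding_subtypeVal.isLocalHomeomorph
    rw [isLocalHomeomorph_iff_isLocalHomeomorphOn_univ] at h1 ⊢
    exact hloc.comp h1 (fun y _ => y.2)
  have hlp : IsLocalHomeomorph p :=
    IsLocalHomeomorph.of_comp (g := (Subtype.val : W → ℂ)) (f := p) hlocX
      hW.isOpenEmbedding_subtypeVal.isLocalHomeomorph hpc
  have : LocallyCompactSpace W := hW.locallyCompactSpace
  have hpp : IsProperMap p := by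
    rw [isProperMap_iff_isCompact_preimage]
    refine ⟨hpc, fun K hK => ?_⟩
    have h2 := hproper (Subtype.val '' K) (by rintro _ ⟨y, _, rfl⟩; exact y.2)
      (hK.image continuous_subtype_val)
    rw [Subtype.isCompact_iff]
    convert h2 using 1
    ext y
    constructor
    · rintro ⟨y, hy, rfl⟩
      exact ⟨y.2, p y, hy, rfl⟩
    · rintro ⟨hy, z, hz, hzy⟩
      refine ⟨⟨y, hy⟩, ?_, rfl⟩
      have : p ⟨y, hy⟩ = z := Subtype.ext hzy.symm
      change p ⟨y, hy⟩ ∈ K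
      rwa [this]
  have hcov : IsCoveringMap p := by
    rw [isCoveringMap_iff_isCoveringMapOn_univ]
    refine hpp.isClosedMap.isCoveringMapOn_of_isLocalHomeomorphOn (fun y _ => ?_) ?_
    · have hc : IsCompact (p ⁻¹' {y}) := hpp.isCompact_preimage isCompact_singleton
      exact hc.finite (.of_openPartialHomeomorph p subset_rfl fun e _ => by
        obtain ⟨φ, h1, h2⟩ := hlp e
        exact ⟨φ, h1, h2.symm⟩)
    · exact hlp.isLocalHomeomorphOn
  -- the disk is simply connected, so that the lifting criterion applies
  have hconv : Convex ℝ (ball (0 : ℂ) 1) := convex_ball 0 1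
  have : ContractibleSpace (ball (0 : ℂ) 1) :=
    hconv.contractibleSpace ⟨0, mem_ball_self one_pos⟩
  have : LocallyPathConnectedSpace (ball (0 : ℂ) 1) := isOpen_ball.locallyPathConnectedSpace
  obtain ⟨F, ⟨hF0, hF⟩, -⟩ := hcov.existsUnique_continuousMap_lifts
    (⟨hφW.restrict φ _ _, hφ.continuousOn.mapsToRestrict hφW⟩ : C(ball (0 : ℂ) 1, W))
    ⟨0, mem_ball_self one_pos⟩ ⟨x, hx⟩ (Subtype.ext hφ0.symm)
  classical
  let ψ : ℂ → ℂ := fun z => if hz : z ∈ ball (0 : ℂ) 1 then F ⟨z, hz⟩ else 0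
  have hψ : ∀ z (hz : z ∈ ball (0 : ℂ) 1), ψ z = F ⟨z, hz⟩ := fun z hz => dif_pos hz
  have hψX : MapsTo ψ (ball 0 1) X := fun z hz => by rw [hψ z hz]; exact (F _).2
  have hlift : ∀ z ∈ ball (0 : ℂ) 1, h (ψ z) = φ z := fun z hz => by
    rw [hψ z hz]
    exact congrArg Subtype.val (congrFun hF ⟨z, hz⟩)
  have hψc : ContinuousOn ψ (ball 0 1) := by
    rw [continuousOn_iff_continuous_domRestrict]
    have : (ball (0 : ℂ) 1).domRestrict ψ = fun z => (F z : ℂ) := by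
      ext z; exact hψ z z.2
    rw [this]; fun_prop
  refine ⟨ψ, fun z hz => ?_, hψX, ?_, hlift⟩
  · have hzn : ball (0 : ℂ) 1 ∈ 𝓝 z := isOpen_ball.mem_nhds hz
    have hs := (hd _ (hψX hz)).hasStrictFDerivAt_equiv (hne _ (hψX hz))
    have hψz : ContinuousAt ψ z := hψc.continuousAt hzn
    have hinv := hs.eventually_left_inverse
    have hev : ∀ᶠ y in 𝓝 z, ψ y = hs.localInverse _ _ _ (φ y) := by
      filter_upwards [hψz.eventually hinv, hzn] with y h1 h2
      rw [← hlift y h2, h1]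
    have hl := (hs.to_localInverse).hasFDerivAt.differentiableAt
    have : DifferentiableAt ℂ (fun y => hs.localInverse _ _ _ (φ y)) z := by
      refine DifferentiableAt.comp z ?_ (hφ.differentiableAt hzn)
      rw [← hlift z hz]; exact hl
    exact (this.congr_of_eventuallyEq hev).differentiableWithinAt
  · rw [hψ 0 (mem_ball_self one_pos), hF0]

/-- The supremum of `‖φ' 0‖` over the holomorphic maps `φ` of the unit disk to `W` with `φ 0 = x`:
the inverse of the density of the Kobayashi metric of `W`. For unbounded `W` the set may be
unbounded and the value of `sSup` meaningless; all lemmas assume `W ⊆ ball 0 R`. -/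
noncomputable def innerRadius (W : Set ℂ) (x : ℂ) : ℝ :=
  sSup {t | ∃ φ : ℂ → ℂ, DifferentiableOn ℂ φ (ball 0 1) ∧ MapsTo φ (ball 0 1) W ∧ φ 0 = x ∧
    t = ‖deriv φ 0‖}

theorem norm_deriv_le_of_mapsTo {W : Set ℂ} {R : ℝ} (hW : W ⊆ ball 0 R)
    {φ : ℂ → ℂ} (hφ : DifferentiableOn ℂ φ (ball 0 1)) (hφW : MapsTo φ (ball 0 1) W) :
    ‖deriv φ 0‖ ≤ 2 * R := by
  have h0 := hW (hφW (mem_ball_self one_pos))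
  have hm : MapsTo φ (ball 0 1) (ball (φ 0) (2 * R)) := fun z hz => by
    have h1 := hW (hφW hz)
    rw [mem_ball] at *
    calc dist (φ z) (φ 0) ≤ dist (φ z) 0 + dist (φ 0) 0 := dist_triangle_right _ _ _
      _ < 2 * R := by linarith
  have := Complex.norm_deriv_le_div_of_mapsTo_ball hφ (hm.mono_right ball_subset_closedBall) one_pos
  simpa using this

theorem innerRadius_bddAbove {W : Set ℂ} {R : ℝ} (hW : W ⊆ ball 0 R) (x : ℂ) :
    BddAbove {t | ∃ φ : ℂ → ℂ, DifferentiableOn ℂ φ (ball 0 1) ∧ MapsTo φ (ball 0 1) W ∧ φ 0 = x ∧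
      t = ‖deriv φ 0‖} := by
  refine ⟨2 * R, ?_⟩
  rintro _ ⟨φ, h1, h2, -, rfl⟩
  exact norm_deriv_le_of_mapsTo hW h1 h2

theorem norm_deriv_le_innerRadius {W : Set ℂ} {R : ℝ} (hW : W ⊆ ball 0 R)
    {φ : ℂ → ℂ} (hφ : DifferentiableOn ℂ φ (ball 0 1)) (hφW : MapsTo φ (ball 0 1) W) :
    ‖deriv φ 0‖ ≤ innerRadius W (φ 0) :=
  le_csSup (innerRadius_bddAbove hW _) ⟨φ, hφ, hφW, rfl, rfl⟩

theorem innerRadius_le {W : Set ℂ} {R : ℝ} (hR : 0 ≤ R) (hW : W ⊆ ball 0 R) (x : ℂ) :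
    innerRadius W x ≤ 2 * R := by
  refine Real.sSup_le ?_ (by positivity)
  rintro _ ⟨φ, h1, h2, -, rfl⟩
  exact norm_deriv_le_of_mapsTo hW h1 h2

theorem le_innerRadius {W : Set ℂ} {R : ℝ} (hW : W ⊆ ball 0 R) {x : ℂ} {δ : ℝ} (hδ : 0 < δ)
    (hx : ball x δ ⊆ W) : δ ≤ innerRadius W x := by
  have h1 : Differentiable ℂ (fun z : ℂ => x + δ * z) := by fun_prop
  have h2 : MapsTo (fun z : ℂ => x + δ * z) (ball 0 1) W := fun z hz => hx (by
    rw [mem_ball_zero_iff] at hz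
    rw [mem_ball, dist_eq_norm, add_sub_cancel_left, norm_mul, Complex.norm_real,
      Real.norm_of_nonneg hδ.le]
    nlinarith)
  have h3 := norm_deriv_le_innerRadius hW h1.differentiableOn h2
  have h4 : HasDerivAt (fun z : ℂ => x + δ * z) (δ : ℂ) 0 := by
    simpa using ((hasDerivAt_id (0 : ℂ)).const_mul (δ : ℂ)).const_add x
  rw [h4.deriv, Complex.norm_real, Real.norm_of_nonneg hδ.le] at h3
  simpa using h3

/-- If `h : X → W` is a holomorphic covering and `X` lies well inside `W`, then `h` expands the
Kobayashi metric of `W` by a definite factor: a disk in `W` lifts to `X`, where there is room to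
dilate it by the factor `1 + η / (2 * R)`. -/
theorem innerRadius_expansion {W X : Set ℂ} {h h' : ℂ → ℂ} {R η : ℝ}
    (hW : IsOpen W) (hX : IsOpen X)
    (hWR : W ⊆ ball 0 R) (hη : 0 < η) (hthick : ∀ x ∈ X, ball x η ⊆ W)
    (hd : ∀ x ∈ X, HasStrictDerivAt h (h' x) x) (hne : ∀ x ∈ X, h' x ≠ 0)
    (hmaps : MapsTo h X W)
    (hproper : ∀ K ⊆ W, IsCompact K → IsCompact (X ∩ h ⁻¹' K)) :
    ∃ lam > 1, ∀ x ∈ X, lam * innerRadius W (h x) ≤ ‖h' x‖ * innerRadius W x := by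
  by_cases hXe : X = ∅
  · exact ⟨2, one_lt_two, by simp [hXe]⟩
  obtain ⟨x0, hx0⟩ := Set.nonempty_iff_ne_empty.2 hXe
  have hXW : X ⊆ W := fun x hx => hthick x hx (mem_ball_self hη)
  have hR : 0 < R := by
    have := hWR (hXW hx0)
    exact pos_of_mem_ball this
  set e : ℝ := η / (2 * R) with he
  have hepos : 0 < e := by positivity
  refine ⟨1 + e, by linarith, fun x hx => ?_⟩
  rw [mul_comm, ← le_div_iff₀ (by positivity)]
  have hS0 : 0 ≤ innerRadius W x := hη.le.trans (le_innerRadius hWR hη (hthick x hx))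
  refine Real.sSup_le ?_ (by positivity)
  rintro _ ⟨φ, hφ, hφW, hφ0, rfl⟩
  obtain ⟨ψ, hψ, hψX, hψ0, hlift⟩ :=
    exists_holomorphic_lift hW hX hd hne hmaps hproper hφ hφW hx hφ0
  have h0n : ball (0 : ℂ) 1 ∈ 𝓝 (0 : ℂ) := ball_mem_nhds _ one_pos
  have hψd : HasDerivAt ψ (deriv ψ 0) 0 := (hψ.differentiableAt h0n).hasDerivAt
  have hφd : deriv φ 0 = h' x * deriv ψ 0 := by
    have h1 : HasDerivAt (h ∘ ψ) (h' x * deriv ψ 0) 0 := by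
      refine HasDerivAt.comp 0 ?_ hψd
      rw [hψ0]; exact (hd x hx).hasDerivAt
    have h2 : φ =ᶠ[𝓝 0] h ∘ ψ := by
      filter_upwards [h0n] with z hz using (hlift z hz).symm
    exact (h1.congr_of_eventuallyEq h2).deriv
  -- the dilation of `ψ` about `x` still maps into `W`
  let χ : ℂ → ℂ := fun z => ψ z + e * (ψ z - x)
  have hχ : DifferentiableOn ℂ χ (ball 0 1) := by
    exact hψ.add ((hψ.sub_const x).const_mul _)
  have hχW : MapsTo χ (ball 0 1) W := fun z hz => by
    refine hthick _ (hψX hz) ?_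
    have h1 := hWR (hXW (hψX hz))
    have h2 := hWR (hXW hx)
    have h3 : ‖ψ z - x‖ < 2 * R := by
      rw [← dist_eq_norm]
      rw [mem_ball] at h1 h2
      calc dist (ψ z) x ≤ dist (ψ z) 0 + dist x 0 := dist_triangle_right _ _ _
        _ < 2 * R := by linarith
    rw [mem_ball, dist_eq_norm, add_sub_cancel_left, norm_mul, Complex.norm_real,
      Real.norm_of_nonneg hepos.le]
    calc e * ‖ψ z - x‖ < e * (2 * R) := by gcongr
      _ = η := by rw [he]; field_simp
  have hχd : deriv χ 0 = (1 + e) * deriv ψ 0 := by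
    have : HasDerivAt χ (deriv ψ 0 + e * deriv ψ 0) 0 :=
      hψd.add ((hψd.sub_const x).const_mul _)
    rw [this.deriv]; ring
  have hχ0 : χ 0 = x := by simp [χ, hψ0]
  have hle := norm_deriv_le_innerRadius hWR hχ hχW
  rw [hχ0, hχd, norm_mul] at hle
  have h1e : ‖(1 + e : ℂ)‖ = 1 + e := by
    have : (1 + e : ℂ) = ((1 + e : ℝ) : ℂ) := by push_cast; rfl
    rw [this, Complex.norm_real, Real.norm_of_nonneg (by positivity)]
  rw [h1e] at hle
  rw [le_div_iff₀ (by positivity), hφd, norm_mul]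
  calc ‖h' x‖ * ‖deriv ψ 0‖ * (1 + e) = ‖h' x‖ * ((1 + e) * ‖deriv ψ 0‖) := by ring
    _ ≤ _ := by gcongr

/-! ### Basins of attraction and their Lyapunov functions -/

section Basins

variable {X : Type*} [MetricSpace X]

/-- `IsAttractingPeriodic` in a general metric space; for the chordal metric of `P1` the two
notions agree by definition. -/
def AttractingPeriodic (f : X → X) (n : ℕ) (p : X) : Prop :=
  0 < n ∧ f^[n] p = p ∧
    ∃ κ < 1, ∃ ρ > 0, ∀ y, dist y p < ρ → dist (f^[n] y) p ≤ κ * dist y p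

/-- The union of the basins of the attracting periodic orbits of `f`: some iterate `f^[j] x` is
attracted by a periodic point `p` under `f^[n]`. -/
def basin (f : X → X) : Set X :=
  {x | ∃ j n p, AttractingPeriodic f n p ∧
    Tendsto (fun k : ℕ => f^[n * k] (f^[j] x)) atTop (𝓝 p)}

theorem mem_basin_of_apply_mem {f : X → X} {x : X} (h : f x ∈ basin f) : x ∈ basin f := by
  obtain ⟨j, n, p, hp, ht⟩ := h
  exact ⟨j + 1, n, p, hp, ht⟩

theorem mem_basin_of_iterate_mem {f : X → X} {x : X} (N : ℕ) (h : f^[N] x ∈ basin f) :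
    x ∈ basin f := by
  induction N generalizing x with
  | zero => exact h
  | succ N ih => exact mem_basin_of_apply_mem (ih h)

theorem AttractingPeriodic.iterate_mul_eq {f : X → X} {n : ℕ} {p : X}
    (hp : AttractingPeriodic f n p) (k : ℕ) : f^[n * k] p = p := by
  rw [Function.iterate_mul]
  exact Function.iterate_fixed hp.2.1 k

theorem AttractingPeriodic.mem_basin {f : X → X} {n : ℕ} {p : X}
    (hp : AttractingPeriodic f n p) : p ∈ basin f :=
  ⟨0, n, p, hp, by simp [hp.iterate_mul_eq]⟩

theorem AttractingPeriodic.exists_contraction {f : X → X} {n : ℕ} {p : X}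
    (hp : AttractingPeriodic f n p) : ∃ κ, 0 < κ ∧ κ < 1 ∧ ∃ ρ > 0, ∀ y, dist y p < ρ → ∀ k,
      dist (f^[n * k] y) p ≤ κ ^ k * dist y p := by
  obtain ⟨hn, hfix, κ, hκ, ρ, hρ, h⟩ := hp
  refine ⟨max κ (1 / 2), by positivity, max_lt hκ (by norm_num), ρ, hρ, fun y hy k => ?_⟩
  induction k with
  | zero => simp
  | succ k ih =>
    have h1 : max κ (1 / 2) ^ k ≤ 1 :=
      pow_le_one₀ (by positivity) (max_lt hκ (by norm_num)).le
    have h2 : dist (f^[n * k] y) p < ρ :=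
      (ih.trans (mul_le_of_le_one_left dist_nonneg h1)).trans_lt hy
    rw [Nat.mul_succ, add_comm, Function.iterate_add_apply]
    calc dist (f^[n] (f^[n * k] y)) p ≤ κ * dist (f^[n * k] y) p := h _ h2
      _ ≤ max κ (1 / 2) * dist (f^[n * k] y) p := by gcongr; exact le_max_left _ _
      _ ≤ max κ (1 / 2) * (max κ (1 / 2) ^ k * dist y p) := by gcongr
      _ = _ := by ring

/-- Attracting periodic points have a neighbourhood on which the iterates are equicontinuous. -/
theorem AttractingPeriodic.equicontinuous {f : X → X} (hf : Continuous f) {n : ℕ} {p : X}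
    (hp : AttractingPeriodic f n p) : ∃ ρ > 0, ∀ x, dist x p < ρ →
      ∀ ε > 0, ∃ δ > 0, ∀ n : ℕ, ∀ y, dist y x < δ → dist (f^[n] y) (f^[n] x) < ε := by
  obtain ⟨κ, hκ0, hκ, ρ, hρ, h⟩ := hp.exists_contraction
  refine ⟨ρ, hρ, fun x hx ε hε => ?_⟩
  have hn := hp.1
  have h1 : ∀ᶠ y in 𝓝 p, ∀ j ∈ Finset.range n, dist (f^[j] y) (f^[j] p) < ε / 2 := by
    rw [Filter.eventually_all_finset]
    intro j _
    exact ((hf.iterate j).continuousAt.eventually (ball_mem_nhds _ (half_pos hε)))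
  obtain ⟨δ₁, hδ₁, h1⟩ := Metric.eventually_nhds_iff.1 h1
  have h2 : ∀ᶠ k : ℕ in atTop, κ ^ k * ρ < δ₁ := by
    have := (tendsto_pow_atTop_nhds_zero_of_lt_one hκ0.le hκ).mul_const ρ
    rw [zero_mul] at this
    exact this.eventually (gt_mem_nhds hδ₁)
  obtain ⟨k₀, hk₀⟩ := eventually_atTop.1 h2
  have hlate : ∀ y, dist y p < ρ → ∀ m ≥ n * k₀,
      dist (f^[m] y) (f^[m % n] p) < ε / 2 := by
    intro y hy m hm
    have hk : k₀ ≤ m / n := by rwa [Nat.le_div_iff_mul_le hn, mul_comm]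
    have : f^[m] y = f^[m % n] (f^[n * (m / n)] y) := by
      rw [← Function.iterate_add_apply, Nat.mod_add_div]
    rw [this]
    refine h1 ?_ _ (Finset.mem_range.2 (Nat.mod_lt _ hn))
    calc _ ≤ κ ^ (m / n) * dist y p := h y hy _
      _ ≤ κ ^ (m / n) * ρ := by gcongr
      _ < δ₁ := hk₀ _ hk
  have h3 : ∀ᶠ y in 𝓝 x, ∀ m ∈ Finset.range (n * k₀), dist (f^[m] y) (f^[m] x) < ε := by
    rw [Filter.eventually_all_finset]
    intro j _
    exact ((hf.iterate j).continuousAt.eventually (ball_mem_nhds _ hε))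
  have h4 : ∀ᶠ y in 𝓝 x, dist y p < ρ := isOpen_ball.mem_nhds hx
  obtain ⟨δ, hδ, h5⟩ := Metric.eventually_nhds_iff.1 (h3.and h4)
  refine ⟨δ, hδ, fun m y hy => ?_⟩
  rcases lt_or_ge m (n * k₀) with hm | hm
  · exact (h5 hy).1 m (Finset.mem_range.2 hm)
  · calc _ ≤ _ := dist_triangle_right _ _ (f^[m % n] p)
      _ < ε / 2 + ε / 2 := add_lt_add (hlate y (h5 hy).2 m hm) (hlate x hx m hm)
      _ = ε := add_halves ε

/-- `w` is a Lyapunov function for the region `{w < 1}`: it is contracted by `f` there, the region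
lies in the basins, and every nonperiodic point `z` is left behind, that is, orbits starting in the
region do not hit `z` after a time that depends only on `z`. -/
structure IsTrap (f : X → X) (w : X → ℝ) : Prop where
  continuous : Continuous w
  nonneg : ∀ x, 0 ≤ w x
  contract : ∃ t, 0 ≤ t ∧ t < 1 ∧ ∀ x, w x < 1 → w (f x) ≤ t * w x
  mem_basin : ∀ x, w x < 1 → x ∈ basin f
  escape : ∀ z, z ∉ Function.periodicPts f → ∃ n₀, ∀ n ≥ n₀, ∀ x, w x < 1 → f^[n] x ≠ z

theorem IsTrap.min {f : X → X} {w₁ w₂ : X → ℝ} (h₁ : IsTrap f w₁) (h₂ : IsTrap f w₂) :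
    IsTrap f (fun x => min (w₁ x) (w₂ x)) := by
  obtain ⟨t₁, ht₁0, ht₁, hc₁⟩ := h₁.contract
  obtain ⟨t₂, ht₂0, ht₂, hc₂⟩ := h₂.contract
  refine ⟨h₁.continuous.min h₂.continuous, fun x => le_min (h₁.nonneg x) (h₂.nonneg x),
    ⟨max t₁ t₂, le_max_of_le_left ht₁0, max_lt ht₁ ht₂, fun x hx => ?_⟩, fun x hx => ?_,
    fun z hz => ?_⟩
  · rcases le_total (w₁ x) (w₂ x) with h | h
    · rw [min_eq_left h] at hx ⊢
      refine (min_le_left _ _).trans ((hc₁ x hx).trans ?_)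
      exact mul_le_mul_of_nonneg_right (le_max_left _ _) (h₁.nonneg x)
    · rw [min_eq_right h] at hx ⊢
      refine (min_le_right _ _).trans ((hc₂ x hx).trans ?_)
      exact mul_le_mul_of_nonneg_right (le_max_right _ _) (h₂.nonneg x)
  · exact (min_lt_iff.1 hx).elim (h₁.mem_basin x) (h₂.mem_basin x)
  · obtain ⟨n₁, hn₁⟩ := h₁.escape z hz
    obtain ⟨n₂, hn₂⟩ := h₂.escape z hz
    exact ⟨max n₁ n₂, fun n hn x hx => (min_lt_iff.1 hx).elim
      (hn₁ n (le_of_max_le_left hn) x) (hn₂ n (le_of_max_le_right hn) x)⟩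

theorem IsTrap.comp_iterate {f : X → X} (hf : Continuous f) {w : X → ℝ} (h : IsTrap f w) (N : ℕ) :
    IsTrap f (fun x => w (f^[N] x)) := by
  obtain ⟨t, ht0, ht, hc⟩ := h.contract
  refine ⟨h.continuous.comp (hf.iterate N), fun x => h.nonneg _, ⟨t, ht0, ht, fun x hx => ?_⟩,
    fun x hx => mem_basin_of_iterate_mem N (h.mem_basin _ hx), fun z hz => ?_⟩
  · rw [← Function.iterate_succ_apply, Function.iterate_succ_apply']
    exact hc _ hx
  · obtain ⟨n₀, hn₀⟩ := h.escape z hz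
    refine ⟨n₀ + N, fun n hn x hx => ?_⟩
    have := hn₀ (n - N) (by omega) _ hx
    rwa [← Function.iterate_add_apply, Nat.sub_add_cancel (by omega)] at this

/-- A Lyapunov function is a multiple of `min_{j < n} τ ^ j * dist (f^[j] x) p`, where `τ > 1` is
so close to `1` that `τ ^ n` times the contraction rate of `f^[n]` at `p` is less than `1`. -/
theorem AttractingPeriodic.exists_isTrap {f : X → X} (hf : Continuous f) {n : ℕ} {p : X}
    (hp : AttractingPeriodic f n p) : ∃ w, IsTrap f w ∧ w p < 1 := by
  obtain ⟨κ, hκ0, hκ, ρ, hρ, h⟩ := hp.exists_contraction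
  have hn := hp.1
  obtain ⟨τ, hτκ, hτ⟩ : ∃ τ : ℝ, τ ^ n * κ < 1 ∧ 1 < τ := by
    have h1 : ∀ᶠ τ : ℝ in 𝓝 1, τ ^ n * κ < 1 := by
      refine (((continuous_pow n).mul continuous_const).tendsto' 1 κ (by simp)).eventually
        (gt_mem_nhds hκ)
    exact ((h1.filter_mono nhdsWithin_le_nhds).and
      (self_mem_nhdsWithin : Ioi (1 : ℝ) ∈ 𝓝[>] 1)).exists
  have hτ0 : 0 < τ := by linarith
  have hne : (Finset.range n).Nonempty := ⟨0, Finset.mem_range.2 hn⟩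
  set v : X → ℝ := fun x => (Finset.range n).inf' hne (fun j => τ ^ j * dist (f^[j] x) p) with hv
  have hvc : Continuous v := by
    refine Continuous.finset_inf'_apply hne fun j _ => ?_
    exact continuous_const.mul ((hf.iterate j).dist continuous_const)
  have hv0 : ∀ x, 0 ≤ v x := fun x => by
    rw [hv]; simp only [Finset.le_inf'_iff]; intro j _; positivity
  have hvle : ∀ x, ∀ j < n, v x ≤ τ ^ j * dist (f^[j] x) p := fun x j hj =>
    Finset.inf'_le (f := fun j => τ ^ j * dist (f^[j] x) p) (Finset.mem_range.2 hj)
  have hvex : ∀ x, ∃ j < n, v x = τ ^ j * dist (f^[j] x) p := fun x => by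
    obtain ⟨j, hj, h⟩ := Finset.exists_mem_eq_inf' hne (fun j => τ ^ j * dist (f^[j] x) p)
    exact ⟨j, Finset.mem_range.1 hj, h⟩
  have hnear : ∀ x, v x < ρ → ∃ j < n, dist (f^[j] x) p < ρ := fun x hx => by
    obtain ⟨j, hj, h⟩ := hvex x
    refine ⟨j, hj, ?_⟩
    have : dist (f^[j] x) p ≤ τ ^ j * dist (f^[j] x) p :=
      le_mul_of_one_le_left dist_nonneg (one_le_pow₀ hτ.le)
    linarith
  have hw : ∀ x, ρ⁻¹ * v x < 1 ↔ v x < ρ := fun x => by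
    rw [inv_mul_lt_iff₀ hρ, mul_one]
  refine ⟨fun x => ρ⁻¹ * v x, ⟨continuous_const.mul hvc,
    fun x => mul_nonneg (by positivity) (hv0 x),
    ⟨τ⁻¹, by positivity, inv_lt_one_of_one_lt₀ hτ, fun x hx => ?_⟩, fun x hx => ?_,
    fun z hz => ?_⟩, ?_⟩
  · rw [hw] at hx
    suffices hs : v (f x) ≤ τ⁻¹ * v x by
      calc ρ⁻¹ * v (f x) ≤ ρ⁻¹ * (τ⁻¹ * v x) := by gcongr
        _ = _ := by ring
    rw [← div_eq_inv_mul, le_div_iff₀ hτ0]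
    obtain ⟨j, hj, hvj⟩ := hvex x
    rcases Nat.eq_zero_or_eq_succ_pred j with h0 | h0
    -- if the minimum is attained at `j = 0`, then `f^[n]` has to be used, otherwise a shift of `j`
    · subst h0
      simp only [pow_zero, one_mul, Function.iterate_zero, id_eq] at hvj
      have h1 := hvle (f x) (n - 1) (by omega)
      have h2 := h x (by linarith) 1
      rw [← Function.iterate_succ_apply, Nat.succ_eq_add_one, Nat.sub_add_cancel hn] at h1
      rw [mul_one, pow_one] at h2
      calc v (f x) * τ ≤ (τ ^ (n - 1) * dist (f^[n] x) p) * τ := by gcongr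
        _ = τ ^ n * dist (f^[n] x) p := by
          conv_rhs => rw [← Nat.sub_add_cancel hn, pow_succ]
          ring_nf
          rw [show 1 + (n - 1) = n from by omega]
        _ ≤ τ ^ n * (κ * dist x p) := by gcongr
        _ = (τ ^ n * κ) * dist x p := by ring
        _ ≤ 1 * dist x p := by gcongr
        _ = v x := by rw [hvj, one_mul]
    · have h1 := hvle (f x) j.pred (by omega)
      rw [← Function.iterate_succ_apply, ← h0] at h1
      calc v (f x) * τ ≤ (τ ^ j.pred * dist (f^[j] x) p) * τ := by gcongr
        _ = τ ^ j.pred.succ * dist (f^[j] x) p := by rw [pow_succ]; ring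
        _ = v x := by rw [hvj, ← h0]
  · obtain ⟨j, -, hj⟩ := hnear x ((hw x).1 hx)
    refine ⟨j, n, p, hp, ?_⟩
    rw [tendsto_iff_dist_tendsto_zero]
    have := (tendsto_pow_atTop_nhds_zero_of_lt_one hκ0.le hκ).mul_const (dist (f^[j] x) p)
    rw [zero_mul] at this
    exact squeeze_zero (fun _ => dist_nonneg) (fun k => h _ hj k) this
  -- the orbits converge uniformly to the orbit of `p`, which does not contain `z`
  · have hzi : ∀ i, f^[i] p ≠ z := by
      rintro i rfl
      refine hz ⟨n, hn, ?_⟩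
      change f^[n] (f^[i] p) = f^[i] p
      rw [← Function.iterate_add_apply, add_comm, Function.iterate_add_apply, hp.2.1]
    have h1 : ∀ᶠ y in 𝓝 p, ∀ i ∈ Finset.range n, f^[i] y ≠ z := by
      rw [Filter.eventually_all_finset]
      intro j _
      exact (hf.iterate j).continuousAt.eventually (isOpen_compl_singleton.mem_nhds (hzi j))
    obtain ⟨δ, hδ, h1⟩ := Metric.eventually_nhds_iff.1 h1
    have h2 : ∀ᶠ k : ℕ in atTop, κ ^ k * ρ < δ := by
      have := (tendsto_pow_atTop_nhds_zero_of_lt_one hκ0.le hκ).mul_const ρ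
      rw [zero_mul] at this
      exact this.eventually (gt_mem_nhds hδ)
    obtain ⟨k₀, hk₀⟩ := eventually_atTop.1 h2
    refine ⟨n * k₀ + n, fun N hN x hx => ?_⟩
    obtain ⟨j, hjn, hj⟩ := hnear x ((hw x).1 hx)
    have hk : k₀ ≤ (N - j) / n := by
      rw [Nat.le_div_iff_mul_le hn, mul_comm]; omega
    have : f^[N] x = f^[(N - j) % n] (f^[n * ((N - j) / n)] (f^[j] x)) := by
      rw [← Function.iterate_add_apply, ← Function.iterate_add_apply, Nat.mod_add_div,
        Nat.sub_add_cancel (by omega)]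
    rw [this]
    refine h1 ?_ _ (Finset.mem_range.2 (Nat.mod_lt _ hn))
    calc _ ≤ κ ^ ((N - j) / n) * dist (f^[j] x) p := h _ hj _
      _ ≤ κ ^ ((N - j) / n) * ρ := by gcongr
      _ < δ := hk₀ _ hk
  · rw [hw]
    have := hvle p 0 hn
    simp only [pow_zero, one_mul, Function.iterate_zero, id_eq, dist_self] at this
    linarith

theorem exists_isTrap_of_mem_basin {f : X → X} (hf : Continuous f) {x : X} (hx : x ∈ basin f) :
    ∃ w, IsTrap f w ∧ w x < 1 := by
  obtain ⟨j, n, p, hp, ht⟩ := hx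
  obtain ⟨w, hw, hwp⟩ := hp.exists_isTrap hf
  obtain ⟨k, hk⟩ := ((hw.continuous.tendsto p).comp ht |>.eventually (gt_mem_nhds hwp)).exists
  refine ⟨_, hw.comp_iterate hf (n * k + j), ?_⟩
  rwa [Function.iterate_add_apply]

/-- Pointwise minima of Lyapunov functions are Lyapunov functions, so finitely many of them cover
a compact set. -/
theorem exists_isTrap_of_isCompact {f : X → X} (hf : Continuous f) {Z : Set X}
    (hZ : IsCompact Z) (hne : Z.Nonempty) (hsub : Z ⊆ basin f) :
    ∃ w, IsTrap f w ∧ ∃ σ < 1, ∀ x ∈ Z, w x < σ := by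
  obtain ⟨w, hw, hwZ⟩ : ∃ w, IsTrap f w ∧ ∀ x ∈ Z, w x < 1 := by
    refine hZ.induction_on (p := fun s => ∃ w, IsTrap f w ∧ ∀ x ∈ s, w x < 1) ?_ ?_ ?_ ?_
    · obtain ⟨z, hz⟩ := hne
      obtain ⟨w, hw, -⟩ := exists_isTrap_of_mem_basin hf (hsub hz)
      exact ⟨w, hw, by simp⟩
    · rintro s t hst ⟨w, hw, h⟩
      exact ⟨w, hw, fun x hx => h x (hst hx)⟩
    · rintro s t ⟨w₁, hw₁, h₁⟩ ⟨w₂, hw₂, h₂⟩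
      exact ⟨_, hw₁.min hw₂, fun x hx => min_lt_iff.2 (hx.imp (h₁ x) (h₂ x))⟩
    · intro x hx
      obtain ⟨w, hw, h⟩ := exists_isTrap_of_mem_basin hf (hsub hx)
      exact ⟨{y | w y < 1}, mem_nhdsWithin_of_mem_nhds
        ((isOpen_lt hw.continuous continuous_const).mem_nhds h), w, hw, fun y hy => hy⟩
  obtain ⟨z, hz, hmax⟩ := hZ.exists_isMaxOn hne hw.continuous.continuousOn
  obtain ⟨σ, h1, h2⟩ := exists_between (hwZ z hz)
  exact ⟨w, hw, σ, h2, fun x hx => (hmax hx).trans_lt h1⟩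

end Basins

/-! ### The projective line -/

/-- The determinant of two vectors of `ℂ²`. -/
def wedge (x y : Fin 2 → ℂ) : ℂ := x 0 * y 1 - x 1 * y 0

theorem euclNorm_eq (v : Fin 2 → ℂ) :
    euclNorm v = ‖(WithLp.toLp 2 v : EuclideanSpace ℂ (Fin 2))‖ := by
  rw [EuclideanSpace.norm_eq, euclNorm, Fin.sum_univ_two]

theorem euclNorm_add_le (v w : Fin 2 → ℂ) : euclNorm (v + w) ≤ euclNorm v + euclNorm w := by
  simp only [euclNorm_eq, WithLp.toLp_add]
  exact norm_add_le _ _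

theorem euclNorm_smul (a : ℂ) (v : Fin 2 → ℂ) : euclNorm (a • v) = ‖a‖ * euclNorm v := by
  simp only [euclNorm_eq, WithLp.toLp_smul]
  exact norm_smul _ _

theorem euclNorm_nonneg (v : Fin 2 → ℂ) : 0 ≤ euclNorm v := Real.sqrt_nonneg _

theorem euclNorm_eq_zero {v : Fin 2 → ℂ} : euclNorm v = 0 ↔ v = 0 := by
  rw [euclNorm_eq, norm_eq_zero]
  exact (WithLp.toLp_injective 2).eq_iff' rfl

theorem euclNorm_pos {v : Fin 2 → ℂ} (hv : v ≠ 0) : 0 < euclNorm v :=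
  (euclNorm_nonneg v).lt_of_ne' (mt euclNorm_eq_zero.1 hv)

theorem continuous_euclNorm : Continuous euclNorm := by
  unfold euclNorm; fun_prop

theorem euclNorm_sq (v : Fin 2 → ℂ) : euclNorm v ^ 2 = ‖v 0‖ ^ 2 + ‖v 1‖ ^ 2 :=
  Real.sq_sqrt (by positivity)

theorem norm_apply_le_euclNorm (v : Fin 2 → ℂ) (i : Fin 2) : ‖v i‖ ≤ euclNorm v := by
  refine Real.le_sqrt_of_sq_le ?_
  fin_cases i <;> simp

theorem wedge_smul_left (a : ℂ) (v w : Fin 2 → ℂ) : wedge (a • v) w = a * wedge v w := by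
  simp only [wedge, Pi.smul_apply, smul_eq_mul]; ring

theorem wedge_smul_right (a : ℂ) (v w : Fin 2 → ℂ) : wedge v (a • w) = a * wedge v w := by
  simp only [wedge, Pi.smul_apply, smul_eq_mul]; ring

theorem wedge_swap (v w : Fin 2 → ℂ) : wedge w v = -wedge v w := by
  simp only [wedge]; ring

theorem wedge_mulVec (U : Matrix (Fin 2) (Fin 2) ℂ) (v w : Fin 2 → ℂ) :
    wedge (U *ᵥ v) (U *ᵥ w) = U.det * wedge v w := by
  simp only [wedge, Matrix.mulVec, dotProduct, Fin.sum_univ_two, Matrix.det_fin_two]; ring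

theorem toProj_of_ne_zero {n : ℕ} {v : Fin (n + 1) → ℂ} (hv : v ≠ 0) :
    toProj v = Projectivization.mk ℂ v hv := dif_pos hv

theorem toProj_rep {n : ℕ} (p : ℙ ℂ (Fin (n + 1) → ℂ)) : toProj p.rep = p := by
  rw [toProj_of_ne_zero p.rep_nonzero, p.mk_rep]

theorem toProj_smul {n : ℕ} {v : Fin (n + 1) → ℂ} {a : ℂ} (ha : a ≠ 0) (hv : v ≠ 0) :
    toProj (a • v) = toProj v := by
  rw [toProj_of_ne_zero hv, toProj_of_ne_zero (smul_ne_zero ha hv),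
    Projectivization.mk_eq_mk_iff']
  exact ⟨a, rfl⟩

theorem exists_rep_toProj {n : ℕ} {v : Fin (n + 1) → ℂ} (hv : v ≠ 0) :
    ∃ a : ℂ, a ≠ 0 ∧ (toProj v).rep = a • v := by
  rw [toProj_of_ne_zero hv]
  obtain ⟨a, ha⟩ := Projectivization.exists_smul_eq_mk_rep ℂ v hv
  exact ⟨a, a.ne_zero, ha.symm⟩

theorem toProj_eq_toProj_iff {n : ℕ} {v w : Fin (n + 1) → ℂ} (hv : v ≠ 0) (hw : w ≠ 0) :
    toProj v = toProj w ↔ ∃ a : ℂ, a • w = v := by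
  rw [toProj_of_ne_zero hv, toProj_of_ne_zero hw, Projectivization.mk_eq_mk_iff']

theorem wedge_eq_zero_iff {v w : Fin 2 → ℂ} (hv : v ≠ 0) (hw : w ≠ 0) :
    wedge v w = 0 ↔ toProj v = toProj w := by
  rw [toProj_eq_toProj_iff hv hw]
  constructor
  · intro h
    rw [wedge, sub_eq_zero] at h
    by_cases h0 : w 0 = 0
    · have h1 : w 1 ≠ 0 := fun h1 => hw (by ext i; fin_cases i <;> simp [h0, h1])
      refine ⟨v 1 / w 1, ?_⟩
      ext i; fin_cases i
      · have : v 0 = 0 := by simpa [h0, h1] using h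
        simp [h0, this]
      · simp [h1]
    · refine ⟨v 0 / w 0, ?_⟩
      ext i; fin_cases i
      · simp [h0]
      · simp only [Pi.smul_apply, smul_eq_mul, Fin.mk_one]
        field_simp; linear_combination h
  · rintro ⟨a, rfl⟩
    rw [wedge_smul_left]; simp only [wedge]; ring

theorem chordal_toProj {v w : Fin 2 → ℂ} (hv : v ≠ 0) (hw : w ≠ 0) :
    chordal (toProj v) (toProj w) = ‖wedge v w‖ / (euclNorm v * euclNorm w) := by
  obtain ⟨a, ha, h1⟩ := exists_rep_toProj hv
  obtain ⟨b, hb, h2⟩ := exists_rep_toProj hw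
  change ‖wedge (toProj v).rep (toProj w).rep‖ / _ = _
  rw [h1, h2, wedge_smul_left, wedge_smul_right, euclNorm_smul, euclNorm_smul, norm_mul, norm_mul]
  have := norm_ne_zero_iff.2 ha
  have := norm_ne_zero_iff.2 hb
  have := (euclNorm_pos hv).ne'
  have := (euclNorm_pos hw).ne'
  field_simp

/-- The triangle inequality follows from the relation `(x ∧ z) y = (y ∧ z) x + (x ∧ y) z` between
three vectors of `ℂ²`. -/
theorem chordal_triangle (p q r : P1) : chordal p r ≤ chordal p q + chordal q r := by
  set x := p.rep
  set y := q.rep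
  set z := r.rep
  have hx := euclNorm_pos p.rep_nonzero
  have hy := euclNorm_pos q.rep_nonzero
  have hz := euclNorm_pos r.rep_nonzero
  have key : wedge x z • y = wedge y z • x + wedge x y • z := by
    ext i; fin_cases i <;> simp [wedge] <;> ring
  have h1 : ‖wedge x z‖ * euclNorm y ≤ ‖wedge y z‖ * euclNorm x + ‖wedge x y‖ * euclNorm z := by
    rw [← euclNorm_smul, key, ← euclNorm_smul, ← euclNorm_smul]
    exact euclNorm_add_le _ _
  change ‖wedge x z‖ / (euclNorm x * euclNorm z) ≤ ‖wedge x y‖ / (euclNorm x * euclNorm y) +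
    ‖wedge y z‖ / (euclNorm y * euclNorm z)
  rw [div_add_div _ _ (by positivity) (by positivity),
    div_le_div_iff₀ (by positivity) (by positivity)]
  calc ‖wedge x z‖ * (euclNorm x * euclNorm y * (euclNorm y * euclNorm z))
      = (‖wedge x z‖ * euclNorm y) * (euclNorm x * euclNorm y * euclNorm z) := by ring
    _ ≤ (‖wedge y z‖ * euclNorm x + ‖wedge x y‖ * euclNorm z) *
        (euclNorm x * euclNorm y * euclNorm z) := by gcongr
    _ = _ := by ring

/-- The projective line as a metric space with the chordal metric. The topology is the one of this
metric; by `isQuotientMap_toP1` it is the quotient topology of the unit sphere of `ℂ²`. -/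
noncomputable instance instMetricSpaceP1 : MetricSpace P1 where
  dist := chordal
  dist_self p := by
    change ‖wedge p.rep p.rep‖ / _ = 0
    simp [wedge, mul_comm]
  dist_comm p q := by
    change ‖wedge p.rep q.rep‖ / _ = ‖wedge q.rep p.rep‖ / _
    rw [wedge_swap, norm_neg, mul_comm]
  dist_triangle := chordal_triangle
  eq_of_dist_eq_zero {p q} h := by
    change ‖wedge p.rep q.rep‖ / _ = 0 at h
    have := (mul_pos (euclNorm_pos p.rep_nonzero) (euclNorm_pos q.rep_nonzero)).ne'
    rw [div_eq_zero_iff, or_iff_left this, norm_eq_zero,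
      wedge_eq_zero_iff p.rep_nonzero q.rep_nonzero, toProj_rep, toProj_rep] at h
    exact h

theorem dist_eq_chordal (p q : P1) : dist p q = chordal p q := rfl

theorem continuous_wedge_left (w : Fin 2 → ℂ) : Continuous (fun v => wedge v w) := by
  unfold wedge; fun_prop

/-- `toProj` with values in `P1`; the types agree only up to unfolding `1 + 1 = 2`. -/
noncomputable def toP1 (v : Fin 2 → ℂ) : P1 := toProj v

theorem continuousAt_toP1 {v : Fin 2 → ℂ} (hv : v ≠ 0) :
    ContinuousAt toP1 v := by
  rw [ContinuousAt, tendsto_iff_dist_tendsto_zero]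
  have h1 : ∀ᶠ w in 𝓝 v, w ≠ 0 := isOpen_compl_singleton.mem_nhds hv
  have h2 : Tendsto (fun w => ‖wedge w v‖ / (euclNorm w * euclNorm v)) (𝓝 v) (𝓝 0) := by
    have hc : ContinuousAt (fun w => ‖wedge w v‖ / (euclNorm w * euclNorm v)) v :=
      ((continuous_wedge_left v).norm.continuousAt).div
        (continuous_euclNorm.mul continuous_const).continuousAt
        (mul_pos (euclNorm_pos hv) (euclNorm_pos hv)).ne'
    have h0 : wedge v v = 0 := by simp only [wedge]; ring
    simpa [ContinuousAt, h0] using hc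
  refine h2.congr' ?_
  filter_upwards [h1] with w hw
  rw [dist_eq_chordal, toP1, toP1, chordal_toProj hw hv]

theorem isCompact_euclSphere : IsCompact {v : Fin 2 → ℂ | euclNorm v = 1} := by
  refine Metric.isCompact_of_isClosed_isBounded
    (isClosed_eq continuous_euclNorm continuous_const) ?_
  refine (isBounded_closedBall (x := 0) (r := 1)).subset fun v hv => ?_
  rw [mem_closedBall_zero_iff, pi_norm_le_iff_of_nonneg zero_le_one]
  intro i
  exact (norm_apply_le_euclNorm v i).trans_eq hv

theorem ne_zero_of_euclNorm {v : Fin 2 → ℂ} (hv : euclNorm v = 1) : v ≠ 0 := by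
  rintro rfl
  rw [euclNorm_eq_zero.2 rfl] at hv
  exact zero_ne_one hv

theorem exists_unit_rep (p : P1) : ∃ v, euclNorm v = 1 ∧ toProj v = p := by
  have h := euclNorm_pos p.rep_nonzero
  refine ⟨((euclNorm p.rep : ℂ)⁻¹) • p.rep, ?_, ?_⟩
  · rw [euclNorm_smul, norm_inv, Complex.norm_real, Real.norm_of_nonneg h.le,
      inv_mul_cancel₀ h.ne']
  · rw [toProj_smul (inv_ne_zero (by exact_mod_cast h.ne')) p.rep_nonzero, toProj_rep]

theorem isQuotientMap_toP1 :
    IsQuotientMap (fun v : {v : Fin 2 → ℂ // euclNorm v = 1} => toP1 v.1) := by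
  have hc : Continuous (fun v : {v : Fin 2 → ℂ // euclNorm v = 1} => toP1 v.1) :=
    continuous_iff_continuousAt.2 fun v =>
      (continuousAt_toP1 (ne_zero_of_euclNorm v.2)).comp continuous_subtype_val.continuousAt
  have : CompactSpace {v : Fin 2 → ℂ // euclNorm v = 1} :=
    isCompact_iff_compactSpace.1 isCompact_euclSphere
  refine hc.isClosedMap.isQuotientMap hc fun p => ?_
  obtain ⟨v, h1, h2⟩ := exists_unit_rep p
  exact ⟨⟨v, h1⟩, h2⟩

instance : CompactSpace P1 := by
  have : CompactSpace {v : Fin 2 → ℂ // euclNorm v = 1} :=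
    isCompact_iff_compactSpace.1 isCompact_euclSphere
  exact isQuotientMap_toP1.surjective.compactSpace isQuotientMap_toP1.continuous

/-! ### Affine coordinates on the projective line -/

section Chart

variable {U : Matrix (Fin 2) (Fin 2) ℂ}

theorem unitary_mul_conjTranspose (hU : U ∈ Matrix.unitaryGroup (Fin 2) ℂ) : U * Uᴴ = 1 :=
  Matrix.mem_unitaryGroup_iff.1 hU

theorem unitary_conjTranspose_mul (hU : U ∈ Matrix.unitaryGroup (Fin 2) ℂ) : Uᴴ * U = 1 :=
  Matrix.mem_unitaryGroup_iff'.1 hU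

theorem mulVec_conjTranspose_mulVec (hU : U ∈ Matrix.unitaryGroup (Fin 2) ℂ) (v : Fin 2 → ℂ) :
    U *ᵥ (Uᴴ *ᵥ v) = v := by
  rw [Matrix.mulVec_mulVec, unitary_mul_conjTranspose hU, Matrix.one_mulVec]

theorem conjTranspose_mulVec_mulVec (hU : U ∈ Matrix.unitaryGroup (Fin 2) ℂ) (v : Fin 2 → ℂ) :
    Uᴴ *ᵥ (U *ᵥ v) = v := by
  rw [Matrix.mulVec_mulVec, unitary_conjTranspose_mul hU, Matrix.one_mulVec]

theorem norm_det_unitary (hU : U ∈ Matrix.unitaryGroup (Fin 2) ℂ) : ‖U.det‖ = 1 := by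
  have h := congrArg Matrix.det (unitary_mul_conjTranspose hU)
  rw [Matrix.det_mul, Matrix.det_conjTranspose, Matrix.det_one] at h
  have h2 := congrArg norm h
  rw [norm_mul, norm_star, norm_one] at h2
  nlinarith [norm_nonneg U.det]

theorem unitary_mulVec_ne_zero (hU : U ∈ Matrix.unitaryGroup (Fin 2) ℂ) {v : Fin 2 → ℂ}
    (hv : v ≠ 0) : U *ᵥ v ≠ 0 := fun h => hv (by
  rw [← conjTranspose_mulVec_mulVec hU v, h, Matrix.mulVec_zero])

theorem euclNorm_unitary_mulVec (hU : U ∈ Matrix.unitaryGroup (Fin 2) ℂ) (v : Fin 2 → ℂ) :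
    euclNorm (U *ᵥ v) = euclNorm v := by
  have key : ∀ w : Fin 2 → ℂ, ((euclNorm w ^ 2 : ℝ) : ℂ) = star w ⬝ᵥ w := fun w => by
    rw [euclNorm_sq]
    simp only [dotProduct, Fin.sum_univ_two, Pi.star_apply, RCLike.star_def]
    rw [← Complex.normSq_eq_conj_mul_self, ← Complex.normSq_eq_conj_mul_self,
      Complex.normSq_eq_norm_sq, Complex.normSq_eq_norm_sq]
    push_cast; rfl
  have h : euclNorm (U *ᵥ v) ^ 2 = euclNorm v ^ 2 := by
    apply Complex.ofReal_injective
    rw [key, key, Matrix.star_mulVec, ← Matrix.dotProduct_mulVec, conjTranspose_mulVec_mulVec hU]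
  exact (pow_left_inj₀ (euclNorm_nonneg _) (euclNorm_nonneg _) two_ne_zero).1 h

theorem vec_one_ne_zero (u : ℂ) : (![u, 1] : Fin 2 → ℂ) ≠ 0 := fun h => by
  simpa using congrFun h 1

theorem vec_ne_zero_one : (![1, 0] : Fin 2 → ℂ) ≠ 0 := fun h => by
  simpa using congrFun h 0

/-- The point of `L_∞` with affine coordinate `u`. -/
noncomputable def aff (U : Matrix (Fin 2) (Fin 2) ℂ) (u : ℂ) : P1 := toProj (U *ᵥ ![u, 1])

theorem continuous_aff (hU : U ∈ Matrix.unitaryGroup (Fin 2) ℂ) : Continuous (aff U) := by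
  refine continuous_iff_continuousAt.2 fun u => ?_
  have h1 : Continuous fun u : ℂ => U *ᵥ ![u, 1] := by
    refine Continuous.matrix_mulVec continuous_const ?_
    exact continuous_pi fun i => by fin_cases i <;> simp <;> fun_prop
  exact ContinuousAt.comp (f := fun u : ℂ => U *ᵥ ![u, 1])
    (continuousAt_toP1 (unitary_mulVec_ne_zero hU (vec_one_ne_zero u))) h1.continuousAt

theorem wedge_affine (u v : ℂ) : wedge ![u, 1] ![v, 1] = u - v := by simp [wedge]

theorem det_unitary_ne_zero (hU : U ∈ Matrix.unitaryGroup (Fin 2) ℂ) : U.det ≠ 0 := fun h => by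
  have := norm_det_unitary hU
  simp [h] at this

theorem aff_injective (hU : U ∈ Matrix.unitaryGroup (Fin 2) ℂ) : Function.Injective (aff U) := by
  intro u v h
  rw [aff, aff, ← wedge_eq_zero_iff (unitary_mulVec_ne_zero hU (vec_one_ne_zero u))
    (unitary_mulVec_ne_zero hU (vec_one_ne_zero v)), wedge_mulVec, wedge_affine] at h
  exact sub_eq_zero.1 ((mul_eq_zero.1 h).resolve_left (det_unitary_ne_zero hU))

theorem dist_aff_missedPoint (hU : U ∈ Matrix.unitaryGroup (Fin 2) ℂ) (u : ℂ) :
    dist (aff U u) (missedPoint U) = (Real.sqrt (1 + ‖u‖ ^ 2))⁻¹ := by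
  rw [dist_eq_chordal, aff, missedPoint, chordal_toProj
    (unitary_mulVec_ne_zero hU (vec_one_ne_zero u)) (unitary_mulVec_ne_zero hU vec_ne_zero_one),
    wedge_mulVec, norm_mul, norm_det_unitary hU, euclNorm_unitary_mulVec hU,
    euclNorm_unitary_mulVec hU]
  simp [wedge, euclNorm, add_comm]

theorem aff_ne_missedPoint (hU : U ∈ Matrix.unitaryGroup (Fin 2) ℂ) (u : ℂ) :
    aff U u ≠ missedPoint U := by
  rw [← dist_pos, dist_aff_missedPoint hU]
  positivity

theorem toProj_eq_aff (hU : U ∈ Matrix.unitaryGroup (Fin 2) ℂ) {x y : ℂ} (hy : y ≠ 0) :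
    toProj (U *ᵥ ![x, y]) = aff U (x / y) := by
  have : U *ᵥ ![x, y] = y • (U *ᵥ ![x / y, 1]) := by
    rw [← Matrix.mulVec_smul]
    congr 1
    ext i; fin_cases i <;> simp; field_simp
  rw [this, toProj_smul hy (unitary_mulVec_ne_zero hU (vec_one_ne_zero _)), aff]

theorem toProj_eq_missedPoint (hU : U ∈ Matrix.unitaryGroup (Fin 2) ℂ) {x : ℂ} (hx : x ≠ 0) :
    toProj (U *ᵥ ![x, 0]) = missedPoint U := by
  have : U *ᵥ ![x, 0] = x • (U *ᵥ ![1, 0]) := by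
    rw [← Matrix.mulVec_smul]
    congr 1
    ext i; fin_cases i <;> simp
  rw [this, toProj_smul hx (unitary_mulVec_ne_zero hU vec_ne_zero_one), missedPoint]

/-- The affine coordinate of a point of `L_∞` (zero at the missed point). -/
noncomputable def affCoord (U : Matrix (Fin 2) (Fin 2) ℂ) (p : P1) : ℂ :=
  (Uᴴ *ᵥ p.rep) 0 / (Uᴴ *ᵥ p.rep) 1

theorem aff_affCoord (hU : U ∈ Matrix.unitaryGroup (Fin 2) ℂ) {p : P1} (hp : p ≠ missedPoint U) :
    aff U (affCoord U p) = p := by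
  have h0 : p = toProj (U *ᵥ ![(Uᴴ *ᵥ p.rep) 0, (Uᴴ *ᵥ p.rep) 1]) := by
    have : ![(Uᴴ *ᵥ p.rep) 0, (Uᴴ *ᵥ p.rep) 1] = Uᴴ *ᵥ p.rep := by
      ext i; fin_cases i <;> rfl
    rw [this, mulVec_conjTranspose_mulVec hU, toProj_rep]
  by_cases h1 : (Uᴴ *ᵥ p.rep) 1 = 0
  · exfalso
    apply hp
    rw [h1] at h0
    rw [h0, toProj_eq_missedPoint hU]
    intro h2
    apply p.rep_nonzero
    rw [← mulVec_conjTranspose_mulVec hU p.rep]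
    have : Uᴴ *ᵥ p.rep = 0 := by ext i; fin_cases i <;> simp [h1, h2]
    rw [this, Matrix.mulVec_zero]
  · rw [affCoord, ← toProj_eq_aff hU h1]; exact h0.symm

theorem affCoord_aff (hU : U ∈ Matrix.unitaryGroup (Fin 2) ℂ) (u : ℂ) :
    affCoord U (aff U u) = u :=
  aff_injective hU (aff_affCoord hU (aff_ne_missedPoint hU u))

/-- The missed point is the point at infinity of the affine coordinate. -/
theorem isCompact_preimage_aff (hU : U ∈ Matrix.unitaryGroup (Fin 2) ℂ) {K : Set P1}
    (hK : IsClosed K) (hm : missedPoint U ∉ K) : IsCompact (aff U ⁻¹' K) := by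
  refine Metric.isCompact_of_isClosed_isBounded (hK.preimage (continuous_aff hU)) ?_
  obtain ⟨ε, hε, hball⟩ := Metric.isOpen_iff.1 hK.isOpen_compl _ hm
  refine (isBounded_closedBall (x := 0) (r := ε⁻¹)).subset fun u hu => ?_
  have h1 : ε ≤ dist (aff U u) (missedPoint U) := by
    by_contra h
    exact hball (mem_ball.2 (not_le.1 h)) hu
  rw [dist_aff_missedPoint hU, le_inv_comm₀ hε (by positivity)] at h1
  rw [mem_closedBall_zero_iff]
  refine le_trans ?_ h1
  exact Real.le_sqrt_of_sq_le (by linarith)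

end Chart

/-! ### Homogeneous polynomials in two variables -/

section Homogeneous

open MvPolynomial

theorem eval_smul_of_isHomogeneous {Q : MvPolynomial (Fin 2) ℂ} {n : ℕ} (hQ : Q.IsHomogeneous n)
    (a : ℂ) (x : Fin 2 → ℂ) : eval (a • x) Q = a ^ n * eval x Q := by
  rw [eval_eq', eval_eq', Finset.mul_sum]
  refine Finset.sum_congr rfl fun d hd => ?_
  have h1 : d 0 + d 1 = n := by
    by_contra h
    refine mem_support_iff.1 hd (hQ.coeff_eq_zero ?_)
    rwa [Finsupp.degree_eq_sum, Fin.sum_univ_two]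
  simp only [Fin.prod_univ_two, Pi.smul_apply, smul_eq_mul, mul_pow]
  rw [← h1, pow_add]; ring

/-- The restriction of a polynomial to the affine line `u ↦ u • a + b`, as a polynomial in `u`. -/
noncomputable def restrictLine (a b : Fin 2 → ℂ) (Q : MvPolynomial (Fin 2) ℂ) : Polynomial ℂ :=
  aeval (fun j => Polynomial.C (a j) * Polynomial.X + Polynomial.C (b j)) Q

theorem eval_restrictLine (a b : Fin 2 → ℂ) (Q : MvPolynomial (Fin 2) ℂ) (u : ℂ) :
    (restrictLine a b Q).eval u = eval (u • a + b) Q := by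
  induction Q using MvPolynomial.induction_on with
  | C c => simp [restrictLine]
  | add p q hp hq => simp only [restrictLine, map_add, Polynomial.eval_add] at *; rw [hp, hq]
  | mul_X p i hp =>
    have h1 : restrictLine a b (p * X i) =
        restrictLine a b p * (Polynomial.C (a i) * Polynomial.X + Polynomial.C (b i)) := by
      simp only [restrictLine, map_mul, aeval_X]
    rw [h1, Polynomial.eval_mul, hp, map_mul, eval_X]
    simp only [Polynomial.eval_add, Polynomial.eval_mul, Polynomial.eval_C, Polynomial.eval_X,
      Pi.add_apply, Pi.smul_apply, smul_eq_mul]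
    ring

theorem eval_derivative_restrictLine (a b : Fin 2 → ℂ) (Q : MvPolynomial (Fin 2) ℂ) (u : ℂ) :
    (restrictLine a b Q).derivative.eval u =
      a 0 * eval (u • a + b) (pderiv 0 Q) + a 1 * eval (u • a + b) (pderiv 1 Q) := by
  induction Q using MvPolynomial.induction_on with
  | C c => simp [restrictLine]
  | add p q hp hq =>
    simp only [restrictLine, map_add, Polynomial.eval_add] at *; rw [hp, hq]; ring
  | mul_X p i hp =>
    have h1 := eval_restrictLine a b p u
    have h2 : restrictLine a b (p * X i) =
        restrictLine a b p * (Polynomial.C (a i) * Polynomial.X + Polynomial.C (b i)) := by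
      simp only [restrictLine, map_mul, aeval_X]
    rw [h2, Polynomial.derivative_mul, Polynomial.eval_add, Polynomial.eval_mul,
      Polynomial.eval_mul, hp, h1]
    simp only [Derivation.leibniz, smul_eq_mul, map_add, map_mul, eval_X, pderiv_X]
    fin_cases i <;> simp <;> ring

/-- A homogeneous polynomial that vanishes on a line not through the origin is zero. -/
theorem restrictLine_ne_zero {Q : MvPolynomial (Fin 2) ℂ} {n : ℕ} (hQ : Q.IsHomogeneous n)
    (h0 : Q ≠ 0) {a b : Fin 2 → ℂ} (hab : wedge a b ≠ 0) : restrictLine a b Q ≠ 0 := by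
  intro h
  apply h0
  have hline : ∀ u : ℂ, eval (u • a + b) Q = 0 := fun u => by
    rw [← eval_restrictLine, h, Polynomial.eval_zero]
  have hX : Q * (C (a 0) * X 1 - C (a 1) * X 0) = 0 := by
    refine MvPolynomial.funext fun x => ?_
    rw [map_mul, map_zero]
    by_cases hx : a 0 * x 1 - a 1 * x 0 = 0
    · simp [hx]
    · -- `x` is a multiple of a point of the line
      set t : ℂ := (a 0 * x 1 - a 1 * x 0) / wedge a b with ht
      have ht0 : t ≠ 0 := div_ne_zero hx hab
      set u : ℂ := (x 0 * b 1 - x 1 * b 0) / (a 0 * x 1 - a 1 * x 0) with hu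
      have : x = t • (u • a + b) := by
        have hw : a 0 * b 1 - a 1 * b 0 ≠ 0 := hab
        have htu : t * u = (x 0 * b 1 - x 1 * b 0) / (a 0 * b 1 - a 1 * b 0) := by
          rw [ht, hu, mul_comm, div_mul_div_cancel₀ hx]; rfl
        ext i
        simp only [Pi.smul_apply, Pi.add_apply, smul_eq_mul]
        rw [mul_add, ← mul_assoc, htu, ht, wedge, div_mul_eq_mul_div, div_mul_eq_mul_div,
          ← add_div, eq_div_iff hw]
        fin_cases i <;> simp only [Fin.mk_one, Fin.zero_eta] <;> ring
      rw [this, eval_smul_of_isHomogeneous hQ, hline, mul_zero, zero_mul]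
  rcases mul_eq_zero.1 hX with h | h
  · exact h
  · exfalso
    apply hab
    have h1 : a 0 = 0 := by simpa using congrArg (eval ![0, 1]) h
    have h2 : a 1 = 0 := by simpa using congrArg (eval ![1, 0]) h
    simp [wedge, h1, h2]

/-- A nonzero homogeneous polynomial has finitely many zeros on the line at infinity. -/
theorem finite_zeros_of_isHomogeneous {Q : MvPolynomial (Fin 2) ℂ} {n : ℕ} (hQ : Q.IsHomogeneous n)
    (h0 : Q ≠ 0) : {p : P1 | eval p.rep Q = 0}.Finite := by
  have h1 : (1 : Matrix (Fin 2) (Fin 2) ℂ) ∈ Matrix.unitaryGroup (Fin 2) ℂ := one_mem _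
  have hr := restrictLine_ne_zero hQ h0 (a := ![1, 0]) (b := ![0, 1]) (by simp [wedge])
  refine (((restrictLine ![1, 0] ![0, 1] Q).rootSet_finite ℂ).image (aff 1) |>.union
    (finite_singleton (missedPoint 1))).subset fun p hp => ?_
  by_cases hpm : p = missedPoint 1
  · exact Or.inr hpm
  · refine Or.inl ⟨affCoord 1 p, ?_, aff_affCoord h1 hpm⟩
    rw [Polynomial.mem_rootSet, Polynomial.aeval_def, Algebra.algebraMap_self,
      Polynomial.eval₂_id]
    refine ⟨hr, ?_⟩
    rw [eval_restrictLine]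
    have h2 := aff_affCoord h1 hpm
    obtain ⟨a, ha, h3⟩ := exists_rep_toProj
      (unitary_mulVec_ne_zero h1 (vec_one_ne_zero (affCoord 1 p)))
    rw [aff] at h2
    rw [h2, Matrix.one_mulVec] at h3
    have h4 : (![affCoord 1 p, 1] : Fin 2 → ℂ) = affCoord 1 p • ![1, 0] + ![0, 1] := by
      ext i; fin_cases i <;> simp
    have h5 : eval p.rep Q = 0 := hp
    rw [← h4]
    rw [h3, eval_smul_of_isHomogeneous hQ] at h5
    exact (mul_eq_zero.1 h5).resolve_left (pow_ne_zero _ ha)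

/-- The linear form vanishing at a zero of a homogeneous polynomial divides it. -/
theorem linear_dvd_of_eval_eq_zero {Q : MvPolynomial (Fin 2) ℂ} {n : ℕ} (hQ : Q.IsHomogeneous n)
    {x : Fin 2 → ℂ} (hx : x ≠ 0) (h : eval x Q = 0) : C (x 1) * X 0 - C (x 0) * X 1 ∣ Q := by
  obtain ⟨α, β, hαβ⟩ : ∃ α β : ℂ, α * x 0 + β * x 1 = 1 := by
    by_cases h0 : x 0 = 0
    · have h1 : x 1 ≠ 0 := fun h1 => hx (by ext i; fin_cases i <;> simp [h0, h1])
      exact ⟨0, (x 1)⁻¹, by simp [h1]⟩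
    · exact ⟨(x 0)⁻¹, 0, by simp [h0]⟩
  set l : MvPolynomial (Fin 2) ℂ := C (x 1) * X 0 - C (x 0) * X 1 with hl
  set t : MvPolynomial (Fin 2) ℂ := C α * X 0 + C β * X 1 with ht
  have hmod : ∀ R : MvPolynomial (Fin 2) ℂ, l ∣ R - aeval (fun i => C (x i) * t) R := by
    intro R
    -- modulo `l`, the variables `X i` are the multiples `x i * t` of `t`
    rw [← Ideal.mem_span_singleton, ← Ideal.Quotient.eq]
    have : (Ideal.Quotient.mkₐ ℂ (Ideal.span {l})) =
        (Ideal.Quotient.mkₐ ℂ (Ideal.span {l})).comp (aeval (fun i => C (x i) * t)) := by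
      refine MvPolynomial.algHom_ext fun i => ?_
      rw [AlgHom.comp_apply, aeval_X]
      change Ideal.Quotient.mk _ _ = Ideal.Quotient.mk _ _
      rw [Ideal.Quotient.eq, Ideal.mem_span_singleton]
      have hC : (C α * C (x 0) + C β * C (x 1) : MvPolynomial (Fin 2) ℂ) = 1 := by
        rw [← C_mul, ← C_mul, ← C_add, hαβ, C_1]
      fin_cases i
      · refine ⟨C β, ?_⟩
        simp only [Fin.zero_eta, hl, ht]
        linear_combination (-X 0) * hC
      · refine ⟨-C α, ?_⟩
        simp only [Fin.mk_one, hl, ht]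
        linear_combination (-X 1) * hC
    exact congrArg (fun φ : MvPolynomial (Fin 2) ℂ →ₐ[ℂ] _ => φ R) this
  have hz : aeval (fun i => C (x i) * t) Q = 0 := by
    refine MvPolynomial.funext fun y => ?_
    have h1 : eval y (aeval (fun i => C (x i) * t) Q) = eval (eval y t • x) Q := by
      rw [aeval_def, eval₂_eq', map_sum, eval_eq']
      refine Finset.sum_congr rfl fun d _ => ?_
      simp [mul_comm]
    rw [h1, eval_smul_of_isHomogeneous hQ, h, mul_zero, map_zero]
  have := hmod Q
  rwa [hz, sub_zero] at this

/-- Relatively prime homogeneous polynomials in two variables have no common zero but the origin. -/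
theorem eq_zero_of_isRelPrime {Q R : MvPolynomial (Fin 2) ℂ} {n m : ℕ} (hQ : Q.IsHomogeneous n)
    (hR : R.IsHomogeneous m) (hrel : IsRelPrime Q R) {x : Fin 2 → ℂ} (h1 : eval x Q = 0)
    (h2 : eval x R = 0) : x = 0 := by
  by_contra hx
  have hu := hrel (linear_dvd_of_eval_eq_zero hQ hx h1) (linear_dvd_of_eval_eq_zero hR hx h2)
  have := (hu.map (eval x)).ne_zero
  apply this
  simp [mul_comm]

end Homogeneous

/-! ### The leading form and the homogeneous lift -/

section LeadingForm

open MvPolynomial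

variable {F : Fin 2 → MvPolynomial (Fin 2) ℂ} (L : LeadingForm F)

/-- The homogeneous lift `(P 0, P 1)` of `f_∞` to `ℂ²`. -/
noncomputable def LeadingForm.lift (v : Fin 2 → ℂ) : Fin 2 → ℂ := fun i => eval v (L.P i)

theorem LeadingForm.lift_smul (a : ℂ) (v : Fin 2 → ℂ) :
    L.lift (a • v) = a ^ L.d' • L.lift v := by
  ext i
  exact eval_smul_of_isHomogeneous (L.P_homogeneous i) a v

theorem LeadingForm.lift_ne_zero {v : Fin 2 → ℂ} (hv : v ≠ 0) : L.lift v ≠ 0 := fun h =>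
  hv (eq_zero_of_isRelPrime (L.P_homogeneous 0) (L.P_homogeneous 1) L.P_relPrime
    (congrFun h 0) (congrFun h 1))

theorem LeadingForm.continuous_lift : Continuous L.lift :=
  continuous_pi fun i => MvPolynomial.continuous_eval (L.P i)

theorem LeadingForm.fInfty_toProj {v : Fin 2 → ℂ} (hv : v ≠ 0) :
    L.fInfty (toProj v) = toProj (L.lift v) := by
  obtain ⟨a, ha, h⟩ := exists_rep_toProj hv
  change toProj (L.lift (toProj v).rep) = _
  rw [h, L.lift_smul, toProj_smul (pow_ne_zero _ ha) (L.lift_ne_zero hv)]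

theorem LeadingForm.continuous_fInfty : Continuous L.fInfty := by
  rw [isQuotientMap_toP1.continuous_iff]
  refine continuous_iff_continuousAt.2 fun v => ?_
  have hv := ne_zero_of_euclNorm v.2
  have h1 : ContinuousAt (fun v : {v : Fin 2 → ℂ // euclNorm v = 1} => toP1 (L.lift v.1)) v :=
    ContinuousAt.comp (g := toP1) (continuousAt_toP1 (L.lift_ne_zero hv))
      (L.continuous_lift.comp continuous_subtype_val).continuousAt
  refine h1.congr (Eventually.of_forall fun w => ?_)
  exact (L.fInfty_toProj (ne_zero_of_euclNorm w.2)).symm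

theorem LeadingForm.finite_fiber (hnc : ∃ p q : P1, L.fInfty p ≠ L.fInfty q) (z : P1) :
    {p | L.fInfty p = z}.Finite := by
  set Q : MvPolynomial (Fin 2) ℂ := L.P 0 * C (z.rep 1) - L.P 1 * C (z.rep 0) with hQ
  have hev : ∀ p : P1, eval p.rep Q = 0 ↔ L.fInfty p = z := fun p => by
    have h1 : L.fInfty p = toProj (L.lift p.rep) := rfl
    have h2 := wedge_eq_zero_iff (L.lift_ne_zero p.rep_nonzero) z.rep_nonzero
    rw [toProj_rep] at h2
    rw [h1, ← h2]
    simp [hQ, wedge, LeadingForm.lift]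
  have hhom : Q.IsHomogeneous L.d' := by
    have h := ((L.P_homogeneous 0).mul (isHomogeneous_C (Fin 2) (z.rep 1))).sub
      ((L.P_homogeneous 1).mul (isHomogeneous_C (Fin 2) (z.rep 0)))
    simpa using h
  have h0 : Q ≠ 0 := by
    intro h0
    obtain ⟨p, q, hpq⟩ := hnc
    apply hpq
    rw [(hev p).1 (by rw [h0, map_zero]), (hev q).1 (by rw [h0, map_zero])]
  refine (finite_zeros_of_isHomogeneous hhom h0).subset fun p hp => (hev p).2 hp

theorem LeadingForm.d'_pos (hnc : ∃ p q : P1, L.fInfty p ≠ L.fInfty q) : 0 < L.d' := by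
  rw [Nat.pos_iff_ne_zero]
  intro h
  obtain ⟨p, q, hpq⟩ := hnc
  apply hpq
  have hc : ∀ v w, L.lift v = L.lift w := fun v w => by
    have h1 := L.lift_smul 0 v
    have h2 := L.lift_smul 0 w
    rw [h, pow_zero, one_smul] at h1 h2
    rw [← h1, ← h2, zero_smul, zero_smul]
  change toProj (L.lift _) = toProj (L.lift _)
  rw [hc]

theorem LeadingForm.exists_P_ne_zero : ∃ i, L.P i ≠ 0 := by
  by_contra! h
  have := L.lift_ne_zero vec_ne_zero_one
  apply this
  ext i
  simp [LeadingForm.lift, h i]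

theorem LeadingForm.gP_homogeneous (i : Fin 2) : (L.g * L.P i).IsHomogeneous (L.d + L.d') :=
  L.g_homogeneous.mul (L.P_homogeneous i)

theorem LeadingForm.homogeneousComponent_eq (i : Fin 2) :
    homogeneousComponent (L.d + L.d') (F i) = L.g * L.P i := by
  have h1 : F i = (F i - L.g * L.P i) + L.g * L.P i := by ring
  rw [h1, map_add, homogeneousComponent_eq_zero _ _ (L.remainder i), zero_add,
    homogeneousComponent_eq_self (L.gP_homogeneous i)]

theorem LeadingForm.totalDegree_le (i : Fin 2) : (F i).totalDegree ≤ L.d + L.d' := by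
  have h1 : F i = (F i - L.g * L.P i) + L.g * L.P i := by ring
  rw [h1]
  exact (totalDegree_add _ _).trans (max_le (L.remainder i).le (L.gP_homogeneous i).totalDegree_le)

theorem LeadingForm.algDegree_eq : algDegree F = L.d + L.d' := by
  refine le_antisymm (max_le (L.totalDegree_le 0) (L.totalDegree_le 1)) ?_
  obtain ⟨i, hi⟩ := L.exists_P_ne_zero
  have h1 : L.d + L.d' ≤ (F i).totalDegree := by
    by_contra h
    have := homogeneousComponent_eq_zero _ _ (not_le.1 h)
    rw [L.homogeneousComponent_eq] at this
    exact (mul_ne_zero L.g_ne_zero hi) this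
  refine h1.trans ?_
  fin_cases i
  · exact le_max_left _ _
  · exact le_max_right _ _

theorem LeadingForm.algDegree_pos (hnc : ∃ p q : P1, L.fInfty p ≠ L.fInfty q) :
    0 < algDegree F := by
  rw [L.algDegree_eq]; have := L.d'_pos hnc; omega

theorem LeadingForm.homogenize_infinity {X : Fin 3 → ℂ} (hX : X 2 = 0) (i : Fin 2) :
    homogenize F i X = eval ![X 0, X 1] L.g * eval ![X 0, X 1] (L.P i) := by
  rw [homogenize, Finset.sum_range_succ, hX, Nat.sub_self, pow_zero, one_mul]
  rw [Finset.sum_eq_zero, zero_add, L.algDegree_eq, L.homogeneousComponent_eq, map_mul]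
  intro k hk
  rw [zero_pow, zero_mul]
  have := Finset.mem_range.1 hk
  omega

theorem homogenize_one (x : Fin 2 → ℂ) (i : Fin 2) :
    homogenize F i ![x 0, x 1, 1] = eval x (F i) := by
  have h1 : (F i).totalDegree ≤ algDegree F := by
    fin_cases i
    · exact le_max_left _ _
    · exact le_max_right _ _
  have hx : ![x 0, x 1] = x := by ext j; fin_cases j <;> rfl
  have h2 : F i = ∑ k ∈ Finset.range (algDegree F + 1), homogeneousComponent k (F i) := by
    conv_lhs => rw [← sum_homogeneousComponent (F i)]
    refine Finset.sum_subset (Finset.range_subset_range.2 (by omega)) fun k _ hk => ?_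
    exact homogeneousComponent_eq_zero _ _ (by simpa using hk)
  conv_rhs => rw [h2, map_sum]
  simp [homogenize, hx]

theorem homogenize_smul (a : ℂ) (X : Fin 3 → ℂ) (i : Fin 2) :
    homogenize F i (a • X) = a ^ algDegree F * homogenize F i X := by
  rw [homogenize, homogenize, Finset.mul_sum]
  refine Finset.sum_congr rfl fun k hk => ?_
  have hk' : k ≤ algDegree F := Nat.lt_succ_iff.1 (Finset.mem_range.1 hk)
  have h1 : ![(a • X) 0, (a • X) 1] = a • ![X 0, X 1] := by ext j; fin_cases j <;> rfl
  rw [h1, eval_smul_of_isHomogeneous (homogeneousComponent_isHomogeneous k (F i))]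
  conv_rhs => rw [← Nat.sub_add_cancel hk', pow_add]
  simp only [Pi.smul_apply, smul_eq_mul, mul_pow]
  rw [Nat.sub_add_cancel hk']; ring

theorem homLift_smul (a : ℂ) (X : Fin 3 → ℂ) :
    homLift F (a • X) = a ^ algDegree F • homLift F X := by
  ext j
  fin_cases j
  · exact homogenize_smul a X 0
  · exact homogenize_smul a X 1
  · simp [homLift, mul_pow]

theorem continuous_homogenize (i : Fin 2) : Continuous (homogenize F i) := by
  unfold homogenize
  refine continuous_finsetSum _ fun k _ => ?_
  refine ((continuous_apply 2).pow _).mul ((MvPolynomial.continuous_eval _).comp ?_)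
  exact continuous_pi fun j => by fin_cases j <;> simp <;> fun_prop

theorem continuous_homLift : Continuous (homLift F) := by
  refine continuous_pi fun j => ?_
  fin_cases j
  · exact continuous_homogenize 0
  · exact continuous_homogenize 1
  · exact (continuous_apply (2 : Fin 3)).pow _

theorem toProj_mem_indetSet_iff {X : Fin 3 → ℂ} (hX : X ≠ 0) :
    toProj X ∈ indetSet F ↔ homLift F X = 0 := by
  obtain ⟨a, ha, h⟩ := exists_rep_toProj hX
  change homLift F (toProj X).rep = 0 ↔ _
  rw [h, homLift_smul, smul_eq_zero_iff_right (pow_ne_zero _ ha)]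

theorem vec3_ne_zero {v : Fin 2 → ℂ} (hv : v ≠ 0) (t : ℂ) : (![v 0, v 1, t] : Fin 3 → ℂ) ≠ 0 :=
  fun h => hv (by ext i; fin_cases i; exacts [congrFun h 0, congrFun h 1])

theorem lineAtInfinity_toProj {v : Fin 2 → ℂ} (hv : v ≠ 0) :
    lineAtInfinity (toProj v) = toProj ![v 0, v 1, 0] := by
  obtain ⟨a, ha, h⟩ := exists_rep_toProj hv
  rw [lineAtInfinity, h]
  have : (![(a • v) 0, (a • v) 1, 0] : Fin 3 → ℂ) = a • ![v 0, v 1, 0] := by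
    ext i; fin_cases i <;> simp
  rw [this, toProj_smul ha (vec3_ne_zero hv 0)]

theorem LeadingForm.homLift_infinity (hD : 0 < algDegree F) (v : Fin 2 → ℂ) :
    homLift F ![v 0, v 1, 0] = ![eval v L.g * L.lift v 0, eval v L.g * L.lift v 1, 0] := by
  have hv : ![v 0, v 1] = v := by ext j; fin_cases j <;> rfl
  have h0 := L.homogenize_infinity (X := ![v 0, v 1, 0]) rfl 0
  have h1 := L.homogenize_infinity (X := ![v 0, v 1, 0]) rfl 1
  simp only [Matrix.cons_val_zero, Matrix.cons_val_one, hv] at h0 h1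
  rw [homLift, h0, h1]
  simp [LeadingForm.lift, hD.ne']

theorem LeadingForm.toProj_mem_indetPoints_iff (hD : 0 < algDegree F) {v : Fin 2 → ℂ}
    (hv : v ≠ 0) : toProj v ∈ indetPoints F ↔ eval v L.g = 0 := by
  change lineAtInfinity (toProj v) ∈ indetSet F ↔ _
  rw [lineAtInfinity_toProj hv, toProj_mem_indetSet_iff (vec3_ne_zero hv 0),
    L.homLift_infinity hD]
  constructor
  · intro h
    by_contra hg
    apply L.lift_ne_zero hv
    ext i
    fin_cases i
    · simpa [hg] using congrFun h 0
    · simpa [hg] using congrFun h 1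
  · intro h
    ext i; fin_cases i <;> simp [h]

theorem LeadingForm.indetPoints_eq (hD : 0 < algDegree F) :
    indetPoints F = {p : P1 | eval p.rep L.g = 0} := by
  ext p
  conv_lhs => rw [← toProj_rep p]
  exact L.toProj_mem_indetPoints_iff hD p.rep_nonzero

theorem LeadingForm.finite_indetPoints (L : LeadingForm F) (hD : 0 < algDegree F) :
    (indetPoints F).Finite := by
  rw [L.indetPoints_eq hD]
  exact finite_zeros_of_isHomogeneous L.g_homogeneous L.g_ne_zero

end LeadingForm

/-! ### The map at infinity in an affine coordinate -/

/-- On a compact set a `C^1` function is uniformly approximated by its linearizations. -/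
theorem exists_uniform_linearization {K V : Set ℂ} {h h' : ℂ → ℂ} (hK : IsCompact K)
    (hV : IsOpen V) (hKV : K ⊆ V) (hd : ∀ x ∈ V, HasDerivAt h (h' x) x) (hc : ContinuousOn h' V)
    {θ : ℝ} (hθ : 0 < θ) : ∃ η > 0, ∀ x ∈ K, closedBall x η ⊆ V ∧
      ∀ y ∈ closedBall x η, ‖h y - h x - h' x * (y - x)‖ ≤ θ * ‖y - x‖ := by
  obtain ⟨η₀, hη₀, hsub⟩ := hK.exists_cthickening_subset_open hV hKV
  have hK' : IsCompact (cthickening η₀ K) := hK.cthickening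
  have hu := hK'.uniformContinuousOn_of_continuous (hc.mono hsub)
  rw [Metric.uniformContinuousOn_iff] at hu
  obtain ⟨δ, hδ, hu⟩ := hu θ hθ
  have hmem : ∀ x ∈ K, closedBall x (min η₀ (δ / 2)) ⊆ cthickening η₀ K := fun x hx =>
    (closedBall_subset_closedBall (min_le_left _ _)).trans
      (closedBall_subset_cthickening hx _)
  refine ⟨min η₀ (δ / 2), by positivity, fun x hx => ⟨(hmem x hx).trans hsub, fun y hy => ?_⟩⟩
  have hx' : x ∈ closedBall x (min η₀ (δ / 2)) := mem_closedBall_self (by positivity)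
  have hg : ∀ z ∈ closedBall x (min η₀ (δ / 2)),
      HasDerivWithinAt (fun z => h z - h' x * z) (h' z - h' x) (closedBall x (min η₀ (δ / 2))) z :=
    fun z hz => by
      have h1 := (hd z (hsub (hmem x hx hz))).sub ((hasDerivAt_id z).const_mul (h' x))
      rw [mul_one] at h1
      exact h1.hasDerivWithinAt
  have hb : ∀ z ∈ closedBall x (min η₀ (δ / 2)), ‖h' z - h' x‖ ≤ θ := fun z hz => by
    rw [← dist_eq_norm]
    refine (hu z (hmem x hx hz) x (hmem x hx hx') ?_).le
    have := (mem_closedBall.1 hz).trans (min_le_right _ _)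
    linarith
  have := Convex.norm_image_sub_le_of_norm_hasDerivWithin_le hg hb (convex_closedBall _ _) hx' hy
  refine le_trans (le_of_eq ?_) this
  congr 1; ring

section ChartMap

open MvPolynomial

variable {F : Fin 2 → MvPolynomial (Fin 2) ℂ} (L : LeadingForm F)
  (U : Matrix (Fin 2) (Fin 2) ℂ)

/-- In the affine chart of `U`, the lift of `f_∞` has the components `chartNum L U 0`,
`chartNum L U 1`, so that `f_∞` is their quotient. -/
noncomputable def chartNum (i : Fin 2) : Polynomial ℂ :=
  Polynomial.C (Uᴴ i 0) * restrictLine (U *ᵥ ![1, 0]) (U *ᵥ ![0, 1]) (L.P 0) +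
    Polynomial.C (Uᴴ i 1) * restrictLine (U *ᵥ ![1, 0]) (U *ᵥ ![0, 1]) (L.P 1)

/-- The map `f_∞` in the affine coordinate given by `U`. -/
noncomputable def chartMap (u : ℂ) : ℂ := (chartNum L U 0).eval u / (chartNum L U 1).eval u

/-- The derivative of `chartMap`. -/
noncomputable def chartDeriv (u : ℂ) : ℂ :=
  ((chartNum L U 0).derivative.eval u * (chartNum L U 1).eval u -
    (chartNum L U 0).eval u * (chartNum L U 1).derivative.eval u) / (chartNum L U 1).eval u ^ 2

variable {U}

theorem line_eq (u : ℂ) : u • (U *ᵥ ![1, 0]) + U *ᵥ ![0, 1] = U *ᵥ ![u, 1] := by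
  rw [← Matrix.mulVec_smul, ← Matrix.mulVec_add]
  congr 1
  ext i; fin_cases i <;> simp

theorem eval_chartNum (i : Fin 2) (u : ℂ) :
    (chartNum L U i).eval u = (Uᴴ *ᵥ L.lift (U *ᵥ ![u, 1])) i := by
  rw [chartNum, Polynomial.eval_add, Polynomial.eval_mul, Polynomial.eval_mul, eval_restrictLine,
    eval_restrictLine, line_eq, Polynomial.eval_C, Polynomial.eval_C, Matrix.mulVec, dotProduct,
    Fin.sum_univ_two]
  rfl

theorem lift_chart (hU : U ∈ Matrix.unitaryGroup (Fin 2) ℂ) (u : ℂ) :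
    L.lift (U *ᵥ ![u, 1]) = U *ᵥ ![(chartNum L U 0).eval u, (chartNum L U 1).eval u] := by
  have : ![(chartNum L U 0).eval u, (chartNum L U 1).eval u] = Uᴴ *ᵥ L.lift (U *ᵥ ![u, 1]) := by
    ext i; fin_cases i
    · exact eval_chartNum L 0 u
    · exact eval_chartNum L 1 u
  rw [this, mulVec_conjTranspose_mulVec hU]

theorem chartNum_ne_zero (hU : U ∈ Matrix.unitaryGroup (Fin 2) ℂ) {u : ℂ}
    (h1 : (chartNum L U 1).eval u = 0) : (chartNum L U 0).eval u ≠ 0 := by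
  intro h0
  apply L.lift_ne_zero (unitary_mulVec_ne_zero hU (vec_one_ne_zero u))
  rw [lift_chart L hU, h0, h1]
  ext i; fin_cases i <;> simp [Matrix.mulVec, dotProduct]

theorem fInfty_aff_eq (hU : U ∈ Matrix.unitaryGroup (Fin 2) ℂ) (u : ℂ) :
    L.fInfty (aff U u) =
      toProj (U *ᵥ ![(chartNum L U 0).eval u, (chartNum L U 1).eval u]) := by
  rw [aff, L.fInfty_toProj (unitary_mulVec_ne_zero hU (vec_one_ne_zero u)), lift_chart L hU]

theorem fInfty_aff (hU : U ∈ Matrix.unitaryGroup (Fin 2) ℂ) {u : ℂ}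
    (h : (chartNum L U 1).eval u ≠ 0) : L.fInfty (aff U u) = aff U (chartMap L U u) := by
  rw [fInfty_aff_eq L hU, toProj_eq_aff hU h, chartMap]

theorem chartNum_one_ne_zero (hU : U ∈ Matrix.unitaryGroup (Fin 2) ℂ) {u : ℂ}
    (h : L.fInfty (aff U u) ≠ missedPoint U) : (chartNum L U 1).eval u ≠ 0 := by
  intro h1
  apply h
  rw [fInfty_aff_eq L hU, h1, toProj_eq_missedPoint hU (chartNum_ne_zero L hU h1)]

theorem fInfty_aff_eq_aff_iff (hU : U ∈ Matrix.unitaryGroup (Fin 2) ℂ) {u a : ℂ} :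
    L.fInfty (aff U u) = aff U a ↔
      (chartNum L U 0).eval u - a * (chartNum L U 1).eval u = 0 := by
  constructor
  · intro h
    have h1 := chartNum_one_ne_zero L hU (h ▸ aff_ne_missedPoint hU a)
    rw [fInfty_aff L hU h1] at h
    rw [← aff_injective hU h, chartMap]
    field_simp; ring
  · intro h
    have h1 : (chartNum L U 1).eval u ≠ 0 := fun h1 => by
      rw [h1, mul_zero, sub_zero] at h
      exact chartNum_ne_zero L hU h1 h
    rw [fInfty_aff L hU h1, chartMap]
    congr 1
    rw [div_eq_iff h1]
    exact sub_eq_zero.1 h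

theorem hasStrictDerivAt_chartMap {u : ℂ} (h : (chartNum L U 1).eval u ≠ 0) :
    HasStrictDerivAt (chartMap L U) (chartDeriv L U u) u :=
  ((chartNum L U 0).hasStrictDerivAt u).div ((chartNum L U 1).hasStrictDerivAt u) h

/-- By Euler's relation, the derivative of the quotient of the components of the lift is, up to
nonzero factors, its Jacobian determinant. -/
theorem mem_criticalPoints_of_chartDeriv_eq_zero (hU : U ∈ Matrix.unitaryGroup (Fin 2) ℂ) {u : ℂ}
    (h : (chartNum L U 1).eval u ≠ 0) (h0 : chartDeriv L U u = 0) :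
    aff U u ∈ L.criticalPoints := by
  set x : Fin 2 → ℂ := U *ᵥ ![u, 1] with hx
  have hx0 : x ≠ 0 := unitary_mulVec_ne_zero hU (vec_one_ne_zero u)
  have h1 : (chartNum L U 0).derivative.eval u * (chartNum L U 1).eval u -
    (chartNum L U 0).eval u * (chartNum L U 1).derivative.eval u = 0 := by
    rw [chartDeriv, div_eq_zero_iff] at h0
    exact h0.resolve_right (pow_ne_zero _ h)
  set a : Fin 2 → ℂ := U *ᵥ ![1, 0] with ha
  set P' : Fin 2 → ℂ := fun i => a 0 * eval x (pderiv 0 (L.P i)) + a 1 * eval x (pderiv 1 (L.P i))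
    with hP'
  have hder : ∀ i, (chartNum L U i).derivative.eval u = (Uᴴ *ᵥ P') i := fun i => by
    rw [chartNum, Polynomial.derivative_add, Polynomial.derivative_C_mul,
      Polynomial.derivative_C_mul, Polynomial.eval_add, Polynomial.eval_C_mul,
      Polynomial.eval_C_mul, eval_derivative_restrictLine, eval_derivative_restrictLine, line_eq]
    have : (Uᴴ *ᵥ P') i = Uᴴ i 0 * P' 0 + Uᴴ i 1 * P' 1 := by
      rw [Matrix.mulVec, dotProduct, Fin.sum_univ_two]
    rw [this]
  have h2 : wedge P' (L.lift x) = 0 := by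
    have h3 : wedge (Uᴴ *ᵥ P') (Uᴴ *ᵥ L.lift x) = 0 := by
      rw [wedge, ← hder, ← hder, ← eval_chartNum, ← eval_chartNum, ← h1]; ring
    rw [wedge_mulVec] at h3
    refine (mul_eq_zero.1 h3).resolve_left ?_
    rw [Matrix.det_conjTranspose]
    exact star_ne_zero.2 (det_unitary_ne_zero hU)
  have hEuler : ∀ i, x 0 * eval x (pderiv 0 (L.P i)) + x 1 * eval x (pderiv 1 (L.P i)) =
      L.d' * L.lift x i := fun i => by
    have := congrArg (eval x) (L.P_homogeneous i).sum_X_mul_pderiv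
    simpa [Fin.sum_univ_two, LeadingForm.lift] using this
  have hwax : wedge a x ≠ 0 := by
    rw [ha, hx, wedge_mulVec]
    exact mul_ne_zero (det_unitary_ne_zero hU) (by simp [wedge])
  have hJ : eval x (pderiv 0 (L.P 0) * pderiv 1 (L.P 1) -
      pderiv 1 (L.P 0) * pderiv 0 (L.P 1)) = 0 := by
    refine (mul_eq_zero.1 (?_ : wedge a x * _ = 0)).resolve_left hwax
    simp only [map_sub, map_mul]
    have e0 := hEuler 0
    have e1 := hEuler 1
    simp only [wedge, hP'] at h2 ⊢
    linear_combination (L.d' : ℂ) * h2 +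
      (a 0 * eval x (pderiv 0 (L.P 0)) + a 1 * eval x (pderiv 1 (L.P 0))) * e1 -
      (a 0 * eval x (pderiv 0 (L.P 1)) + a 1 * eval x (pderiv 1 (L.P 1))) * e0
  obtain ⟨c, hc, hrep⟩ := exists_rep_toProj hx0
  change eval (aff U u).rep _ = 0
  have hhom : (pderiv 0 (L.P 0) * pderiv 1 (L.P 1) -
      pderiv 1 (L.P 0) * pderiv 0 (L.P 1)).IsHomogeneous ((L.d' - 1) + (L.d' - 1)) :=
    (((L.P_homogeneous 0).pderiv).mul ((L.P_homogeneous 1).pderiv)).sub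
      (((L.P_homogeneous 0).pderiv).mul ((L.P_homogeneous 1).pderiv))
  have h5 : (aff U u).rep = c • x := hrep
  rw [h5, eval_smul_of_isHomogeneous hhom, hJ, mul_zero]

theorem isClosed_criticalPoints : IsClosed L.criticalPoints := by
  have hhom : (pderiv 0 (L.P 0) * pderiv 1 (L.P 1) -
      pderiv 1 (L.P 0) * pderiv 0 (L.P 1)).IsHomogeneous ((L.d' - 1) + (L.d' - 1)) :=
    (((L.P_homogeneous 0).pderiv).mul ((L.P_homogeneous 1).pderiv)).sub
      (((L.P_homogeneous 0).pderiv).mul ((L.P_homogeneous 1).pderiv))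
  rw [← isQuotientMap_toP1.isClosed_preimage]
  have : (fun v : {v : Fin 2 → ℂ // euclNorm v = 1} => toP1 v.1) ⁻¹' L.criticalPoints =
      {v | eval v.1 (pderiv 0 (L.P 0) * pderiv 1 (L.P 1) -
        pderiv 1 (L.P 0) * pderiv 0 (L.P 1)) = 0} := by
    ext v
    obtain ⟨c, hc, hrep⟩ := exists_rep_toProj (ne_zero_of_euclNorm v.2)
    have h5 : (toP1 v.1).rep = c • v.1 := hrep
    change eval (toP1 v.1).rep _ = 0 ↔ eval v.1 _ = 0
    rw [h5, eval_smul_of_isHomogeneous hhom, mul_eq_zero, or_iff_right (pow_ne_zero _ hc)]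
  rw [this]
  exact isClosed_eq ((MvPolynomial.continuous_eval _).comp continuous_subtype_val) continuous_const

end ChartMap

/-! ### Expansion outside a trap -/

section Expansion

variable {F : Fin 2 → MvPolynomial (Fin 2) ℂ} {L : LeadingForm F}
  {U : Matrix (Fin 2) (Fin 2) ℂ}

/-- A Lyapunov function `w` for `f_∞` with a level `σ` whose sublevel set contains the critical
points and the missed point. Outside it, `f_∞` is an expanding covering in the affine coordinate. -/
structure ExpansionSetup (L : LeadingForm F) (U : Matrix (Fin 2) (Fin 2) ℂ) (w : P1 → ℝ)
    (σ : ℝ) : Prop where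
  unitary : U ∈ Matrix.unitaryGroup (Fin 2) ℂ
  trap : IsTrap L.fInfty w
  lt_one : σ < 1
  critical : ∀ c ∈ L.criticalPoints, w c < σ
  missed : w (missedPoint U) < σ

namespace ExpansionSetup

variable {w : P1 → ℝ} {σ : ℝ} (hs : ExpansionSetup L U w σ)
include hs

theorem pos : 0 < σ := (hs.trap.nonneg _).trans_lt hs.missed

theorem apply_lt {p : P1} (hp : w p ≤ σ) : w (L.fInfty p) < σ := by
  obtain ⟨t, ht0, ht1, hc⟩ := hs.trap.contract
  have h1 := hc p (hp.trans_lt hs.lt_one)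
  have h2 := hs.pos
  have h3 := hs.trap.nonneg p
  nlinarith

theorem lt_of_le_apply {p : P1} (hp : σ ≤ w (L.fInfty p)) : σ < w p := by
  by_contra h
  exact absurd (hs.apply_lt (not_lt.1 h)) (not_lt.2 hp)

theorem continuous_aff : Continuous (aff U) := PolyDyn.continuous_aff hs.unitary

theorem isOpen_target : IsOpen {u | σ < w (aff U u)} :=
  isOpen_lt continuous_const (hs.trap.continuous.comp hs.continuous_aff)

theorem isOpen_source : IsOpen {u | σ < w (L.fInfty (aff U u))} :=
  isOpen_lt continuous_const
    (hs.trap.continuous.comp (L.continuous_fInfty.comp hs.continuous_aff))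

theorem isCompact_le_target : IsCompact {u | σ ≤ w (aff U u)} :=
  isCompact_preimage_aff (K := {p | σ ≤ w p}) hs.unitary
    (isClosed_le continuous_const hs.trap.continuous) (not_le.2 hs.missed)

theorem isCompact_le_source : IsCompact {u | σ ≤ w (L.fInfty (aff U u))} :=
  isCompact_preimage_aff (K := {p | σ ≤ w (L.fInfty p)}) hs.unitary
    (isClosed_le continuous_const (hs.trap.continuous.comp L.continuous_fInfty))
    (not_le.2 (hs.apply_lt hs.missed.le))

theorem lt_of_mem_source {u : ℂ} (hu : σ ≤ w (L.fInfty (aff U u))) : σ < w (aff U u) :=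
  hs.lt_of_le_apply hu

theorem chartNum_one_ne_zero {u : ℂ} (hu : σ ≤ w (L.fInfty (aff U u))) :
    (chartNum L U 1).eval u ≠ 0 := by
  refine PolyDyn.chartNum_one_ne_zero L hs.unitary fun h => ?_
  rw [h] at hu
  exact absurd hs.missed (not_lt.2 hu)

theorem fInfty_aff {u : ℂ} (hu : σ ≤ w (L.fInfty (aff U u))) :
    L.fInfty (aff U u) = aff U (chartMap L U u) :=
  PolyDyn.fInfty_aff L hs.unitary (hs.chartNum_one_ne_zero hu)

theorem chartDeriv_ne_zero {u : ℂ} (hu : σ ≤ w (L.fInfty (aff U u))) : chartDeriv L U u ≠ 0 := by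
  intro h0
  have h1 := hs.critical _ (mem_criticalPoints_of_chartDeriv_eq_zero L hs.unitary
    (hs.chartNum_one_ne_zero hu) h0)
  exact absurd (hs.lt_of_mem_source hu) (not_lt.2 h1.le)

/-- The expansion estimate for `f_∞ : f_∞⁻¹ W → W`, where `W = {w > σ}` in the affine coordinate. -/
theorem exists_expansion : ∃ R > 0, ∃ η > 0, ∃ lam > 1,
    {u | σ < w (aff U u)} ⊆ ball 0 R ∧
    (∀ u, σ ≤ w (L.fInfty (aff U u)) → closedBall u η ⊆ {u | σ < w (aff U u)}) ∧
    ∀ u, σ < w (L.fInfty (aff U u)) →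
      lam * innerRadius {u | σ < w (aff U u)} (chartMap L U u) ≤
        ‖chartDeriv L U u‖ * innerRadius {u | σ < w (aff U u)} u := by
  obtain ⟨R, hR⟩ := hs.isCompact_le_target.isBounded.subset_ball 0
  have hR' : {u | σ < w (aff U u)} ⊆ ball 0 (max R 1) := fun u hu =>
    ball_subset_ball (le_max_left _ _) (hR (show σ ≤ w (aff U u) from le_of_lt hu))
  obtain ⟨η, hη, hth⟩ := hs.isCompact_le_source.exists_cthickening_subset_open hs.isOpen_target
    (fun u hu => hs.lt_of_mem_source hu)
  have hball : ∀ u, σ ≤ w (L.fInfty (aff U u)) → closedBall u η ⊆ {u | σ < w (aff U u)} :=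
    fun u hu => (closedBall_subset_cthickening
      (show u ∈ {u | σ ≤ w (L.fInfty (aff U u))} from hu) η).trans hth
  obtain ⟨lam, hlam, hexp⟩ := innerRadius_expansion (h := chartMap L U) (h' := chartDeriv L U)
    hs.isOpen_target hs.isOpen_source hR' hη
    (fun u hu => ball_subset_closedBall.trans (hball u (le_of_lt hu)))
    (fun u hu => hasStrictDerivAt_chartMap L (hs.chartNum_one_ne_zero (le_of_lt hu)))
    (fun u hu => hs.chartDeriv_ne_zero (le_of_lt hu))
    (fun u hu => by
      change σ < w (aff U (chartMap L U u))
      rw [← hs.fInfty_aff (le_of_lt hu)]; exact hu)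
    (fun K hKW hK => by
      have hcl : IsClosed (aff U '' K) := (hK.image hs.continuous_aff).isClosed
      convert isCompact_preimage_aff (K := L.fInfty ⁻¹' (aff U '' K)) hs.unitary
        (hcl.preimage L.continuous_fInfty) ?_ using 1
      · ext u
        constructor
        · rintro ⟨hu, huK⟩
          exact ⟨_, huK, (hs.fInfty_aff (le_of_lt hu)).symm⟩
        · rintro ⟨k, hk, hku⟩
          have hu : σ < w (L.fInfty (aff U u)) := by rw [← hku]; exact hKW hk
          refine ⟨hu, ?_⟩
          rw [hs.fInfty_aff hu.le] at hku
          rw [mem_preimage, ← aff_injective hs.unitary hku]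
          exact hk
      · rintro ⟨k, hk, hkm⟩
        have h1 : σ < w (aff U k) := hKW hk
        rw [hkm] at h1
        exact absurd (hs.apply_lt hs.missed.le) (not_lt.2 h1.le))
  exact ⟨max R 1, by positivity, η, hη, lam, hlam, hR', hball, hexp⟩

end ExpansionSetup

end Expansion

/-! ### The Fatou set of a hyperbolic map -/

theorem exists_unitary_missedPoint (p : P1) :
    ∃ U ∈ Matrix.unitaryGroup (Fin 2) ℂ, missedPoint U = p := by
  obtain ⟨v, hv, rfl⟩ := exists_unit_rep p
  have h1 : v 0 * star (v 0) + v 1 * star (v 1) = 1 := by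
    have h2 : ((euclNorm v ^ 2 : ℝ) : ℂ) = 1 := by rw [hv]; simp
    rw [euclNorm_sq] at h2
    simp only [RCLike.star_def, Complex.mul_conj, Complex.normSq_eq_norm_sq]
    rw [← h2]; push_cast; rfl
  refine ⟨!![v 0, -star (v 1); v 1, star (v 0)], ?_, ?_⟩
  · rw [Matrix.mem_unitaryGroup_iff, Matrix.star_eq_conjTranspose]
    ext i j
    fin_cases i <;> fin_cases j <;>
      simp only [Matrix.mul_apply, Fin.sum_univ_two, Matrix.conjTranspose_apply, Matrix.of_apply,
        Matrix.cons_val', Matrix.cons_val_zero, Matrix.cons_val_one, Fin.zero_eta, Fin.mk_one,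
        Matrix.cons_val_fin_one, star_neg, star_star, Matrix.one_apply, if_true, zero_ne_one,
        one_ne_zero, if_false]
    · linear_combination h1
    · ring
    · ring
    · linear_combination h1
  · have : !![v 0, -star (v 1); v 1, star (v 0)] *ᵥ ![1, 0] = v := by
      ext i; fin_cases i <;> simp [Matrix.mulVec, dotProduct]
    rw [missedPoint, this]

section Fatou

variable {F : Fin 2 → MvPolynomial (Fin 2) ℂ} {L : LeadingForm F}

theorem LeadingForm.IsHyperbolic.criticalPoints_subset (hyp : L.IsHyperbolic) :
    L.criticalPoints ⊆ basin L.fInfty := by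
  intro c hc
  obtain ⟨n, p, hp, ht⟩ := hyp.2 c hc
  exact ⟨0, n, p, hp, tendsto_iff_dist_tendsto_zero.2 ht⟩

theorem mem_fatouSet_of_attracting {n : ℕ} {p : P1} (hp : IsAttractingPeriodic L.fInfty n p) :
    p ∈ fatouSet L.fInfty :=
  AttractingPeriodic.equicontinuous L.continuous_fInfty hp

theorem LeadingForm.IsHyperbolic.exists_expansionSetup (hyp : L.IsHyperbolic) {Z : Set P1}
    (hZ : IsClosed Z) (hZb : Z ⊆ basin L.fInfty)
    {U : Matrix (Fin 2) (Fin 2) ℂ} (hU : U ∈ Matrix.unitaryGroup (Fin 2) ℂ)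
    (hm : missedPoint U ∈ basin L.fInfty) :
    ∃ w σ, ExpansionSetup L U w σ ∧ ∀ z ∈ Z, w z < σ := by
  have hcl : IsClosed (L.criticalPoints ∪ Z ∪ {missedPoint U}) :=
    ((isClosed_criticalPoints L).union hZ).union isClosed_singleton
  obtain ⟨w, hw, σ, hσ, h⟩ := exists_isTrap_of_isCompact L.continuous_fInfty hcl.isCompact
    ⟨_, Or.inr rfl⟩ (by
      rintro x ((hx | hx) | rfl)
      exacts [hyp.criticalPoints_subset hx, hZb hx, hm])
  exact ⟨w, σ, ⟨hU, hw, hσ, fun c hc => h c (Or.inl (Or.inl hc)), h _ (Or.inr rfl)⟩,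
    fun z hz => h z (Or.inl (Or.inr hz))⟩

/-- For hyperbolic `f_∞` the Fatou set is contained in the basins of the attracting periodic orbits.
Otherwise the orbit of some Fatou point stays outside a trap. The derivatives of the iterates at
this point are then bounded by equicontinuity and Cauchy's estimate, but unbounded by expansion. -/
theorem LeadingForm.IsHyperbolic.fatouSet_subset (hyp : L.IsHyperbolic) :
    fatouSet L.fInfty ⊆ basin L.fInfty := by
  intro x hx
  by_contra hxb
  obtain ⟨n₀, p₀, hp₀⟩ := hyp.1
  obtain ⟨U, hU, hUp⟩ := exists_unitary_missedPoint p₀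
  obtain ⟨w, σ, hs, -⟩ := hyp.exists_expansionSetup isClosed_empty (empty_subset _) hU
    (hUp ▸ AttractingPeriodic.mem_basin hp₀)
  set f := L.fInfty with hf
  set h := chartMap L U with hh
  have horb : ∀ n, σ < w (f^[n] x) := fun n => by
    by_contra hlt
    exact hxb (mem_basin_of_iterate_mem n
      (hs.trap.mem_basin _ ((not_lt.1 hlt).trans_lt hs.lt_one)))
  obtain ⟨R, hR, η, hη, lam, hlam, hWR, hball, hexp⟩ := hs.exists_expansion
  set W : Set ℂ := {u | σ < w (aff U u)} with hW
  set S := innerRadius W with hS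
  have hxm : x ≠ missedPoint U := fun h0 => by
    have := horb 0
    rw [Function.iterate_zero, id_eq, h0] at this
    exact absurd hs.missed (not_lt.2 this.le)
  set x₀ := affCoord U x with hx₀
  have hax : aff U x₀ = x := aff_affCoord hU hxm
  -- the orbits of the points close to `x` stay away from the trap
  have hG : IsCompact {p | σ ≤ w (f p)} :=
    (isClosed_le continuous_const (hs.trap.continuous.comp L.continuous_fInfty)).isCompact
  obtain ⟨ε, hε, hth⟩ := hG.exists_thickening_subset_open
    (isOpen_lt continuous_const hs.trap.continuous : IsOpen {p | σ < w p})
    (fun p hp => hs.lt_of_le_apply hp)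
  obtain ⟨ρ, hρ, hx⟩ := hx
  have hxx : chordal x x = 0 := dist_self x
  obtain ⟨δ, hδ, hequi⟩ := hx x (by rw [hxx]; exact hρ) ε hε
  obtain ⟨δ', hδ', hcont⟩ := Metric.continuous_iff.1 (continuous_aff hU) x₀ δ hδ
  have hstay : ∀ u ∈ ball x₀ δ', ∀ n, σ < w (f^[n] (aff U u)) := fun u hu n => by
    refine hth (mem_thickening_iff.2 ⟨f^[n] x, ?_, ?_⟩)
    · have := horb (n + 1)
      rw [Function.iterate_succ_apply'] at this
      exact this.le
    · refine hequi n _ ?_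
      rw [← dist_eq_chordal, ← hax]
      exact hcont u hu
  have hiter : ∀ u ∈ ball x₀ δ', ∀ n, f^[n] (aff U u) = aff U (h^[n] u) ∧
      DifferentiableAt ℂ h^[n] u := fun u hu n => by
    induction n with
    | zero => exact ⟨rfl, differentiableAt_id⟩
    | succ n ih =>
      have h1 := hstay u hu (n + 1)
      rw [Function.iterate_succ_apply', ih.1] at h1
      rw [Function.iterate_succ_apply', Function.iterate_succ_apply', ih.1]
      refine ⟨hs.fInfty_aff h1.le, ?_⟩
      rw [Function.iterate_succ']
      exact ((hasStrictDerivAt_chartMap L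
        (hs.chartNum_one_ne_zero h1.le)).hasDerivAt.differentiableAt).comp u ih.2
  have hx₀b : x₀ ∈ ball x₀ δ' := mem_ball_self hδ'
  -- Cauchy's estimate bounds the derivatives of the iterates
  have hupper : ∀ n, δ' * ‖deriv h^[n] x₀‖ ≤ 2 * R := fun n => by
    have hmem : MapsTo (fun z : ℂ => x₀ + δ' * z) (ball 0 1) (ball x₀ δ') := fun z hz => by
      rw [mem_ball_zero_iff] at hz
      rw [mem_ball, dist_eq_norm, add_sub_cancel_left, norm_mul, Complex.norm_real,
        Real.norm_of_nonneg hδ'.le]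
      nlinarith
    have hd : DifferentiableOn ℂ (fun z : ℂ => h^[n] (x₀ + δ' * z)) (ball 0 1) := fun z hz => by
      have h1 : DifferentiableAt ℂ (fun z : ℂ => x₀ + δ' * z) z := by fun_prop
      exact (DifferentiableAt.comp (g := h^[n]) z (hiter _ (hmem hz) n).2
        h1).differentiableWithinAt
    have hm : MapsTo (fun z : ℂ => h^[n] (x₀ + δ' * z)) (ball 0 1) W := fun z hz => by
      have h1 := hstay _ (hmem hz) n
      rw [(hiter _ (hmem hz) n).1] at h1
      exact h1
    have h2 := norm_deriv_le_of_mapsTo hWR hd hm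
    have h3 : HasDerivAt (fun z : ℂ => x₀ + δ' * z) (δ' : ℂ) 0 := by
      simpa using ((hasDerivAt_id (0 : ℂ)).const_mul (δ' : ℂ)).const_add x₀
    have h4 : HasDerivAt (fun z : ℂ => h^[n] (x₀ + δ' * z)) (deriv h^[n] x₀ * δ') 0 := by
      refine HasDerivAt.comp (h₂ := h^[n]) 0 ?_ h3
      rw [mul_zero, add_zero]
      exact (hiter _ hx₀b n).2.hasDerivAt
    rw [h4.deriv, norm_mul, Complex.norm_real, Real.norm_of_nonneg hδ'.le, mul_comm] at h2
    exact h2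
  -- while the expansion makes them grow
  have hsrc : ∀ n, σ < w (f (aff U (h^[n] x₀))) := fun n => by
    have h1 := hstay x₀ hx₀b (n + 1)
    rwa [Function.iterate_succ_apply', (hiter x₀ hx₀b n).1] at h1
  have hlower : ∀ n, lam ^ n * S (h^[n] x₀) ≤ ‖deriv h^[n] x₀‖ * S x₀ := fun n => by
    induction n with
    | zero => simp
    | succ n ih =>
      have h1 : deriv h^[n + 1] x₀ = chartDeriv L U (h^[n] x₀) * deriv h^[n] x₀ := by
        rw [Function.iterate_succ']
        exact (HasDerivAt.comp x₀ (hasStrictDerivAt_chartMap L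
          (hs.chartNum_one_ne_zero (hsrc n).le)).hasDerivAt (hiter x₀ hx₀b n).2.hasDerivAt).deriv
      rw [h1, norm_mul, Function.iterate_succ_apply']
      calc lam ^ (n + 1) * S (h (h^[n] x₀)) = lam ^ n * (lam * S (h (h^[n] x₀))) := by ring
        _ ≤ lam ^ n * (‖chartDeriv L U (h^[n] x₀)‖ * S (h^[n] x₀)) := by
            exact mul_le_mul_of_nonneg_left (hexp _ (hsrc n)) (by positivity)
        _ = ‖chartDeriv L U (h^[n] x₀)‖ * (lam ^ n * S (h^[n] x₀)) := by ring
        _ ≤ ‖chartDeriv L U (h^[n] x₀)‖ * (‖deriv h^[n] x₀‖ * S x₀) := by gcongr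
        _ = _ := by ring
  have hSη : ∀ n, η ≤ S (h^[n] x₀) := fun n =>
    le_innerRadius hWR hη (ball_subset_closedBall.trans (hball _ (hsrc n).le))
  have hS0 : S x₀ ≤ 2 * R := innerRadius_le hR.le hWR x₀
  have hfin : ∀ n, lam ^ n ≤ 2 * R / δ' * (2 * R) / η := fun n => by
    rw [le_div_iff₀ hη]
    have h5 : ‖deriv h^[n] x₀‖ ≤ 2 * R / δ' := by
      rw [le_div_iff₀ hδ', mul_comm]; exact hupper n
    have h6 : 0 ≤ S x₀ := hη.le.trans (hSη 0)
    calc lam ^ n * η ≤ lam ^ n * S (h^[n] x₀) := by gcongr; exact hSη n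
      _ ≤ ‖deriv h^[n] x₀‖ * S x₀ := hlower n
      _ ≤ 2 * R / δ' * (2 * R) := by gcongr
  obtain ⟨n, hn⟩ := pow_unbounded_of_one_lt (2 * R / δ' * (2 * R) / η) hlam
  exact absurd (hfin n) (not_le.2 hn)

end Fatou

/-! ### The radii at finitely many points -/

section Radii

variable {F : Fin 2 → MvPolynomial (Fin 2) ℂ} {L : LeadingForm F}
  {U : Matrix (Fin 2) (Fin 2) ℂ}

theorem LeadingForm.finite_iterate_fiber (hnc : ∃ p q : P1, L.fInfty p ≠ L.fInfty q) (n : ℕ)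
    (z : P1) : {p | L.fInfty^[n] p = z}.Finite := by
  induction n with
  | zero => exact (finite_singleton z).subset fun p hp => hp
  | succ n ih =>
    refine (ih.preimage' (f := L.fInfty) fun b _ => L.finite_fiber hnc b).subset fun p hp => ?_
    exact hp

/-- Radii for the points of a finite set without periodic points. The radius at `p` depends only on
the number of the predecessors of `p` under iteration, and decreases rapidly with this number;
since this number is larger for `f_∞ p` than for `p`, the disk at `f_∞ p` avoids the image of the
circle about `p`. -/
theorem exists_radii_of_finite (hU : U ∈ Matrix.unitaryGroup (Fin 2) ℂ)
    (hnc : ∃ p q : P1, L.fInfty p ≠ L.fInfty q) {E₀ : Set P1} (hE : E₀.Finite)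
    (hper : ∀ p ∈ E₀, p ∉ Function.periodicPts L.fInfty) (hm : missedPoint U ∉ E₀)
    {ρ₁ : ℝ} (hρ₁ : 0 < ρ₁) :
    ∃ r : P1 → ℝ, ∃ μ > 0, (∀ p, 0 < r p ∧ r p ≤ ρ₁) ∧
      (∀ p ∈ E₀, ∀ q ∈ E₀, p ≠ q → r p + r q < dist (affCoord U p) (affCoord U q)) ∧
      ∀ p ∈ E₀, ∀ q ∈ E₀, ∀ u ∈ sphere (affCoord U p) (r p),
        (r q + μ) * ‖(chartNum L U 1).eval u‖ ≤
          ‖(chartNum L U 0).eval u - affCoord U q * (chartNum L U 1).eval u‖ := by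
  set f := L.fInfty with hf
  set a := affCoord U with ha
  set A : ℂ → ℂ := fun u => (chartNum L U 0).eval u with hA
  set B : ℂ → ℂ := fun u => (chartNum L U 1).eval u with hB
  have hAc : Continuous A := (chartNum L U 0).continuous
  have hBc : Continuous B := (chartNum L U 1).continuous
  have haff : ∀ p ∈ E₀, aff U (a p) = p := fun p hp =>
    aff_affCoord hU fun h => hm (h ▸ hp)
  have hzero : ∀ q ∈ E₀, ∀ u, A u - a q * B u = 0 ↔ f (aff U u) = q := fun q hq u => by
    have := fInfty_aff_eq_aff_iff L hU (u := u) (a := a q)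
    rw [haff q hq] at this
    exact this.symm
  -- separation of the points and of their images
  have hstep1 : ∀ p ∈ E₀, ∀ q ∈ E₀, ∀ᶠ ρ in 𝓝[>] (0 : ℝ),
      (p ≠ q → 2 * ρ < dist (a p) (a q)) ∧
      (f p ≠ q → ∀ u ∈ closedBall (a p) ρ, 2 * ρ * ‖B u‖ ≤ ‖A u - a q * B u‖) ∧
      (f p = q → ∀ u ∈ closedBall (a p) ρ, u ≠ a p → A u - a q * B u ≠ 0) := by
    intro p hp q hq
    refine Eventually.and ?_ (Eventually.and ?_ ?_)
    · by_cases hpq : p = q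
      · exact Eventually.of_forall fun _ h => absurd hpq h
      · have h1 : 0 < dist (a p) (a q) := dist_pos.2 fun h => hpq (by
          rw [← haff p hp, ← haff q hq, h])
        have h2 : ∀ᶠ ρ : ℝ in 𝓝 0, 2 * ρ < dist (a p) (a q) :=
          ((continuous_const.mul continuous_id).tendsto' 0 0 (by simp)).eventually (gt_mem_nhds h1)
        exact (h2.filter_mono nhdsWithin_le_nhds).mono fun _ h _ => h
    · by_cases hpq : f p = q
      · exact Eventually.of_forall fun _ h => absurd hpq h
      · have h1 : A (a p) - a q * B (a p) ≠ 0 := fun h => hpq (by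
          rw [← (hzero q hq _).1 h, haff p hp])
        have hg : Continuous fun z : ℂ × ℝ => ‖A z.1 - a q * B z.1‖ - 2 * z.2 * ‖B z.1‖ := by
          fun_prop
        have h2 : ∀ᶠ z in 𝓝 ((a p, 0) : ℂ × ℝ),
            0 < ‖A z.1 - a q * B z.1‖ - 2 * z.2 * ‖B z.1‖ :=
          hg.continuousAt.eventually (lt_mem_nhds (by simpa using h1))
        obtain ⟨e, he, h3⟩ := Metric.eventually_nhds_iff.1 h2
        filter_upwards [Ioo_mem_nhdsGT he] with ρ hρ _ u hu
        have h4 := @h3 (u, ρ) (by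
          rw [Prod.dist_eq, max_lt_iff]
          refine ⟨(mem_closedBall.1 hu).trans_lt hρ.2, ?_⟩
          rw [Real.dist_eq, sub_zero, abs_of_pos hρ.1]; exact hρ.2)
        have h5 : 0 < ‖A u - a q * B u‖ - 2 * ρ * ‖B u‖ := h4
        linarith
    · have hfin : (aff U ⁻¹' {z | f z = q} \ {a p}).Finite :=
        ((L.finite_fiber hnc q).preimage (aff_injective hU).injOn).subset sdiff_subset
      have h2 : ∀ᶠ u in 𝓝 (a p), u ∉ aff U ⁻¹' {z | f z = q} \ {a p} :=
        hfin.isClosed.isOpen_compl.mem_nhds (by simp)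
      obtain ⟨e, he, h3⟩ := Metric.eventually_nhds_iff.1 h2
      filter_upwards [Ioo_mem_nhdsGT he] with ρ hρ _ u hu hne h0
      exact h3 ((mem_closedBall.1 hu).trans_lt hρ.2) ⟨(hzero q hq u).1 h0, hne⟩
  obtain ⟨ρ₀, hρ₀, hρ₀pos, hρ₀₁⟩ : ∃ ρ₀ : ℝ, (∀ p ∈ E₀, ∀ q ∈ E₀,
      (p ≠ q → 2 * ρ₀ < dist (a p) (a q)) ∧
      (f p ≠ q → ∀ u ∈ closedBall (a p) ρ₀, 2 * ρ₀ * ‖B u‖ ≤ ‖A u - a q * B u‖) ∧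
      (f p = q → ∀ u ∈ closedBall (a p) ρ₀, u ≠ a p → A u - a q * B u ≠ 0)) ∧
      0 < ρ₀ ∧ ρ₀ < ρ₁ := by
    have h1 := (eventually_all_finite hE).2 fun p hp => (eventually_all_finite hE).2 (hstep1 p hp)
    exact (h1.and (Ioo_mem_nhdsGT hρ₁)).exists
  -- the radius at `f p` is chosen after the radius at `p`
  have hstep2 : ∀ ρ : ℝ, ∃ ρ' : ℝ, 0 < ρ → ρ ≤ ρ₀ → 0 < ρ' ∧ ρ' ≤ ρ ∧
      ∀ p ∈ E₀, ∀ q ∈ E₀, f p = q → ∀ u ∈ sphere (a p) ρ,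
        2 * ρ' * ‖B u‖ ≤ ‖A u - a q * B u‖ := by
    intro ρ
    by_cases hρ : 0 < ρ ∧ ρ ≤ ρ₀
    swap
    · exact ⟨0, fun h1 h2 => absurd ⟨h1, h2⟩ hρ⟩
    have h1 : ∀ p ∈ E₀, ∀ q ∈ E₀, ∀ᶠ ρ' in 𝓝[>] (0 : ℝ), f p = q → ∀ u ∈ sphere (a p) ρ,
        2 * ρ' * ‖B u‖ ≤ ‖A u - a q * B u‖ := by
      intro p hp q hq
      by_cases hpq : f p = q
      swap
      · exact Eventually.of_forall fun _ h => absurd h hpq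
      have hcont : Continuous fun u => ‖A u - a q * B u‖ := by fun_prop
      obtain ⟨m, hm0, hmle⟩ := (isCompact_sphere (a p) ρ).exists_forall_le' hcont.continuousOn
        (a := 0) fun u hu => norm_pos_iff.2 ((hρ₀ p hp q hq).2.2 hpq u
          (sphere_subset_closedBall.trans (closedBall_subset_closedBall hρ.2) hu)
          fun h => by
            have h1 : dist u (a p) = ρ := hu
            rw [h, dist_self] at h1
            exact hρ.1.ne h1)
      obtain ⟨M, hM⟩ := (isCompact_sphere (a p) ρ).exists_bound_of_continuousOn hBc.continuousOn
      have hpos : 0 < m / (2 * (|M| + 1)) := by positivity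
      filter_upwards [Ioo_mem_nhdsGT hpos] with ρ' hρ' _ u hu
      have h2 : ‖B u‖ ≤ |M| + 1 := by linarith [hM u hu, le_abs_self M]
      have h3 := hρ'.2.le
      rw [le_div_iff₀ (by positivity)] at h3
      calc 2 * ρ' * ‖B u‖ ≤ 2 * ρ' * (|M| + 1) := by
            have := hρ'.1
            gcongr
        _ = ρ' * (2 * (|M| + 1)) := by ring
        _ ≤ m := h3
        _ ≤ _ := hmle u hu
    have h2 := (eventually_all_finite hE).2 fun p hp => (eventually_all_finite hE).2 (h1 p hp)
    obtain ⟨ρ', h3, h4⟩ := (h2.and (Ioo_mem_nhdsGT hρ.1)).exists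
    exact ⟨ρ', fun _ _ => ⟨h4.1, h4.2.le, h3⟩⟩
  choose next hnext using hstep2
  set R : ℕ → ℝ := fun n => next^[n] ρ₀ with hR
  have hRs : ∀ n, R (n + 1) = next (R n) := fun n => Function.iterate_succ_apply' _ _ _
  have hRpos : ∀ n, 0 < R n ∧ R n ≤ ρ₀ := fun n => by
    induction n with
    | zero => exact ⟨hρ₀pos, le_rfl⟩
    | succ n ih =>
      rw [hRs]
      have := hnext (R n) ih.1 ih.2
      exact ⟨this.1, this.2.1.trans ih.2⟩
  have hRanti : Antitone R := antitone_nat_of_succ_le fun n => by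
    rw [hRs]; exact (hnext (R n) (hRpos n).1 (hRpos n).2).2.1
  -- the number of the strict predecessors of a point
  set prec : P1 → Set P1 := fun p => {q ∈ E₀ | ∃ j, 0 < j ∧ f^[j] q = p} with hprec
  have hprecsub : ∀ p, prec p ⊆ E₀ := fun p q hq => hq.1
  have hprecfin : ∀ p, (prec p).Finite := fun p => hE.subset (hprecsub p)
  have hheight : ∀ p ∈ E₀, (prec p).ncard < (prec (f p)).ncard := fun p hp => by
    refine ncard_lt_ncard ⟨?_, fun h => ?_⟩ (hprecfin _)
    · rintro q ⟨hq, j, hj, rfl⟩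
      exact ⟨hq, j + 1, j.succ_pos, Function.iterate_succ_apply' _ _ _⟩
    · have h1 : p ∈ prec (f p) := ⟨hp, 1, one_pos, rfl⟩
      obtain ⟨-, j, hj, hjp⟩ := h h1
      exact hper p hp ⟨j, hj, hjp⟩
  refine ⟨fun p => R (prec p).ncard, R (E₀.ncard + 1), (hRpos _).1,
    fun p => ⟨(hRpos _).1, (hRpos _).2.trans hρ₀₁.le⟩, fun p hp q hq hpq => ?_,
    fun p hp q hq u hu => ?_⟩
  · have := (hρ₀ p hp q hq).1 hpq
    have h1 := (hRpos (prec p).ncard).2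
    have h2 := (hRpos (prec q).ncard).2
    linarith
  · have hle : (prec p).ncard ≤ E₀.ncard := ncard_le_ncard (hprecsub p) hE
    by_cases hpq : f p = q
    · have h1 := (hnext _ (hRpos (prec p).ncard).1 (hRpos (prec p).ncard).2).2.2 p hp q hq hpq u hu
      rw [← hRs] at h1
      refine le_trans ?_ h1
      have h2 : R (prec q).ncard ≤ R ((prec p).ncard + 1) := by
        rw [← hpq]; exact hRanti (hheight p hp)
      have h3 : R (E₀.ncard + 1) ≤ R ((prec p).ncard + 1) := hRanti (by omega)
      gcongr
      linarith
    · have h1 := (hρ₀ p hp q hq).2.1 hpq u (sphere_subset_closedBall.trans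
        (closedBall_subset_closedBall (hRpos _).2) hu)
      refine le_trans ?_ h1
      have h2 := (hRpos (prec q).ncard).2
      have h3 := (hRpos (E₀.ncard + 1)).2
      gcongr
      linarith

end Radii

/-! ### The disks on the line at infinity -/

section Core

variable {F : Fin 2 → MvPolynomial (Fin 2) ℂ} {L : LeadingForm F}
  {U : Matrix (Fin 2) (Fin 2) ℂ}

theorem LeadingForm.indetPoints_subset_E : indetPoints F ⊆ L.E := fun _ hp => ⟨0, hp⟩

theorem LeadingForm.mem_E_of_apply {p : P1} (h : L.fInfty p ∈ L.E) : p ∈ L.E := by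
  obtain ⟨n, hn⟩ := h
  exact ⟨n + 1, hn⟩

theorem LeadingForm.apply_mem_E {p : P1} (h : p ∈ L.E) (hp : p ∉ indetPoints F) :
    L.fInfty p ∈ L.E := by
  obtain ⟨n, hn⟩ := h
  cases n with
  | zero => exact absurd hn hp
  | succ n => exact ⟨n, hn⟩

theorem LeadingForm.not_periodic_of_mem_E
    (hper : ∀ p ∈ indetPoints F, p ∉ Function.periodicPts L.fInfty) {p : P1} (h : p ∈ L.E) :
    p ∉ Function.periodicPts L.fInfty := by
  rintro ⟨k, hk, hkp⟩
  obtain ⟨n, hn⟩ := h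
  refine hper _ hn ⟨k, hk, ?_⟩
  change L.fInfty^[k] (L.fInfty^[n] p) = L.fInfty^[n] p
  rw [← Function.iterate_add_apply, add_comm, Function.iterate_add_apply]
  exact congrArg _ hkp

/-- All but finitely many points of `E` are mapped outside the trap: an orbit that reaches an
indeterminacy point, which is not periodic, can spend only a bounded time in the trap. -/
theorem ExpansionSetup.finite_far {w : P1 → ℝ} {σ : ℝ} (hs : ExpansionSetup L U w σ)
    (hnc : ∃ p q : P1, L.fInfty p ≠ L.fInfty q)
    (hper : ∀ p ∈ indetPoints F, p ∉ Function.periodicPts L.fInfty) :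
    {p ∈ L.E | w (L.fInfty p) ≤ σ}.Finite := by
  have hI := L.finite_indetPoints (L.algDegree_pos hnc)
  have h1 : ∀ z ∈ indetPoints F, {p | w (L.fInfty p) ≤ σ ∧ ∃ n, L.fInfty^[n] p = z}.Finite := by
    intro z hz
    obtain ⟨n₀, hn₀⟩ := hs.trap.escape z (hper z hz)
    refine ((finite_Iic n₀).biUnion fun n _ => L.finite_iterate_fiber hnc n z).subset ?_
    rintro p ⟨hp, n, hn⟩
    refine mem_biUnion (x := n) ?_ hn
    by_contra hlt
    rw [mem_Iic, not_le] at hlt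
    obtain ⟨k, rfl⟩ : ∃ k, n = k + 1 := ⟨n - 1, by omega⟩
    exact hn₀ k (by omega) _ (hp.trans_lt hs.lt_one) hn
  refine (hI.biUnion h1).subset ?_
  rintro p ⟨⟨n, hn⟩, hp⟩
  exact mem_biUnion hn ⟨hp, n, rfl⟩

/-- Radii for all points of `E` such that the circle about `p` is mapped outside the disk about `q`
with margin `μ`, where `q = f_∞ p`, or `q ∈ E` is arbitrary if `p` is an indeterminacy point. The
estimate is written with numerator and denominator of `f_∞`, since a circle may contain a preimage
of the missed point. -/
theorem exists_radii (hyp : L.IsHyperbolic) (hnc : ∃ p q : P1, L.fInfty p ≠ L.fInfty q)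
    (hJ : ∀ p ∈ indetPoints F, p ∉ juliaSet L.fInfty)
    (hper : ∀ p ∈ indetPoints F, p ∉ Function.periodicPts L.fInfty)
    (hU : U ∈ Matrix.unitaryGroup (Fin 2) ℂ) (hm : missedPoint U ∉ juliaSet L.fInfty ∪ L.E)
    {δ : ℝ} (hδ : 0 < δ) :
    ∃ (r : P1 → ℝ) (μ : ℝ) (K : Set ℂ) (Q : ℝ), 0 < μ ∧ IsCompact K ∧
      (∀ p ∈ L.E, 0 < r p ∧ r p < δ) ∧
      (∀ p ∈ L.E, sphere (affCoord U p) (r p) ⊆ K) ∧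
      (∀ u ∈ K, aff U u ∉ indetPoints F) ∧
      (∀ p ∈ L.E, ‖affCoord U p‖ ≤ Q) ∧
      (∀ p ∈ L.E, ∀ q ∈ L.E, (p ∈ indetPoints F ∨ q = L.fInfty p) →
        ∀ u ∈ sphere (affCoord U p) (r p), (r q + μ) * ‖(chartNum L U 1).eval u‖ ≤
          ‖(chartNum L U 0).eval u - affCoord U q * (chartNum L U 1).eval u‖) ∧
      (∀ p ∈ indetPoints F, ∀ q ∈ L.E, q ≠ p →
        Disjoint (ball (affCoord U p) (r p)) (ball (affCoord U q) (r q))) ∧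
      (∀ q ∈ L.E, ∀ q' ∈ L.E, L.fInfty q = L.fInfty q' → q ≠ q' →
        Disjoint (ball (affCoord U q) (r q)) (ball (affCoord U q') (r q'))) := by
  set f := L.fInfty with hf
  set a := affCoord U with ha
  have hIfin := L.finite_indetPoints (L.algDegree_pos hnc)
  have hFatou : ∀ p, p ∉ juliaSet f → p ∈ basin f := fun p hp =>
    hyp.fatouSet_subset (notMem_compl_iff.1 hp)
  obtain ⟨w, σ, hs, hI⟩ := hyp.exists_expansionSetup hIfin.isClosed
    (fun p hp => hFatou p (hJ p hp)) hU (hFatou _ fun h => hm (Or.inl h))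
  obtain ⟨R, hR, η, hη, lam, hlam, hWR, hball, hexp⟩ := hs.exists_expansion
  set W : Set ℂ := {u | σ < w (aff U u)} with hW
  set S := innerRadius W with hS
  set h := chartMap L U with hh
  set A : ℂ → ℂ := fun u => (chartNum L U 0).eval u with hA
  set B : ℂ → ℂ := fun u => (chartNum L U 1).eval u with hB
  have hAc : Continuous A := (chartNum L U 0).continuous
  have hBc : Continuous B := (chartNum L U 1).continuous
  have haff : ∀ p ∈ L.E, aff U (a p) = p := fun p hp =>
    aff_affCoord hU fun h0 => hm (Or.inr (h0 ▸ hp))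
  have hfrac : ∀ u z, B u ≠ 0 → ‖A u - z * B u‖ = ‖h u - z‖ * ‖B u‖ := fun u z hu => by
    rw [← norm_mul, sub_mul]
    congr 2
    exact (div_mul_cancel₀ _ hu).symm
  -- uniform estimates near the closed set of the points mapped outside the trap
  set Ks : Set ℂ := {u | σ ≤ w (f (aff U u))} with hKs
  have hKsc : IsCompact Ks := hs.isCompact_le_source
  set V : Set ℂ := W ∩ {u | B u ≠ 0} with hV
  have hVo : IsOpen V := hs.isOpen_target.inter (isOpen_ne_fun hBc continuous_const)
  have hKV : Ks ⊆ V := fun u hu => ⟨hs.lt_of_mem_source hu, hs.chartNum_one_ne_zero hu⟩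
  have hdV : ∀ u ∈ V, HasDerivAt h (chartDeriv L U u) u := fun u hu =>
    (hasStrictDerivAt_chartMap L hu.2).hasDerivAt
  have hcV : ContinuousOn (chartDeriv L U) V := by
    refine ContinuousOn.div ?_ ?_ fun u hu => pow_ne_zero 2 hu.2
    · exact ((((chartNum L U 0).derivative.continuous.mul hBc).sub
        (hAc.mul (chartNum L U 1).derivative.continuous))).continuousOn
    · exact (hBc.pow 2).continuousOn
  obtain ⟨b, hb, hbK⟩ := hKsc.exists_forall_le' (hcV.mono hKV).norm (a := 0) fun u hu =>
    norm_pos_iff.2 (hs.chartDeriv_ne_zero hu)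
  -- the relative error `θ₀` of the linearization costs less than the expansion by `lam` gains
  set θ₀ : ℝ := (1 - lam⁻¹) / 2 with hθ₀
  have hlam0 : 0 < lam := by linarith
  have hlaminv : lam⁻¹ < 1 := inv_lt_one_of_one_lt₀ hlam
  have hlaminv0 : 0 < lam⁻¹ := inv_pos.2 hlam0
  have hθpos : 0 < θ₀ := by rw [hθ₀]; linarith
  have hθhalf : 1 / 2 ≤ 1 - θ₀ := by rw [hθ₀]; linarith
  have hθlam : (1 - θ₀) * lam = (lam + 1) / 2 := by rw [hθ₀]; field_simp; ring
  obtain ⟨η₁, hη₁, hlin⟩ := exists_uniform_linearization hKsc hVo hKV hdV hcV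
    (mul_pos hθpos hb)
  obtain ⟨η₂, hη₂, hth⟩ := hKsc.exists_cthickening_subset_open hVo hKV
  have hlow : ∀ x ∈ Ks, ∀ y ∈ closedBall x η₁,
      (1 - θ₀) * (‖chartDeriv L U x‖ * ‖y - x‖) ≤ ‖h y - h x‖ := fun x hx y hy => by
    have h1 := (hlin x hx).2 y hy
    have h2 : ‖chartDeriv L U x * (y - x)‖ ≤
        ‖h y - h x‖ + ‖h y - h x - chartDeriv L U x * (y - x)‖ := by
      have := norm_sub_le (h y - h x) (h y - h x - chartDeriv L U x * (y - x))
      rwa [sub_sub_cancel] at this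
    rw [norm_mul] at h2
    have h3 : θ₀ * b * ‖y - x‖ ≤ θ₀ * ‖chartDeriv L U x‖ * ‖y - x‖ := by
      gcongr; exact hbK x hx
    linarith
  -- the radii outside the trap are proportional to `S`
  set e₀ : ℝ := min (min η₁ η₂) (min η δ) with he₀
  have he₀pos : 0 < e₀ := by positivity
  set ε : ℝ := e₀ / (8 * R) with hε
  have hεpos : 0 < ε := by positivity
  have hεS : ∀ x, ε * S x ≤ e₀ / 4 := fun x => by
    have h1 : S x ≤ 2 * R := innerRadius_le hR.le hWR x
    calc ε * S x ≤ ε * (2 * R) := by gcongr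
      _ = e₀ / 4 := by rw [hε]; field_simp; ring
  have he1 : e₀ ≤ η₁ := (min_le_left _ _).trans (min_le_left _ _)
  have he2 : e₀ ≤ η₂ := (min_le_left _ _).trans (min_le_right _ _)
  have he4 : e₀ ≤ δ := (min_le_right _ _).trans (min_le_right _ _)
  have hSη : ∀ x ∈ Ks, η ≤ S x := fun x hx =>
    le_innerRadius hWR hη (ball_subset_closedBall.trans (hball x hx))
  -- the finitely many remaining points
  set E₀ : Set P1 := {p ∈ L.E | w (f p) ≤ σ} with hE₀
  have hE₀fin : E₀.Finite := hs.finite_far hnc hper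
  have hIE₀ : indetPoints F ⊆ E₀ := fun p hp =>
    ⟨L.indetPoints_subset_E hp, (hs.apply_lt (hI p hp).le).le⟩
  set κ₀ : ℝ := ε * (b * η) / 4 with hκ₀
  have hκ₀pos : 0 < κ₀ := by positivity
  obtain ⟨ρI, hρI, hρIδ, hρIpos⟩ : ∃ ρ : ℝ,
      (∀ p ∈ indetPoints F, ∀ u ∈ closedBall (a p) ρ, w (aff U u) < σ) ∧ ρ < min κ₀ δ ∧ 0 < ρ := by
    have h1 : ∀ p ∈ indetPoints F, ∀ᶠ ρ in 𝓝[>] (0 : ℝ),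
        ∀ u ∈ closedBall (a p) ρ, w (aff U u) < σ := fun p hp => by
      have h2 : ∀ᶠ u in 𝓝 (a p), w (aff U u) < σ :=
        (hs.trap.continuous.comp (continuous_aff hU)).continuousAt.eventually
          (gt_mem_nhds (by
            change w (aff U (a p)) < σ
            rw [haff p (L.indetPoints_subset_E hp)]; exact hI p hp))
      obtain ⟨e, he, h3⟩ := Metric.eventually_nhds_iff.1 h2
      filter_upwards [Ioo_mem_nhdsGT he] with ρ hρ u hu
      exact h3 ((mem_closedBall.1 hu).trans_lt hρ.2)
    have h4 := (eventually_all_finite hIfin).2 h1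
    have h5 : 0 < min κ₀ δ := by positivity
    obtain ⟨ρ, h6, h7⟩ := (h4.and (Ioo_mem_nhdsGT h5)).exists
    exact ⟨ρ, h6, h7.2, h7.1⟩
  obtain ⟨rf, μf, hμf, hrf, hsep, hmarg⟩ := exists_radii_of_finite hU hnc hE₀fin
    (fun p hp => L.not_periodic_of_mem_E hper hp.1) (fun h0 => hm (Or.inr h0.1)) hρIpos
  classical
  set r : P1 → ℝ := fun p => if w (f p) ≤ σ then rf p else ε * S (a p) with hr
  have hrfar : ∀ p, w (f p) ≤ σ → r p = rf p := fun p hp => if_pos hp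
  have hrnear : ∀ p, σ < w (f p) → r p = ε * S (a p) := fun p hp => if_neg (not_le.2 hp)
  set μ : ℝ := min (min μf (e₀ / 4)) (min ((lam - 1) / 2 * (ε * η)) κ₀) with hμ
  have hμpos : 0 < μ := by
    have : 0 < (lam - 1) / 2 := by linarith
    positivity
  have hμ1 : μ ≤ μf := (min_le_left _ _).trans (min_le_left _ _)
  have hμ2 : μ ≤ e₀ / 4 := (min_le_left _ _).trans (min_le_right _ _)
  have hμ3 : μ ≤ (lam - 1) / 2 * (ε * η) := (min_le_right _ _).trans (min_le_left _ _)
  have hμ4 : μ ≤ κ₀ := (min_le_right _ _).trans (min_le_right _ _)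
  have hnearK : ∀ p ∈ L.E, σ < w (f p) → a p ∈ Ks := fun p hp hpw => by
    change σ ≤ w (f (aff U (a p)))
    rw [haff p hp]; exact hpw.le
  have hrle : ∀ p, σ < w (f p) → r p ≤ e₀ / 4 := fun p hp => by
    rw [hrnear p hp]; exact hεS _
  have hrpos : ∀ p ∈ L.E, 0 < r p := fun p hp => by
    rcases le_or_gt (w (f p)) σ with h1 | h1
    · rw [hrfar p h1]; exact (hrf p).1
    · rw [hrnear p h1]
      exact mul_pos hεpos (hη.trans_le (hSη _ (hnearK p hp h1)))
  have hdisc : ∀ q ∈ L.E, σ < w (f q) → ∀ z ∈ closedBall (a q) η₁, σ < w (aff U z) :=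
    fun q hq hqw z hz => ((hlin _ (hnearK q hq hqw)).1 hz).1
  -- the spheres outside the trap expand
  have hspN : ∀ p ∈ L.E, σ < w (f p) → ∀ u ∈ sphere (a p) (r p), B u ≠ 0 ∧
      (1 - θ₀) * (‖chartDeriv L U (a p)‖ * (ε * S (a p))) ≤ ‖h u - a (f p)‖ := by
    intro p hp hpw u hu
    have hK := hnearK p hp hpw
    have hub : u ∈ closedBall (a p) η₁ := by
      rw [mem_closedBall, mem_sphere.1 hu]
      have := hrle p hpw
      linarith
    refine ⟨((hlin _ hK).1 hub).2, ?_⟩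
    have h1 : h (a p) = a (f p) := by
      have h2 := hs.fInfty_aff hK
      rw [haff p hp] at h2
      change h (a p) = affCoord U (f p)
      rw [hf, h2, affCoord_aff hU]
    rw [← h1, ← hrnear p hpw, ← mem_sphere.1 hu, dist_eq_norm]
    exact hlow _ hK u hub
  have hgoalN : ∀ p ∈ L.E, σ < w (f p) → f p ∈ L.E → ∀ u ∈ sphere (a p) (r p),
      (r (f p) + μ) * ‖B u‖ ≤ ‖A u - a (f p) * B u‖ := by
    intro p hp hpw hfp u hu
    obtain ⟨hBu, h1⟩ := hspN p hp hpw u hu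
    have hK := hnearK p hp hpw
    rw [hfrac u _ hBu]
    gcongr
    refine le_trans ?_ h1
    rcases le_or_gt (w (f (f p))) σ with h2 | h2
    · rw [hrfar _ h2]
      have h3 := (hrf (f p)).2.trans (hρIδ.le.trans (min_le_left _ _))
      have h4 : b * η ≤ ‖chartDeriv L U (a p)‖ * S (a p) :=
        mul_le_mul (hbK _ hK) (hSη _ hK) hη.le (norm_nonneg _)
      calc rf (f p) + μ ≤ κ₀ + κ₀ := add_le_add h3 hμ4
        _ = 1 / 2 * (ε * (b * η)) := by rw [hκ₀]; ring
        _ ≤ (1 - θ₀) * (ε * (‖chartDeriv L U (a p)‖ * S (a p))) := by gcongr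
        _ = _ := by ring
    · rw [hrnear _ h2]
      have hpw' : σ < w (f (aff U (a p))) := by rw [haff p hp]; exact hpw
      have h3 := hexp (a p) hpw'
      have h5 : h (a p) = a (f p) := by
        have h6 := hs.fInfty_aff hK
        rw [haff p hp] at h6
        change h (a p) = affCoord U (f p)
        rw [hf, h6, affCoord_aff hU]
      have h3' : lam * S (a (f p)) ≤ ‖chartDeriv L U (a p)‖ * S (a p) := by
        rw [← h5]; exact h3
      have h7 : η ≤ S (a (f p)) := hSη _ (hnearK _ hfp h2)
      have h8 : (lam - 1) / 2 * (ε * η) ≤ (lam - 1) / 2 * (ε * S (a (f p))) := by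
        have : 0 < lam - 1 := by linarith
        gcongr
      calc ε * S (a (f p)) + μ ≤ ε * S (a (f p)) + (lam - 1) / 2 * (ε * S (a (f p))) := by
            linarith
        _ = ε * ((lam + 1) / 2 * S (a (f p))) := by ring
        _ = ε * ((1 - θ₀) * (lam * S (a (f p)))) := by rw [← hθlam]; ring
        _ ≤ ε * ((1 - θ₀) * (‖chartDeriv L U (a p)‖ * S (a p))) := by
            have : 0 ≤ 1 - θ₀ := by linarith
            gcongr
        _ = _ := by ring
  -- the circles around the remaining points
  have hspF : ∀ p ∈ E₀, ∀ u ∈ sphere (a p) (rf p), ∀ q ∈ E₀, aff U u ≠ q := by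
    rintro p hp u hu q hq rfl
    by_cases hpq : p = aff U u
    · have h1 : dist u (a p) = rf p := hu
      have h2 : a p = u := by rw [hpq]; exact affCoord_aff hU u
      rw [h2, dist_self] at h1
      exact (hrf p).1.ne h1
    · have h1 := hsep p hp _ hq hpq
      have h2 : dist u (a p) = rf p := hu
      have h3 : affCoord U (aff U u) = u := affCoord_aff hU u
      rw [h3, dist_comm] at h1
      have h4 := (hrf (aff U u)).1
      have h5 : dist u (affCoord U p) = rf p := h2
      linarith
  obtain ⟨Q₀, hQ₀⟩ := (hE₀fin.image a).isBounded.exists_norm_le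
  refine ⟨r, μ, cthickening η₂ Ks ∪ ⋃ p ∈ E₀, sphere (a p) (rf p), max R Q₀, hμpos,
    hKsc.cthickening.union (hE₀fin.isCompact_biUnion fun p _ => isCompact_sphere _ _),
    fun p hp => ⟨hrpos p hp, ?_⟩, fun p hp => ?_, ?_, fun p hp => ?_, fun p hp q hq hpq u hu => ?_,
    fun p hp q hq hqp => ?_, fun q hq q' hq' hqq hne => ?_⟩
  · rcases le_or_gt (w (f p)) σ with h1 | h1
    · rw [hrfar p h1]
      exact (hrf p).2.trans_lt (hρIδ.trans_le (min_le_right _ _))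
    · have := hrle p h1
      linarith
  · rcases le_or_gt (w (f p)) σ with h1 | h1
    · rw [hrfar p h1]
      exact subset_union_of_subset_right (subset_biUnion_of_mem (u := fun p => sphere (a p) (rf p))
        (⟨hp, h1⟩ : p ∈ E₀)) _
    · refine subset_union_of_subset_left (sphere_subset_closedBall.trans ?_) _
      refine (closedBall_subset_closedBall ?_).trans
        (closedBall_subset_cthickening (hnearK p hp h1) η₂)
      have := hrle p h1
      linarith
  · rintro u (hu | hu) hI'
    · have h1 : σ < w (aff U u) := (hth hu).1
      exact absurd (hI _ hI') (not_lt.2 h1.le)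
    · rw [mem_iUnion₂] at hu
      obtain ⟨p, hp, hu⟩ := hu
      exact hspF p hp u hu _ (hIE₀ hI') rfl
  · rcases le_or_gt (w (f p)) σ with h1 | h1
    · exact (hQ₀ _ (mem_image_of_mem _ (⟨hp, h1⟩ : p ∈ E₀))).trans (le_max_right _ _)
    · have h2 : a p ∈ W := (hKV (hnearK p hp h1)).1
      exact (mem_ball_zero_iff.1 (hWR h2)).le.trans (le_max_left _ _)
  · by_cases hpw : σ < w (f p)
    · have hpI : p ∉ indetPoints F := fun h0 => absurd (hIE₀ h0).2 (not_le.2 hpw)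
      obtain rfl := hpq.resolve_left hpI
      exact hgoalN p hp hpw hq u hu
    · rw [not_lt] at hpw
      have hpE₀ : p ∈ E₀ := ⟨hp, hpw⟩
      rw [hrfar p hpw] at hu
      rcases le_or_gt (w (f q)) σ with hqw | hqw
      · have h1 := hmarg p hpE₀ q ⟨hq, hqw⟩ u hu
        rw [hrfar q hqw]
        refine le_trans ?_ h1
        gcongr
      · have hpI : p ∈ indetPoints F := by
          refine hpq.resolve_right ?_
          rintro rfl
          exact absurd (hs.apply_lt hpw).le (not_le.2 hqw)
        have h1 : w (aff U u) < σ := hρI p hpI u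
          ((sphere_subset_closedBall.trans (closedBall_subset_closedBall (hrf p).2)) hu)
        by_contra hlt
        rw [not_le] at hlt
        have hBu : B u ≠ 0 := fun h0 => by
          have h0' : Polynomial.eval u (chartNum L U 1) = 0 := h0
          simp only [h0', norm_zero, mul_zero] at hlt
          exact absurd hlt (not_lt.2 (norm_nonneg _))
        have h2 : ‖A u - a q * B u‖ < (r q + μ) * ‖B u‖ := hlt
        rw [hfrac u _ hBu] at h2
        have h3 : ‖h u - a q‖ < r q + μ := lt_of_mul_lt_mul_right h2 (norm_nonneg _)
        have h4 : h u ∈ closedBall (a q) η₁ := by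
          rw [mem_closedBall, dist_eq_norm]
          have := hrle q hqw
          linarith
        have h5 := hdisc q hq hqw _ h4
        rw [← fInfty_aff L hU hBu] at h5
        exact absurd (hs.apply_lt h1.le) (not_lt.2 h5.le)
  · have hpE₀ := hIE₀ hp
    rcases le_or_gt (w (f q)) σ with hqw | hqw
    · rw [hrfar q hqw, hrfar p hpE₀.2]
      exact ball_disjoint_ball (hsep p hpE₀ q ⟨hq, hqw⟩ hqp.symm).le
    · rw [Set.disjoint_left]
      intro u hu hu'
      rw [hrfar p hpE₀.2] at hu
      have h1 : w (aff U u) < σ := hρI p hp u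
        ((ball_subset_closedBall.trans (closedBall_subset_closedBall (hrf p).2)) hu)
      have h2 := hdisc q hq hqw u (ball_subset_closedBall.trans
        (closedBall_subset_closedBall (by have := hrle q hqw; linarith)) hu')
      exact absurd h1 (not_lt.2 h2.le)
  · rcases le_or_gt (w (f q)) σ with hqw | hqw
    · have hqw' : w (f q') ≤ σ := hqq ▸ hqw
      rw [hrfar q hqw, hrfar q' hqw']
      exact ball_disjoint_ball (hsep q ⟨hq, hqw⟩ q' ⟨hq', hqw'⟩ hne).le
    · have hqw' : σ < w (f q') := hqq ▸ hqw
      refine ball_disjoint_ball ?_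
      by_contra hlt
      rw [not_le] at hlt
      have hK := hnearK q hq hqw
      have hK' := hnearK q' hq' hqw'
      have h1 : a q' ∈ closedBall (a q) η₁ := by
        rw [mem_closedBall, dist_comm]
        have h2 := hrle q hqw
        have h3 := hrle q' hqw'
        linarith
      have h2 := hlow _ hK _ h1
      have h3 : h (a q') = h (a q) := by
        apply aff_injective hU
        have e1 := hs.fInfty_aff hK
        have e2 := hs.fInfty_aff hK'
        rw [haff q hq] at e1
        rw [haff q' hq'] at e2
        rw [← e1, ← e2]; exact hqq.symm
      rw [h3, sub_self, norm_zero] at h2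
      have h4 : a q' ≠ a q := fun h0 => hne (by rw [← haff q hq, ← haff q' hq', h0])
      have h5 : 0 < ‖a q' - a q‖ := norm_pos_iff.2 (sub_ne_zero.2 h4)
      have h6 : 0 < ‖chartDeriv L U (a q)‖ := norm_pos_iff.2 (hs.chartDeriv_ne_zero hK)
      have h7 : 0 < 1 - θ₀ := by linarith
      have := mul_pos h7 (mul_pos h6 h5)
      linarith

end Core

/-! ### The projective plane and bidisks -/

section Plane

theorem isOpen_of_forall_toProj {S : Set P2} {T : Set (Fin 3 → ℂ)} (hT : IsOpen T)
    (h : ∀ V : Fin 3 → ℂ, V ≠ 0 → (toProj V ∈ S ↔ V ∈ T)) : IsOpen S := by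
  have hq : IsOpen (Quotient.mk (projectivizationSetoid ℂ (Fin 3 → ℂ)) ⁻¹' S) := by
    convert hT.preimage (continuous_subtype_val (p := fun v : Fin 3 → ℂ => v ≠ 0)) using 1
    ext V
    have := h V.1 V.2
    rw [toProj_of_ne_zero V.2] at this
    exact this
  exact hq

theorem isClosed_of_forall_toProj {S : Set P2} {T : Set (Fin 3 → ℂ)} (hT : IsClosed T)
    (h : ∀ V : Fin 3 → ℂ, V ≠ 0 → (toProj V ∈ S ↔ V ∈ T)) : IsClosed S := by
  rw [← isOpen_compl_iff]
  exact isOpen_of_forall_toProj hT.isOpen_compl fun V hV => not_congr (h V hV)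

variable {F : Fin 2 → MvPolynomial (Fin 2) ℂ}

/-- If `S` is closed and contains the images of all regular points near a point, then it contains
the whole image of this point under the meromorphic extension. -/
theorem mem_of_mem_closure_regularGraph {x₀ : Fin 3 → ℂ} (hx₀ : x₀ ≠ 0) {y : P2}
    (h : ((toProj x₀, y) : P2 × P2) ∈ closure (regularGraph F)) {S : Set P2} (hS : IsClosed S)
    (hev : ∀ᶠ V in 𝓝 x₀, homLift F V ≠ 0 → toProj (homLift F V) ∈ S) : y ∈ S := by
  by_contra hy
  obtain ⟨N, hN, hNo, hxN⟩ := _root_.mem_nhds_iff.1 hev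
  set O : Set P2 := {x | ∃ V : Fin 3 → ℂ, V ≠ 0 ∧ toProj V = x ∧ V ∈ N} with hO
  have hOo : IsOpen O := by
    refine isOpen_of_forall_toProj
      (T := ⋃ c : {c : ℂ // c ≠ 0}, (fun V : Fin 3 → ℂ => (c : ℂ) • V) ⁻¹' N)
      (isOpen_iUnion fun c => hNo.preimage (continuous_const_smul (c : ℂ))) fun V hV => ?_
    rw [mem_iUnion]
    constructor
    · rintro ⟨V', hV', hVV', hV'N⟩
      obtain ⟨c, rfl⟩ := (toProj_eq_toProj_iff hV' hV).1 hVV'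
      exact ⟨⟨c, fun hc => hV' (by rw [hc, zero_smul])⟩, hV'N⟩
    · rintro ⟨c, hc⟩
      exact ⟨(c : ℂ) • V, smul_ne_zero c.2 hV, toProj_smul c.2 hV, hc⟩
  have hxO : (toProj x₀ : P2) ∈ O := ⟨x₀, hx₀, rfl, hxN⟩
  obtain ⟨⟨x', y'⟩, ⟨⟨V, hV, hVx, hVN⟩, hy'⟩, hx', hyx⟩ :=
    mem_closure_iff.1 h (O ×ˢ Sᶜ) (hOo.prod hS.isOpen_compl) ⟨hxO, hy⟩
  simp only at hVx hx' hyx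
  apply hy'
  obtain ⟨c, hc, hrep⟩ := exists_rep_toProj hV
  rw [← hVx] at hx' hyx
  have hne : homLift F V ≠ 0 := mt (toProj_mem_indetSet_iff hV).2 hx'
  change y' ∈ S
  rw [hyx, hrep, homLift_smul, toProj_smul (pow_ne_zero _ hc) hne]
  exact hN hVN hne

theorem mem_regularGraph {V : Fin 3 → ℂ} (hV : V ≠ 0) (hne : homLift F V ≠ 0) :
    ((toProj V, toProj (homLift F V)) : P2 × P2) ∈ regularGraph F := by
  refine ⟨mt (toProj_mem_indetSet_iff hV).1 hne, ?_⟩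
  obtain ⟨c, hc, hrep⟩ := exists_rep_toProj hV
  change toProj (homLift F V) = toProj (homLift F (toProj V).rep)
  rw [hrep, homLift_smul, toProj_smul (pow_ne_zero _ hc) hne]

/-- The coordinates `Z'` (for `i = 0`) and `W'` (for `i = 1`) of `(Z, W) = U (Z', W')`. -/
noncomputable def coord (U : Matrix (Fin 2) (Fin 2) ℂ) (i : Fin 2) (V : Fin 3 → ℂ) : ℂ :=
  (Uᴴ *ᵥ ![V 0, V 1]) i

/-- The homogeneous coordinates of `chart U (u, v)`. -/
noncomputable def chartVec (U : Matrix (Fin 2) (Fin 2) ℂ) (u v : ℂ) : Fin 3 → ℂ :=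
  ![(U *ᵥ ![u, 1]) 0, (U *ᵥ ![u, 1]) 1, v]

variable {U : Matrix (Fin 2) (Fin 2) ℂ}

theorem chart_eq (u v : ℂ) : chart U (u, v) = toProj (chartVec U u v) := rfl

theorem chartVec_ne_zero (hU : U ∈ Matrix.unitaryGroup (Fin 2) ℂ) (u v : ℂ) :
    chartVec U u v ≠ 0 :=
  vec3_ne_zero (unitary_mulVec_ne_zero hU (vec_one_ne_zero u)) v

theorem continuous_coord (i : Fin 2) : Continuous (coord U i) := by
  have h : Continuous fun V : Fin 3 → ℂ => (![V 0, V 1] : Fin 2 → ℂ) :=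
    continuous_pi fun j => by fin_cases j <;> simp <;> fun_prop
  exact (continuous_apply i).comp (Continuous.matrix_mulVec continuous_const h)

theorem coord_smul (i : Fin 2) (c : ℂ) (V : Fin 3 → ℂ) : coord U i (c • V) = c * coord U i V := by
  have : ![(c • V) 0, (c • V) 1] = c • ![V 0, V 1] := by ext j; fin_cases j <;> rfl
  rw [coord, this, Matrix.mulVec_smul]; rfl

theorem coord_vec (hU : U ∈ Matrix.unitaryGroup (Fin 2) ℂ) (x y t : ℂ) :
    coord U 0 ![(U *ᵥ ![x, y]) 0, (U *ᵥ ![x, y]) 1, t] = x ∧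
      coord U 1 ![(U *ᵥ ![x, y]) 0, (U *ᵥ ![x, y]) 1, t] = y := by
  have : (![(U *ᵥ ![x, y]) 0, (U *ᵥ ![x, y]) 1] : Fin 2 → ℂ) = U *ᵥ ![x, y] := by
    ext j; fin_cases j <;> rfl
  have h : Uᴴ *ᵥ (![(U *ᵥ ![x, y]) 0, (U *ᵥ ![x, y]) 1] : Fin 2 → ℂ) = ![x, y] := by
    rw [this, conjTranspose_mulVec_mulVec hU]
  exact ⟨congrFun h 0, congrFun h 1⟩

theorem eq_of_coord (hU : U ∈ Matrix.unitaryGroup (Fin 2) ℂ) (V : Fin 3 → ℂ) :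
    V = ![(U *ᵥ ![coord U 0 V, coord U 1 V]) 0, (U *ᵥ ![coord U 0 V, coord U 1 V]) 1, V 2] := by
  have h : ![coord U 0 V, coord U 1 V] = Uᴴ *ᵥ ![V 0, V 1] := by
    ext j; fin_cases j <;> rfl
  rw [h, mulVec_conjTranspose_mulVec hU]
  ext j; fin_cases j <;> rfl

theorem toProj_eq_chart_iff (hU : U ∈ Matrix.unitaryGroup (Fin 2) ℂ) {V : Fin 3 → ℂ} (hV : V ≠ 0)
    {u v : ℂ} : toProj V = chart U (u, v) ↔
      coord U 1 V ≠ 0 ∧ coord U 0 V = u * coord U 1 V ∧ V 2 = v * coord U 1 V := by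
  rw [chart_eq, toProj_eq_toProj_iff hV (chartVec_ne_zero hU u v)]
  have h := coord_vec hU u 1 v
  constructor
  · rintro ⟨c, rfl⟩
    rw [coord_smul, coord_smul, chartVec, h.1, h.2, mul_one]
    refine ⟨fun hc => hV (by rw [hc, zero_smul]), mul_comm _ _, ?_⟩
    simp [mul_comm]
  · rintro ⟨-, h0, h2⟩
    refine ⟨coord U 1 V, ?_⟩
    conv_rhs => rw [eq_of_coord hU V, h0, h2]
    have : (![u * coord U 1 V, coord U 1 V] : Fin 2 → ℂ) = coord U 1 V • ![u, 1] := by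
      ext j; fin_cases j <;> simp [mul_comm]
    rw [this, Matrix.mulVec_smul]
    ext j; fin_cases j <;> simp [chartVec, mul_comm]

theorem eq_zero_of_coord (hU : U ∈ Matrix.unitaryGroup (Fin 2) ℂ) {V : Fin 3 → ℂ}
    (h0 : coord U 0 V = 0) (h1 : coord U 1 V = 0) (h2 : V 2 = 0) : V = 0 := by
  rw [eq_of_coord hU V, h0, h1, h2]
  ext j; fin_cases j <;> simp [Matrix.mulVec, dotProduct]

theorem chart_injective (hU : U ∈ Matrix.unitaryGroup (Fin 2) ℂ) {u v u' v' : ℂ}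
    (h : chart U (u, v) = chart U (u', v')) : u = u' ∧ v = v' := by
  rw [chart_eq u v, toProj_eq_chart_iff hU (chartVec_ne_zero hU u v)] at h
  have h1 := coord_vec hU u 1 v
  rw [chartVec, h1.1, h1.2, mul_one, mul_one] at h
  exact h.2

theorem toProj_mem_carrier_iff (hU : U ∈ Matrix.unitaryGroup (Fin 2) ℂ) (Δ : Bidisk)
    {V : Fin 3 → ℂ} (hV : V ≠ 0) : toProj V ∈ Δ.carrier U ↔
      ‖coord U 0 V - Δ.center * coord U 1 V‖ < Δ.r * ‖coord U 1 V‖ ∧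
        ‖V 2‖ < Δ.s * ‖coord U 1 V‖ := by
  constructor
  · rintro ⟨⟨u, v⟩, ⟨hu, hv⟩, h⟩
    obtain ⟨h1, h0, h2⟩ := (toProj_eq_chart_iff hU hV).1 h.symm
    have h1' := norm_pos_iff.2 h1
    rw [h0, h2, ← sub_mul, norm_mul, norm_mul]
    rw [mem_ball, dist_eq_norm] at hu
    rw [mem_ball_zero_iff] at hv
    exact ⟨mul_lt_mul_of_pos_right hu h1', mul_lt_mul_of_pos_right hv h1'⟩
  · rintro ⟨h0, h2⟩
    have h1 : coord U 1 V ≠ 0 := fun h => by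
      rw [h, norm_zero, mul_zero] at h2
      exact absurd h2 (not_lt.2 (norm_nonneg _))
    have h1' := norm_pos_iff.2 h1
    refine ⟨(coord U 0 V / coord U 1 V, V 2 / coord U 1 V), ⟨?_, ?_⟩, ?_⟩
    · rw [mem_ball, dist_eq_norm, div_sub' h1, norm_div, div_lt_iff₀ h1', mul_comm (coord U 1 V)]
      exact h0
    · rw [mem_ball_zero_iff, norm_div, div_lt_iff₀ h1']
      exact h2
    · exact ((toProj_eq_chart_iff hU hV).2
        ⟨h1, (div_mul_cancel₀ _ h1).symm, (div_mul_cancel₀ _ h1).symm⟩).symm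

theorem isOpen_carrier (hU : U ∈ Matrix.unitaryGroup (Fin 2) ℂ) (Δ : Bidisk) :
    IsOpen (Δ.carrier U) := by
  have h0 := continuous_coord (U := U) 0
  have h1 := continuous_coord (U := U) 1
  refine isOpen_of_forall_toProj
    (T := {V | ‖coord U 0 V - Δ.center * coord U 1 V‖ < Δ.r * ‖coord U 1 V‖} ∩
      {V | ‖V 2‖ < Δ.s * ‖coord U 1 V‖})
    (IsOpen.inter (isOpen_lt ?_ ?_) (isOpen_lt ?_ ?_))
    fun V hV => toProj_mem_carrier_iff hU Δ hV
  all_goals fun_prop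

theorem exists_of_mem_closure_carrier (hU : U ∈ Matrix.unitaryGroup (Fin 2) ℂ) {Δ : Bidisk} {y : P2}
    (hy : y ∈ closure (Δ.carrier U)) :
    ∃ u v, y = chart U (u, v) ∧ ‖u - Δ.center‖ ≤ Δ.r ∧ ‖v‖ ≤ Δ.s := by
  have h0 := continuous_coord (U := U) 0
  have h1 := continuous_coord (U := U) 1
  set S : Set P2 := {y | ∃ u v, y = chart U (u, v) ∧ ‖u - Δ.center‖ ≤ Δ.r ∧ ‖v‖ ≤ Δ.s} with hS
  have hcl : IsClosed S := by
    refine isClosed_of_forall_toProj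
      (T := {V | ‖coord U 0 V - Δ.center * coord U 1 V‖ ≤ Δ.r * ‖coord U 1 V‖} ∩
        {V | ‖V 2‖ ≤ Δ.s * ‖coord U 1 V‖})
      (IsClosed.inter (isClosed_le ?_ ?_) (isClosed_le ?_ ?_)) fun V hV => ⟨?_, ?_⟩
    iterate 4 fun_prop
    · rintro ⟨u, v, h, hu, hv⟩
      obtain ⟨-, h0, h2⟩ := (toProj_eq_chart_iff hU hV).1 h
      refine ⟨?_, ?_⟩
      · change ‖_‖ ≤ _
        rw [h0, ← sub_mul, norm_mul]
        exact mul_le_mul_of_nonneg_right hu (norm_nonneg _)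
      · change ‖_‖ ≤ _
        rw [h2, norm_mul]
        exact mul_le_mul_of_nonneg_right hv (norm_nonneg _)
    · rintro ⟨h0, h2⟩
      have h0 : ‖coord U 0 V - Δ.center * coord U 1 V‖ ≤ Δ.r * ‖coord U 1 V‖ := h0
      have h2 : ‖V 2‖ ≤ Δ.s * ‖coord U 1 V‖ := h2
      have h1 : coord U 1 V ≠ 0 := fun h => by
        simp only [h, norm_zero, mul_zero, sub_zero] at h0 h2
        exact hV (eq_zero_of_coord hU (norm_le_zero_iff.1 h0) h (norm_le_zero_iff.1 h2))
      have h1' := norm_pos_iff.2 h1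
      refine ⟨coord U 0 V / coord U 1 V, V 2 / coord U 1 V, (toProj_eq_chart_iff hU hV).2
        ⟨h1, (div_mul_cancel₀ _ h1).symm, (div_mul_cancel₀ _ h1).symm⟩, ?_, ?_⟩
      · rw [div_sub' h1, norm_div, div_le_iff₀ h1', mul_comm (coord U 1 V)]
        exact h0
      · rw [norm_div, div_le_iff₀ h1']
        exact h2
  refine closure_minimal ?_ hcl hy
  rintro _ ⟨⟨u, v⟩, ⟨hu, hv⟩, rfl⟩
  rw [mem_ball, dist_eq_norm] at hu
  exact ⟨u, v, rfl, hu.le, (mem_ball_zero_iff.1 hv).le⟩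

theorem exists_of_mem_frontier_carrier (hU : U ∈ Matrix.unitaryGroup (Fin 2) ℂ) {Δ : Bidisk}
    {y : P2} (hy : y ∈ frontier (Δ.carrier U)) :
    ∃ u v, y = chart U (u, v) ∧ ‖u - Δ.center‖ ≤ Δ.r ∧ ‖v‖ ≤ Δ.s ∧
      (‖v‖ < Δ.s → ‖u - Δ.center‖ = Δ.r) := by
  rw [(isOpen_carrier hU Δ).frontier_eq] at hy
  obtain ⟨u, v, rfl, hu, hv⟩ := exists_of_mem_closure_carrier hU hy.1
  refine ⟨u, v, rfl, hu, hv, fun hv' => le_antisymm hu (not_lt.1 fun hu' => hy.2 ?_)⟩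
  exact ⟨(u, v), ⟨by rwa [mem_ball, dist_eq_norm], mem_ball_zero_iff.2 hv'⟩, rfl⟩

theorem disjoint_carrier (hU : U ∈ Matrix.unitaryGroup (Fin 2) ℂ) {Δ₁ Δ₂ : Bidisk}
    (h : Disjoint (ball Δ₁.center Δ₁.r) (ball Δ₂.center Δ₂.r)) :
    Disjoint (Δ₁.carrier U) (Δ₂.carrier U) := by
  rw [Set.disjoint_left]
  rintro _ ⟨⟨u, v⟩, ⟨hu, -⟩, rfl⟩ ⟨⟨u', v'⟩, ⟨hu', -⟩, h'⟩
  obtain ⟨rfl, -⟩ := chart_injective hU h'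
  exact Set.disjoint_left.1 h hu hu'

end Plane

/-! ### Dominating maps -/

section Dominating

open MvPolynomial

variable {F : Fin 2 → MvPolynomial (Fin 2) ℂ}

theorem homogeneousComponent_totalDegree_ne_zero {R : MvPolynomial (Fin 2) ℂ} (hR : R ≠ 0) :
    homogeneousComponent R.totalDegree R ≠ 0 := by
  obtain ⟨d, hd, h⟩ := Finset.exists_mem_eq_sup R.support (support_nonempty.2 hR)
    (fun s => s.sum fun _ e => e)
  intro h0
  have h1 := coeff_homogeneousComponent R.totalDegree R d
  rw [h0, coeff_zero, if_pos] at h1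
  · exact mem_support_iff.1 hd h1.symm
  · rw [totalDegree, h, Finsupp.degree_eq_sum, Finsupp.sum_fintype _ _ (fun _ => rfl)]

/-- Homogenizing a polynomial relation `R ∘ F = 0` gives a relation on all of `ℂ³`; at infinity
it says that the leading form of `R` vanishes on the image of `g * P`. -/
theorem LeadingForm.eval_eq_zero_of_relation (L : LeadingForm F) (hD : 0 < algDegree F)
    {R : MvPolynomial (Fin 2) ℂ} (hR : ∀ x, eval (polyMap F x) R = 0) {x : Fin 2 → ℂ}
    (hx : eval x L.g ≠ 0) : eval (L.lift x) (homogeneousComponent R.totalDegree R) = 0 := by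
  set k := R.totalDegree with hk
  set D := algDegree F with hDd
  set G : ℂ → Fin 2 → ℂ := fun t i => homogenize F i ![x 0, x 1, t] with hG
  have hGc : Continuous G := continuous_pi fun i => (continuous_homogenize i).comp
    (continuous_pi fun j => by fin_cases j <;> simp <;> fun_prop)
  set E : ℂ → ℂ := fun t => ∑ j ∈ Finset.range (k + 1),
    t ^ ((k - j) * D) * eval (G t) (homogeneousComponent j R) with hE
  have hEc : Continuous E := continuous_finsetSum _ fun j _ =>
    (continuous_id.pow _).mul ((MvPolynomial.continuous_eval _).comp hGc)
  have hE0 : ∀ t ∈ ({0}ᶜ : Set ℂ), E t = 0 := by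
    intro t ht
    have ht : t ≠ 0 := ht
    have hV : ![x 0, x 1, t] = t • ![(t⁻¹ • x) 0, (t⁻¹ • x) 1, 1] := by
      ext j; fin_cases j <;> simp [ht]
    have hGt : G t = t ^ D • polyMap F (t⁻¹ • x) := by
      ext i
      simp only [hG]
      rw [hV, homogenize_smul, homogenize_one]; rfl
    have h1 : E t = t ^ (k * D) * ∑ j ∈ Finset.range (k + 1),
        eval (polyMap F (t⁻¹ • x)) (homogeneousComponent j R) := by
      rw [Finset.mul_sum]
      refine Finset.sum_congr rfl fun j hj => ?_
      have hj : j ≤ k := Nat.lt_succ_iff.1 (Finset.mem_range.1 hj)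
      rw [hGt, eval_smul_of_isHomogeneous (homogeneousComponent_isHomogeneous j R), ← mul_assoc,
        ← pow_mul, ← pow_add, mul_comm D j, ← add_mul, Nat.sub_add_cancel hj]
    rw [h1, ← map_sum, sum_homogeneousComponent, hR, mul_zero]
  have h0 : E 0 = 0 := congrFun
    (Continuous.ext_on (dense_compl_singleton (0 : ℂ)) hEc continuous_const hE0) 0
  have hx' : ![x 0, x 1] = x := by ext j; fin_cases j <;> rfl
  have hG0 : G 0 = eval x L.g • L.lift x := by
    ext i
    have := L.homogenize_infinity (X := ![x 0, x 1, 0]) rfl i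
    simp only [Matrix.cons_val_zero, Matrix.cons_val_one, hx'] at this
    exact this
  rw [hE] at h0
  simp only at h0
  rw [Finset.sum_range_succ, Finset.sum_eq_zero, zero_add, Nat.sub_self, zero_mul, pow_zero,
    one_mul, hG0, eval_smul_of_isHomogeneous (homogeneousComponent_isHomogeneous k R)] at h0
  · exact (mul_eq_zero.1 h0).resolve_left (pow_ne_zero _ hx)
  · intro j hj
    have := Finset.mem_range.1 hj
    rw [zero_pow (Nat.mul_ne_zero (by omega) hD.ne'), zero_mul]

theorem infinite_P1 : Infinite P1 :=
  Infinite.of_injective (aff 1) (aff_injective (one_mem _))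

/-- A polynomial relation between the components of `F` would force the image of the nonconstant
map `f_∞` to be finite. -/
theorem LeadingForm.isDominating (L : LeadingForm F)
    (hnc : ∃ p q : P1, L.fInfty p ≠ L.fInfty q) : IsDominating F := by
  intro R hR
  by_contra hR0
  have hD := L.algDegree_pos hnc
  set Q := homogeneousComponent R.totalDegree R with hQ
  have hQh : Q.IsHomogeneous R.totalDegree := homogeneousComponent_isHomogeneous _ R
  have hfin := finite_zeros_of_isHomogeneous hQh (homogeneousComponent_totalDegree_ne_zero hR0)
  have := infinite_P1
  refine (Set.infinite_univ (α := P1)) (((L.finite_indetPoints hD).union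
    (hfin.biUnion fun z _ => L.finite_fiber hnc z)).subset fun p _ => ?_)
  by_cases hp : p ∈ indetPoints F
  · exact Or.inl hp
  · refine Or.inr (mem_biUnion (x := L.fInfty p) ?_ rfl)
    rw [L.indetPoints_eq hD] at hp
    have h1 := L.eval_eq_zero_of_relation hD hR hp
    obtain ⟨a, ha, h⟩ := exists_rep_toProj (L.lift_ne_zero p.rep_nonzero)
    have h2 : L.fInfty p = toProj (L.lift p.rep) := rfl
    change eval (L.fInfty p).rep Q = 0
    rw [h2, h, eval_smul_of_isHomogeneous hQh, h1, mul_zero]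

end Dominating

/-! ### The vertical boundaries -/

section Vertical

variable {F : Fin 2 → MvPolynomial (Fin 2) ℂ} {U : Matrix (Fin 2) (Fin 2) ℂ}

/-- The coordinates `Z'` and `W'` of the homogeneous lift at the point `(u, v)` of the chart. -/
noncomputable def liftCoord (F : Fin 2 → MvPolynomial (Fin 2) ℂ) (U : Matrix (Fin 2) (Fin 2) ℂ)
    (i : Fin 2) (u v : ℂ) : ℂ :=
  coord U i (homLift F (chartVec U u v))

theorem continuous_chartVec : Continuous fun x : ℂ × ℂ => chartVec U x.1 x.2 := by
  have h : Continuous fun x : ℂ × ℂ => U *ᵥ ![x.1, 1] :=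
    Continuous.matrix_mulVec continuous_const
      (continuous_pi fun j => by fin_cases j <;> simp <;> fun_prop)
  refine continuous_pi fun j => ?_
  fin_cases j
  · exact continuous_pi_iff.1 h 0
  · exact continuous_pi_iff.1 h 1
  · exact continuous_snd

theorem continuous_liftCoord (i : Fin 2) :
    Continuous fun x : ℂ × ℂ => liftCoord F U i x.1 x.2 :=
  (continuous_coord i).comp (continuous_homLift.comp continuous_chartVec)

theorem differentiable_liftCoord (i : Fin 2) (v : ℂ) :
    Differentiable ℂ fun u => liftCoord F U i u v := by
  have h : ∀ j, Differentiable ℂ fun u => homogenize F j (chartVec U u v) := by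
    intro j
    unfold homogenize
    refine Differentiable.fun_sum fun k _ => ?_
    change Differentiable ℂ fun u => v ^ (algDegree F - k) *
      MvPolynomial.eval ![chartVec U u v 0, chartVec U u v 1]
        (MvPolynomial.homogeneousComponent k (F j))
    refine Differentiable.const_mul ?_ _
    have : (fun u : ℂ => MvPolynomial.eval ![chartVec U u v 0, chartVec U u v 1]
        (MvPolynomial.homogeneousComponent k (F j))) = fun u =>
        (restrictLine (U *ᵥ ![1, 0]) (U *ᵥ ![0, 1])
          (MvPolynomial.homogeneousComponent k (F j))).eval u := by
      funext u
      rw [eval_restrictLine, line_eq]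
      congr 2
      ext l; fin_cases l <;> rfl
    rw [this]
    exact Polynomial.differentiable _
  have : (fun u => liftCoord F U i u v) = fun u =>
      Uᴴ i 0 * homogenize F 0 (chartVec U u v) + Uᴴ i 1 * homogenize F 1 (chartVec U u v) := by
    funext u
    simp [liftCoord, coord, Matrix.mulVec, dotProduct, homLift]
  rw [this]
  exact ((h 0).const_mul _).add ((h 1).const_mul _)

theorem liftCoord_zero (L : LeadingForm F) (hD : 0 < algDegree F)
    (hU : U ∈ Matrix.unitaryGroup (Fin 2) ℂ) (u : ℂ) :
    liftCoord F U 0 u 0 = MvPolynomial.eval (U *ᵥ ![u, 1]) L.g * (chartNum L U 0).eval u ∧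
      liftCoord F U 1 u 0 = MvPolynomial.eval (U *ᵥ ![u, 1]) L.g * (chartNum L U 1).eval u := by
  set g := MvPolynomial.eval (U *ᵥ ![u, 1]) L.g with hg
  have h1 : homLift F (chartVec U u 0) = g •
      ![(U *ᵥ ![(chartNum L U 0).eval u, (chartNum L U 1).eval u]) 0,
        (U *ᵥ ![(chartNum L U 0).eval u, (chartNum L U 1).eval u]) 1, 0] := by
    rw [chartVec, L.homLift_infinity hD, ← lift_chart L hU]
    ext j; fin_cases j <;> simp [hg]
  have h2 := coord_vec hU ((chartNum L U 0).eval u) ((chartNum L U 1).eval u) 0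
  rw [liftCoord, liftCoord, h1, coord_smul, coord_smul, h2.1, h2.2]
  exact ⟨rfl, rfl⟩

theorem eval_g_ne_zero_iff (L : LeadingForm F) (hD : 0 < algDegree F)
    (hU : U ∈ Matrix.unitaryGroup (Fin 2) ℂ) (u : ℂ) :
    MvPolynomial.eval (U *ᵥ ![u, 1]) L.g ≠ 0 ↔ aff U u ∉ indetPoints F :=
  (not_congr (L.toProj_mem_indetPoints_iff hD
    (unitary_mulVec_ne_zero hU (vec_one_ne_zero u)))).symm

/-- Over a compact set of the line at infinity without indeterminacy points, a definite margin
for `f_∞` persists for `f` at all sufficiently small heights. -/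
theorem exists_height (L : LeadingForm F) (hD : 0 < algDegree F)
    (hU : U ∈ Matrix.unitaryGroup (Fin 2) ℂ) {K : Set ℂ} (hK : IsCompact K)
    (hKI : ∀ u ∈ K, aff U u ∉ indetPoints F) {μ : ℝ} (hμ : 0 < μ) (Q : ℝ) :
    ∃ η > 0, ∀ u ∈ K, ∀ v : ℂ, ‖v‖ < η → ∀ (a : ℂ) (ρ : ℝ), ‖a‖ ≤ Q → 0 ≤ ρ → ρ ≤ 1 →
      (ρ + μ) * ‖(chartNum L U 1).eval u‖ ≤
        ‖(chartNum L U 0).eval u - a * (chartNum L U 1).eval u‖ →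
      ρ * ‖liftCoord F U 1 u v‖ < ‖liftCoord F U 0 u v - a * liftCoord F U 1 u v‖ := by
  rcases lt_or_ge Q 0 with hQ | hQ
  · exact ⟨1, one_pos, fun u _ v _ a ρ ha => absurd (norm_nonneg a) (by linarith)⟩
  have hgc : Continuous fun u : ℂ => MvPolynomial.eval (U *ᵥ ![u, 1]) L.g := by
    refine (MvPolynomial.continuous_eval _).comp (Continuous.matrix_mulVec continuous_const
      (continuous_pi fun j => by fin_cases j <;> simp <;> fun_prop))
  obtain ⟨m, hm, hmK⟩ : ∃ m > 0, ∀ u ∈ K, m ≤ ‖MvPolynomial.eval (U *ᵥ ![u, 1]) L.g‖ *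
      (‖(chartNum L U 0).eval u‖ + ‖(chartNum L U 1).eval u‖) := by
    rcases K.eq_empty_or_nonempty with rfl | hne
    · exact ⟨1, one_pos, fun u hu => absurd hu (notMem_empty u)⟩
    obtain ⟨u₀, hu₀, hmin⟩ := hK.exists_isMinOn hne (f := fun u =>
      ‖MvPolynomial.eval (U *ᵥ ![u, 1]) L.g‖ *
      (‖(chartNum L U 0).eval u‖ + ‖(chartNum L U 1).eval u‖))
      (hgc.norm.mul ((chartNum L U 0).continuous.norm.add
        (chartNum L U 1).continuous.norm)).continuousOn
    refine ⟨_, ?_, fun u hu => hmin hu⟩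
    have h1 := norm_pos_iff.2 ((eval_g_ne_zero_iff L hD hU u₀).2 (hKI u₀ hu₀))
    refine mul_pos h1 ?_
    by_cases hB : (chartNum L U 1).eval u₀ = 0
    · exact add_pos_of_pos_of_nonneg (norm_pos_iff.2 (chartNum_ne_zero L hU hB)) (norm_nonneg _)
    · exact add_pos_of_nonneg_of_pos (norm_nonneg _) (norm_pos_iff.2 hB)
  -- the margin bounds `‖A - a B‖ - ρ ‖B‖` below by `(‖A‖ + ‖B‖) / c`
  set c : ℝ := 1 + (Q + 2) / μ with hc
  have hc0 : 0 < c := by positivity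
  set ε : ℝ := m / c / (Q + 3) with hε
  have hε0 : 0 < ε := by positivity
  have hev := hK.eventually_forall_of_forall_eventually (x₀ := (0 : ℂ))
    (P := fun v u => ‖liftCoord F U 0 u v - liftCoord F U 0 u 0‖ < ε ∧
      ‖liftCoord F U 1 u v - liftCoord F U 1 u 0‖ < ε) (fun u _ => by
    have hcont : ∀ i : Fin 2, ∀ᶠ z : ℂ × ℂ in 𝓝 (0, u),
        ‖liftCoord F U i z.2 z.1 - liftCoord F U i z.2 0‖ < ε := fun i => by
      have h1 : Continuous fun z : ℂ × ℂ => ‖liftCoord F U i z.2 z.1 - liftCoord F U i z.2 0‖ :=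
        (((continuous_liftCoord (F := F) (U := U) i).comp
          (continuous_snd.prodMk continuous_fst)).sub
          ((continuous_liftCoord (F := F) (U := U) i).comp
            (continuous_snd.prodMk continuous_const))).norm
      refine h1.continuousAt.eventually_lt continuousAt_const ?_
      simpa using hε0
    exact (hcont 0).and (hcont 1))
  obtain ⟨η, hη, hηK⟩ := Metric.eventually_nhds_iff.1 hev
  refine ⟨η, hη, fun u hu v hv a ρ ha hρ0 hρ1 h => ?_⟩
  obtain ⟨h0, h1⟩ := hηK (y := v) (by rwa [dist_zero_right]) u hu
  have hm' := hmK u hu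
  obtain ⟨hz0, hz1⟩ := liftCoord_zero L hD hU u
  set g := MvPolynomial.eval (U *ᵥ ![u, 1]) L.g
  set A := (chartNum L U 0).eval u
  set B := (chartNum L U 1).eval u
  set X := liftCoord F U 0 u v
  set Y := liftCoord F U 1 u v
  rw [hz0] at h0
  rw [hz1] at h1
  set d : ℝ := ‖A - a * B‖ - ρ * ‖B‖ with hd
  have hB0 := norm_nonneg B
  have hdB : μ * ‖B‖ ≤ d := by rw [hd]; linarith
  have hAd : ‖A‖ ≤ d + (Q + 1) * ‖B‖ := by
    have h2 : ‖A‖ ≤ ‖A - a * B‖ + ‖a‖ * ‖B‖ := by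
      rw [← norm_mul]; simpa using norm_add_le (A - a * B) (a * B)
    have h3 : ‖a‖ * ‖B‖ ≤ Q * ‖B‖ := mul_le_mul_of_nonneg_right ha hB0
    have h4 : ρ * ‖B‖ ≤ 1 * ‖B‖ := mul_le_mul_of_nonneg_right hρ1 hB0
    rw [hd]; linarith
  have hsum : ‖A‖ + ‖B‖ ≤ c * d := by
    have h2 : (Q + 2) * ‖B‖ ≤ (Q + 2) / μ * d := by
      rw [div_mul_eq_mul_div, le_div_iff₀ hμ]
      have := mul_le_mul_of_nonneg_left hdB (by linarith : 0 ≤ Q + 2)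
      linarith
    rw [hc, add_mul, one_mul]; linarith
  have hgd : m / c ≤ ‖g‖ * d := by
    rw [div_le_iff₀ hc0]
    calc m ≤ ‖g‖ * (‖A‖ + ‖B‖) := hm'
      _ ≤ ‖g‖ * (c * d) := mul_le_mul_of_nonneg_left hsum (norm_nonneg _)
      _ = _ := by ring
  have hX : ‖g‖ * ‖A - a * B‖ ≤ ‖X - a * Y‖ + ε + Q * ε := by
    rw [← norm_mul]
    have h2 : g * (A - a * B) = (X - a * Y) - (X - g * A) + a * (Y - g * B) := by ring
    rw [h2]
    refine (norm_add_le _ _).trans (add_le_add ((norm_sub_le _ _).trans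
      (add_le_add le_rfl h0.le)) ?_)
    rw [norm_mul]
    exact mul_le_mul ha h1.le (norm_nonneg _) hQ
  have hY : ρ * ‖Y‖ ≤ ρ * (‖g‖ * ‖B‖) + ε := by
    have h2 : ‖Y‖ ≤ ‖g‖ * ‖B‖ + ε := by
      rw [← norm_mul]
      have := norm_add_le (g * B) (Y - g * B)
      rw [add_sub_cancel] at this
      linarith
    have h3 := mul_le_mul_of_nonneg_left h2 hρ0
    have h4 : ρ * ε ≤ 1 * ε := mul_le_mul_of_nonneg_right hρ1 hε0.le
    linarith
  have hεm : m / c = (Q + 3) * ε := by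
    rw [hε, mul_div_cancel₀]; positivity
  have hexp : ‖g‖ * d = ‖g‖ * ‖A - a * B‖ - ρ * (‖g‖ * ‖B‖) := by rw [hd]; ring
  nlinarith

end Vertical

/-! ### Images near the line at infinity -/

section Horizontal

variable {F : Fin 2 → MvPolynomial (Fin 2) ℂ} {U : Matrix (Fin 2) (Fin 2) ℂ}

/-- If `f` maps the regular point `(u, v)` outside the cylinder over the disk of `Δ`, strictly, then
its image is not in the closure of `Δ`. -/
theorem notMem_closure_carrier (hU : U ∈ Matrix.unitaryGroup (Fin 2) ℂ) {Δ : Bidisk} {u v : ℂ}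
    {y : P2} (h : ((chart U (u, v), y) : P2 × P2) ∈ closure (regularGraph F))
    (hlt : Δ.r * ‖liftCoord F U 1 u v‖ <
      ‖liftCoord F U 0 u v - Δ.center * liftCoord F U 1 u v‖) :
    y ∉ closure (Δ.carrier U) := by
  obtain ⟨r', hr', hrr'⟩ : ∃ r', r' * ‖liftCoord F U 1 u v‖ <
      ‖liftCoord F U 0 u v - Δ.center * liftCoord F U 1 u v‖ ∧ Δ.r < r' := by
    have h1 : ∀ᶠ r' in 𝓝[>] Δ.r, r' * ‖liftCoord F U 1 u v‖ <
        ‖liftCoord F U 0 u v - Δ.center * liftCoord F U 1 u v‖ :=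
      ((continuous_id.mul continuous_const).continuousAt.eventually_lt continuousAt_const
        hlt).filter_mono nhdsWithin_le_nhds
    exact (h1.and self_mem_nhdsWithin).exists
  set O : Set P2 := {y | ∃ a b, y = chart U (a, b) ∧ ‖a - Δ.center‖ < r'} with hO
  have h0 := continuous_coord (U := U) 0
  have h1 := continuous_coord (U := U) 1
  have hiff : ∀ V : Fin 3 → ℂ, V ≠ 0 → (toProj V ∈ O ↔
      V ∈ {V | ‖coord U 0 V - Δ.center * coord U 1 V‖ < r' * ‖coord U 1 V‖}) := by
    intro V hV
    constructor
    · rintro ⟨a, b, hab, ha⟩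
      obtain ⟨hc1, hc0, -⟩ := (toProj_eq_chart_iff hU hV).1 hab
      rw [mem_ofPred_eq, hc0, ← sub_mul, norm_mul]
      exact mul_lt_mul_of_pos_right ha (norm_pos_iff.2 hc1)
    · intro hV'
      rw [mem_ofPred_eq] at hV'
      have hc1 : coord U 1 V ≠ 0 := fun hc => by
        rw [hc, norm_zero, mul_zero, mul_zero, sub_zero] at hV'
        exact absurd hV' (not_lt.2 (norm_nonneg _))
      refine ⟨coord U 0 V / coord U 1 V, V 2 / coord U 1 V, (toProj_eq_chart_iff hU hV).2
        ⟨hc1, (div_mul_cancel₀ _ hc1).symm, (div_mul_cancel₀ _ hc1).symm⟩, ?_⟩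
      rw [div_sub' hc1, norm_div, div_lt_iff₀ (norm_pos_iff.2 hc1), mul_comm (coord U 1 V)]
      exact hV'
  have hOo : IsOpen O := isOpen_of_forall_toProj (isOpen_lt (by fun_prop) (by fun_prop)) hiff
  rw [chart_eq] at h
  have hy : y ∈ Oᶜ := by
    refine mem_of_mem_closure_regularGraph (chartVec_ne_zero hU u v) h hOo.isClosed_compl ?_
    have hc : Continuous fun V : Fin 3 → ℂ => homLift F V := continuous_homLift
    have hev : ∀ᶠ V in 𝓝 (chartVec U u v), r' * ‖coord U 1 (homLift F V)‖ <
        ‖coord U 0 (homLift F V) - Δ.center * coord U 1 (homLift F V)‖ :=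
      (continuous_const.mul (h1.comp hc).norm).continuousAt.eventually_lt
        ((h0.comp hc).sub (continuous_const.mul (h1.comp hc))).norm.continuousAt hr'
    filter_upwards [hev] with V hV hne
    rw [mem_compl_iff, hiff _ hne]
    exact not_lt.2 hV.le
  intro hcl
  obtain ⟨a, b, rfl, ha, -⟩ := exists_of_mem_closure_carrier hU hcl
  exact hy ⟨a, b, rfl, ha.trans_lt hrr'⟩

theorem euclNorm_vec_one (u : ℂ) : euclNorm ![u, 1] = Real.sqrt (‖u‖ ^ 2 + 1) := by
  simp [euclNorm]

theorem one_le_euclNorm_vec_one (u : ℂ) : 1 ≤ euclNorm ![u, 1] := by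
  rw [euclNorm_vec_one, Real.one_le_sqrt]
  nlinarith [sq_nonneg ‖u‖]

theorem euclNorm_vec_one_le {u a : ℂ} {τ : ℝ} (h : ‖u - a‖ ≤ τ) :
    euclNorm ![u, 1] ≤ (1 + τ) * euclNorm ![a, 1] := by
  have hτ : 0 ≤ τ := (norm_nonneg _).trans h
  have hu : ‖u‖ ≤ ‖a‖ + τ := by
    have := norm_add_le (u - a) a
    rw [sub_add_cancel] at this
    linarith
  rw [euclNorm_vec_one, euclNorm_vec_one]
  refine Real.sqrt_le_iff.2 ⟨by positivity, ?_⟩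
  rw [mul_pow, Real.sq_sqrt (by positivity)]
  have hu0 := norm_nonneg u
  have ha0 := norm_nonneg a
  have h1 : ‖u‖ ^ 2 ≤ (‖a‖ + τ) ^ 2 := pow_le_pow_left₀ hu0 hu 2
  nlinarith [mul_nonneg hτ (sq_nonneg (‖a‖ - 1)), mul_nonneg hτ (sq_nonneg ‖a‖),
    mul_nonneg (mul_nonneg hτ hτ) (sq_nonneg ‖a‖)]

theorem euclNorm_smul_vec3 (c : ℂ) (V : Fin 3 → ℂ) :
    euclNorm ![(c • V) 0, (c • V) 1] = ‖c‖ * euclNorm ![V 0, V 1] := by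
  rw [← euclNorm_smul]
  congr 1
  ext j; fin_cases j <;> rfl

/-- The lower bound for `‖f(x)‖` near infinity, in homogeneous coordinates. -/
theorem mul_le_euclNorm_homLift {C M : ℝ}
    (hatt : ∀ x : Fin 2 → ℂ, M ≤ euclNorm x → C * euclNorm x ≤ euclNorm (polyMap F x))
    {V : Fin 3 → ℂ} (hV : V 2 ≠ 0) (hM : M * ‖V 2‖ ≤ euclNorm ![V 0, V 1]) :
    C * euclNorm ![V 0, V 1] * ‖homLift F V 2‖ ≤
      ‖V 2‖ * euclNorm ![homLift F V 0, homLift F V 1] := by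
  set x : Fin 2 → ℂ := (V 2)⁻¹ • ![V 0, V 1] with hx
  have hn := norm_pos_iff.2 hV
  have hVx : V = V 2 • ![x 0, x 1, 1] := by
    ext j; fin_cases j <;> simp [hx, hV]
  have hex : euclNorm ![V 0, V 1] = ‖V 2‖ * euclNorm x := by
    rw [hx, euclNorm_smul, norm_inv, mul_inv_cancel_left₀ hn.ne']
  have h2 : (![homLift F ![x 0, x 1, 1] 0, homLift F ![x 0, x 1, 1] 1] : Fin 2 → ℂ) =
      polyMap F x := by
    ext j
    fin_cases j
    · exact homogenize_one x 0
    · exact homogenize_one x 1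
  have h3 : homLift F ![x 0, x 1, 1] 2 = 1 := by simp [homLift]
  have h4 : homLift F V = V 2 ^ algDegree F • homLift F ![x 0, x 1, 1] := by
    rw [← homLift_smul, ← hVx]
  rw [h4, euclNorm_smul_vec3, h2, Pi.smul_apply, h3, smul_eq_mul, mul_one, hex]
  rw [hex, mul_comm] at hM
  calc C * (‖V 2‖ * euclNorm x) * ‖V 2 ^ algDegree F‖
      = ‖V 2‖ * ‖V 2 ^ algDegree F‖ * (C * euclNorm x) := by ring
    _ ≤ ‖V 2‖ * ‖V 2 ^ algDegree F‖ * euclNorm (polyMap F x) :=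
        mul_le_mul_of_nonneg_left (hatt x (le_of_mul_le_mul_left hM hn)) (by positivity)
    _ = _ := by ring

/-- Near infinity the map multiplies the distance to the origin by at least `C`; in the
chart, where `|v| / ‖(u, 1)‖` is the inverse of this distance, it contracts heights by `C`. -/
theorem norm_le_of_mem_closure_regularGraph (hD : 0 < algDegree F)
    (hU : U ∈ Matrix.unitaryGroup (Fin 2) ℂ) {C M : ℝ}
    (hatt : ∀ x : Fin 2 → ℂ, M ≤ euclNorm x → C * euclNorm x ≤ euclNorm (polyMap F x))
    {u v u' v' : ℂ} {k : ℝ} (hM : M * ‖v‖ < euclNorm ![u, 1])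
    (hk : k * ‖v‖ < C * euclNorm ![u, 1])
    (h : ((chart U (u, v), chart U (u', v')) : P2 × P2) ∈ closure (regularGraph F)) :
    k * ‖v'‖ ≤ euclNorm ![u', 1] := by
  have hvec : ∀ a b : ℂ, euclNorm ![chartVec U a b 0, chartVec U a b 1] = euclNorm ![a, 1] := by
    intro a b
    have : (![chartVec U a b 0, chartVec U a b 1] : Fin 2 → ℂ) = U *ᵥ ![a, 1] := by
      ext j; fin_cases j <;> rfl
    rw [this, euclNorm_unitary_mulVec hU]
  have hcont : Continuous fun V : Fin 3 → ℂ => euclNorm ![V 0, V 1] :=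
    continuous_euclNorm.comp (continuous_pi fun j => by fin_cases j <;> simp <;> fun_prop)
  set O : Set P2 := {y | ∃ V : Fin 3 → ℂ, V ≠ 0 ∧ y = toProj V ∧
    euclNorm ![V 0, V 1] < k * ‖V 2‖} with hO
  have hiff : ∀ V : Fin 3 → ℂ, V ≠ 0 → (toProj V ∈ O ↔
      V ∈ {V : Fin 3 → ℂ | euclNorm ![V 0, V 1] < k * ‖V 2‖}) := by
    intro V hV
    constructor
    · rintro ⟨V', hV', hVV', hlt⟩
      obtain ⟨c, rfl⟩ := (toProj_eq_toProj_iff hV hV').1 hVV'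
      have hc : c ≠ 0 := fun hc => hV (by rw [hc, zero_smul])
      rw [mem_ofPred_eq, euclNorm_smul_vec3, Pi.smul_apply, smul_eq_mul, norm_mul, mul_left_comm]
      exact mul_lt_mul_of_pos_left hlt (norm_pos_iff.2 hc)
    · exact fun hlt => ⟨V, hV, rfl, hlt⟩
  have hOo : IsOpen O := isOpen_of_forall_toProj (isOpen_lt hcont (by fun_prop)) hiff
  rw [chart_eq u v] at h
  have hy : chart U (u', v') ∈ Oᶜ := by
    refine mem_of_mem_closure_regularGraph (chartVec_ne_zero hU u v) h hOo.isClosed_compl ?_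
    have hv2 : Continuous fun V : Fin 3 → ℂ => ‖V 2‖ := (continuous_apply (2 : Fin 3)).norm
    have hev1 : ∀ᶠ V in 𝓝 (chartVec U u v), M * ‖V 2‖ < euclNorm ![V 0, V 1] :=
      (continuous_const.mul hv2).continuousAt.eventually_lt hcont.continuousAt
        (by rw [hvec]; exact hM)
    have hev2 : ∀ᶠ V in 𝓝 (chartVec U u v), k * ‖V 2‖ < C * euclNorm ![V 0, V 1] :=
      (continuous_const.mul hv2).continuousAt.eventually_lt
        (continuous_const.mul hcont).continuousAt (by rw [hvec]; exact hk)
    filter_upwards [hev1, hev2] with V hV1 hV2 hne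
    rw [mem_compl_iff, hiff _ hne, mem_ofPred_eq, not_lt]
    by_cases hV : V 2 = 0
    · have : homLift F V 2 = 0 := by simp [homLift, hV, hD.ne']
      rw [this, norm_zero, mul_zero]
      exact euclNorm_nonneg _
    · have h1 := mul_le_euclNorm_homLift hatt hV hV1.le
      have h2 := mul_le_mul_of_nonneg_right hV2.le (norm_nonneg (homLift F V 2))
      refine le_of_mul_le_mul_left ?_ (norm_pos_iff.2 hV)
      linarith
  by_contra hcon
  refine hy ⟨chartVec U u' v', chartVec_ne_zero hU u' v', rfl, ?_⟩
  rw [hvec]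
  exact not_le.1 hcon

/-- The curve `f⁻¹ {u = a}` has points outside `L_∞` near every indeterminacy point. At height
`v = 0` its equation has an isolated zero at an indeterminacy point, because all components of the
lift vanish there, and this zero persists at small heights by the open mapping theorem. -/
theorem exists_zero_near (L : LeadingForm F) (hnc : ∃ p q : P1, L.fInfty p ≠ L.fInfty q)
    (hU : U ∈ Matrix.unitaryGroup (Fin 2) ℂ) {p : ℂ} (hp : aff U p ∈ indetPoints F) (a : ℂ)
    {r s : ℝ} (hr : 0 < r) (hs : 0 < s) :
    ∃ u v : ℂ, ‖u - p‖ < r ∧ v ≠ 0 ∧ ‖v‖ < s ∧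
      liftCoord F U 0 u v = a * liftCoord F U 1 u v := by
  have hD := L.algDegree_pos hnc
  set Ψ : ℂ → ℂ → ℂ := fun u v => liftCoord F U 0 u v - a * liftCoord F U 1 u v with hΨ
  have hΨc : Continuous fun x : ℂ × ℂ => Ψ x.1 x.2 :=
    (continuous_liftCoord 0).sub (continuous_const.mul (continuous_liftCoord 1))
  have hΨ0 : ∀ u, Ψ u 0 = MvPolynomial.eval (U *ᵥ ![u, 1]) L.g *
      ((chartNum L U 0).eval u - a * (chartNum L U 1).eval u) := fun u => by
    obtain ⟨h0, h1⟩ := liftCoord_zero L hD hU u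
    simp only [hΨ]
    rw [h0, h1]; ring
  have hfin : {u | Ψ u 0 = 0}.Finite := by
    have h1 : (indetPoints F ∪ {q | L.fInfty q = aff U a}).Finite :=
      (L.finite_indetPoints hD).union (L.finite_fiber hnc _)
    refine (h1.preimage (aff_injective hU).injOn).subset fun u hu => ?_
    rw [mem_ofPred_eq, hΨ0, mul_eq_zero] at hu
    rcases hu with hu | hu
    · exact Or.inl (not_not.1 fun h => (eval_g_ne_zero_iff L hD hU u).2 h hu)
    · exact Or.inr ((fInfty_aff_eq_aff_iff L hU).2 hu)
  -- a circle about `p` without zeros at height `0`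
  obtain ⟨ρ, ⟨hρ0, hρr⟩, hρ⟩ : ∃ ρ ∈ Ioo 0 r, ρ ∉ (fun u => ‖u - p‖) '' {u | Ψ u 0 = 0} :=
    ((Ioo_infinite hr).sdiff (hfin.image _)).nonempty
  obtain ⟨ε, hε, hmin⟩ : ∃ ε > 0, ∀ u ∈ sphere p ρ, ε ≤ ‖Ψ u 0‖ := by
    obtain ⟨u₀, hu₀, hmin⟩ := (isCompact_sphere p ρ).exists_isMinOn
      (NormedSpace.sphere_nonempty.2 hρ0.le) (f := fun u => ‖Ψ u 0‖)
      (hΨc.comp (continuous_id.prodMk continuous_const)).norm.continuousOn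
    refine ⟨_, norm_pos_iff.2 fun h => hρ ⟨u₀, h, ?_⟩, fun u hu => hmin hu⟩
    rwa [mem_sphere, dist_eq_norm] at hu₀
  have hev := (isCompact_closedBall p ρ).eventually_forall_of_forall_eventually (x₀ := (0 : ℂ))
    (P := fun v u => ‖Ψ u v - Ψ u 0‖ < ε / 4) (fun u _ => by
      have h1 : Continuous fun z : ℂ × ℂ => ‖Ψ z.2 z.1 - Ψ z.2 0‖ :=
        ((hΨc.comp (continuous_snd.prodMk continuous_fst)).sub
          (hΨc.comp (continuous_snd.prodMk continuous_const))).norm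
      refine h1.continuousAt.eventually_lt continuousAt_const ?_
      simpa using hε)
  obtain ⟨v, ⟨hv, hvs⟩, hv0⟩ : ∃ v : ℂ,
      ((∀ u ∈ closedBall p ρ, ‖Ψ u v - Ψ u 0‖ < ε / 4) ∧ ‖v‖ < s) ∧ v ≠ 0 := by
    have h1 : ∀ᶠ v : ℂ in 𝓝 0, ‖v‖ < s :=
      continuous_norm.continuousAt.eventually_lt continuousAt_const (by simpa using hs)
    have h2 : ∀ᶠ v : ℂ in 𝓝[≠] 0, (∀ u ∈ closedBall p ρ, ‖Ψ u v - Ψ u 0‖ < ε / 4) ∧ ‖v‖ < s :=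
      (hev.and h1).filter_mono nhdsWithin_le_nhds
    exact (h2.and self_mem_nhdsWithin).exists
  have hp0 : Ψ p 0 = 0 := by
    rw [hΨ0, not_not.1 fun h => (eval_g_ne_zero_iff L hD hU p).1 h hp, zero_mul]
  have hpv : ‖Ψ p v‖ < ε / 4 := by
    have := hv p (mem_closedBall_self hρ0.le)
    rwa [hp0, sub_zero] at this
  have hdiff : Differentiable ℂ fun u => Ψ u v :=
    (differentiable_liftCoord 0 v).sub ((differentiable_liftCoord 1 v).const_mul a)
  have hsph : ∀ u ∈ sphere p ρ, ε / 2 ≤ ‖Ψ u v - Ψ p v‖ := by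
    intro u hu
    have h1 := hmin u hu
    have h2 := hv u (sphere_subset_closedBall hu)
    have h3 := norm_sub_le (Ψ u v - Ψ p v) ((Ψ u v - Ψ u 0) - Ψ p v)
    have h4 := norm_sub_le (Ψ u v - Ψ u 0) (Ψ p v)
    have h5 : Ψ u v - Ψ p v - (Ψ u v - Ψ u 0 - Ψ p v) = Ψ u 0 := by ring
    rw [h5] at h3
    linarith
  have hfreq : ∃ᶠ u in 𝓝 p, Ψ u v ≠ Ψ p v := by
    intro hcon
    have h1 : ∀ᶠ u in 𝓝 p, Ψ u v = Ψ p v := by simpa using hcon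
    have h2 := AnalyticOnNhd.eq_of_eventuallyEq (f := fun u => Ψ u v) (g := fun _ => Ψ p v)
      (hdiff.differentiableOn.analyticOnNhd isOpen_univ) analyticOnNhd_const h1
    obtain ⟨u, hu⟩ := (NormedSpace.sphere_nonempty (x := p) (r := ρ)).2 hρ0.le
    have h3 := hsph u hu
    rw [congrFun h2 u, sub_self, norm_zero] at h3
    linarith
  obtain ⟨u, hu, hzero⟩ := hdiff.diffContOnCl.ball_subset_image_closedBall hρ0 hsph hfreq
    (show (0 : ℂ) ∈ ball (Ψ p v) (ε / 2 / 2) by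
      rw [mem_ball, dist_zero_left]; linarith)
  rw [mem_closedBall, dist_eq_norm] at hu
  exact ⟨u, v, hu.trans_lt hρr, hv0, hvs, sub_eq_zero.1 hzero⟩

end Horizontal

/-! ### Horizontal-like maps between bidisks -/

section HorizontalLike

variable {F : Fin 2 → MvPolynomial (Fin 2) ℂ} {U : Matrix (Fin 2) (Fin 2) ℂ}

theorem euclNorm_chartVec (hU : U ∈ Matrix.unitaryGroup (Fin 2) ℂ) (u v : ℂ) :
    euclNorm ![chartVec U u v 0, chartVec U u v 1] = euclNorm ![u, 1] := by
  have : (![chartVec U u v 0, chartVec U u v 1] : Fin 2 → ℂ) = U *ᵥ ![u, 1] := by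
    ext j; fin_cases j <;> rfl
  rw [this, euclNorm_unitary_mulVec hU]

/-- A point of the affine plane near an indeterminacy point whose image lies on the line
`u = a`. The image is affine because `‖f(x)‖ ≥ C ‖x‖` excludes zeros of `f` near infinity. -/
theorem exists_mem_closure_regularGraph_near (L : LeadingForm F)
    (hnc : ∃ p q : P1, L.fInfty p ≠ L.fInfty q)
    (hU : U ∈ Matrix.unitaryGroup (Fin 2) ℂ) {C M : ℝ} (hC : 0 < C)
    (hatt : ∀ x : Fin 2 → ℂ, M ≤ euclNorm x → C * euclNorm x ≤ euclNorm (polyMap F x))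
    {p : ℂ} (hp : aff U p ∈ indetPoints F) (a : ℂ) {r s : ℝ} (hr : 0 < r) (hs : 0 < s)
    (hM : ∀ u v : ℂ, ‖u - p‖ < r → ‖v‖ < s → M * ‖v‖ < euclNorm ![u, 1]) :
    ∃ u v w : ℂ, ‖u - p‖ < r ∧ ‖v‖ < s ∧
      ((chart U (u, v), chart U (a, w)) : P2 × P2) ∈ closure (regularGraph F) := by
  obtain ⟨u, v, hu, hv0, hv, h0⟩ := exists_zero_near L hnc hU hp a hr hs
  set V := chartVec U u v with hV
  have hV2 : V 2 = v := rfl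
  have hl2 : homLift F V 2 ≠ 0 := by
    change V 2 ^ algDegree F ≠ 0
    exact pow_ne_zero _ hv0
  have hne : homLift F V ≠ 0 := fun h => hl2 (congrFun h 2)
  have h1 : coord U 1 (homLift F V) ≠ 0 := by
    intro h1
    have h0' : coord U 0 (homLift F V) = 0 := by
      change liftCoord F U 0 u v = 0
      rw [h0, show liftCoord F U 1 u v = 0 from h1, mul_zero]
    have hz := eq_of_coord hU (homLift F V)
    rw [h0', h1] at hz
    have hz' : (![homLift F V 0, homLift F V 1] : Fin 2 → ℂ) = 0 := by
      rw [hz]; ext j; fin_cases j <;> simp [Matrix.mulVec, dotProduct]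
    have h3 := mul_le_euclNorm_homLift hatt (V := V) hv0
      (by rw [euclNorm_chartVec hU]; exact (hM u v hu hv).le)
    rw [hz', euclNorm_eq_zero.2 rfl, mul_zero, euclNorm_chartVec hU] at h3
    have h4 := one_le_euclNorm_vec_one u
    have : 0 < C * euclNorm ![u, 1] * ‖homLift F V 2‖ :=
      mul_pos (mul_pos hC (by linarith)) (norm_pos_iff.2 hl2)
    linarith
  refine ⟨u, v, homLift F V 2 / coord U 1 (homLift F V), hu, hv, subset_closure ?_⟩
  have h2 : toProj (homLift F V) = chart U (a, homLift F V 2 / coord U 1 (homLift F V)) :=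
    (toProj_eq_chart_iff hU hne).2 ⟨h1, h0, (div_mul_cancel₀ _ h1).symm⟩
  rw [← h2]
  exact mem_regularGraph (chartVec_ne_zero hU u v) hne

/-- Where `f` is regular on `L_∞`, it agrees there with `f_∞`. -/
theorem mem_regularGraph_of_notMem_indetPoints (L : LeadingForm F) (hD : 0 < algDegree F)
    (hU : U ∈ Matrix.unitaryGroup (Fin 2) ℂ) {p a : ℂ} (hp : aff U p ∉ indetPoints F)
    (ha : L.fInfty (aff U p) = aff U a) :
    ((chart U (p, 0), chart U (a, 0)) : P2 × P2) ∈ regularGraph F := by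
  have hg := (eval_g_ne_zero_iff L hD hU p).2 hp
  have hB : (chartNum L U 1).eval p ≠ 0 :=
    chartNum_one_ne_zero L hU (by rw [ha]; exact aff_ne_missedPoint hU a)
  obtain ⟨h0, h1⟩ := liftCoord_zero L hD hU p
  have h1' : coord U 1 (homLift F (chartVec U p 0)) ≠ 0 := by
    change liftCoord F U 1 p 0 ≠ 0
    rw [h1]; exact mul_ne_zero hg hB
  have hne : homLift F (chartVec U p 0) ≠ 0 := fun h => h1' (by
    rw [h]; simp [coord, Matrix.mulVec, dotProduct])
  have h2 : toProj (homLift F (chartVec U p 0)) = chart U (a, 0) := by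
    refine (toProj_eq_chart_iff hU hne).2 ⟨h1', ?_, ?_⟩
    · change liftCoord F U 0 p 0 = a * liftCoord F U 1 p 0
      rw [h0, h1, sub_eq_zero.1 ((fInfty_aff_eq_aff_iff L hU).1 ha)]
      ring
    · simp [homLift, chartVec, hD.ne']
  rw [← h2]
  exact mem_regularGraph (chartVec_ne_zero hU p 0) hne

/-- A criterion in coordinates. The image of `Δ₁` may leave `Δ₂` only sideways, since by `hhor` the
points of the image over the closed disk of `Δ₂` lie strictly below its top. -/
theorem isHorizontalLike_of (hdom : IsDominating F) (hU : U ∈ Matrix.unitaryGroup (Fin 2) ℂ)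
    {Δ₁ Δ₂ : Bidisk}
    (hvert : ∀ u ∈ sphere Δ₁.center Δ₁.r, ∀ v : ℂ, ‖v‖ < Δ₁.s →
      Δ₂.r * ‖liftCoord F U 1 u v‖ <
        ‖liftCoord F U 0 u v - Δ₂.center * liftCoord F U 1 u v‖)
    (hhor : ∀ u v u' v' : ℂ, ‖u - Δ₁.center‖ ≤ Δ₁.r → ‖v‖ ≤ Δ₁.s → ‖u' - Δ₂.center‖ ≤ Δ₂.r →
      ((chart U (u, v), chart U (u', v')) : P2 × P2) ∈ closure (regularGraph F) → ‖v'‖ < Δ₂.s)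
    (hmeet : ∃ u v w : ℂ, ‖u - Δ₁.center‖ < Δ₁.r ∧ ‖v‖ < Δ₁.s ∧
      ((chart U (u, v), chart U (Δ₂.center, w)) : P2 × P2) ∈ closure (regularGraph F)) :
    IsHorizontalLike F U Δ₁ Δ₂ where
  dominating := hdom
  no_indet := by
    rw [Set.disjoint_right]
    rintro _ ⟨⟨u, v⟩, ⟨hu, hv⟩, rfl⟩ hI
    rw [chart_eq, toProj_mem_indetSet_iff (chartVec_ne_zero hU u v)] at hI
    have h := hvert u hu v (mem_ball_zero_iff.1 hv)
    have h0 : ∀ i, liftCoord F U i u v = 0 := fun i => by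
      rw [liftCoord, hI]; simp [coord, Matrix.mulVec, dotProduct]
    simp [h0] at h
  vertical := by
    rw [Set.disjoint_left]
    rintro y ⟨_, ⟨⟨u, v⟩, ⟨hu, hv⟩, rfl⟩, h⟩
    exact notMem_closure_carrier hU h (hvert u hu v (mem_ball_zero_iff.1 hv))
  horizontal := by
    rintro y ⟨⟨x, hx, h⟩, hy⟩
    obtain ⟨u, v, rfl, hu, hv⟩ := exists_of_mem_closure_carrier hU hx
    obtain ⟨u', v', rfl, hu', hv', hfr⟩ := exists_of_mem_frontier_carrier hU hy
    have hlt := hhor u v u' v' hu hv hu' h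
    exact ⟨(u', v'), ⟨by rw [mem_sphere, dist_eq_norm]; exact hfr hlt,
      mem_ball_zero_iff.2 hlt⟩, rfl⟩
  meets := by
    obtain ⟨u, v, w, hu, hv, h⟩ := hmeet
    have hw := hhor u v _ w hu.le hv.le (by rw [sub_self, norm_zero]; exact Δ₂.r_pos.le) h
    refine ⟨chart U (Δ₂.center, w), ⟨chart U (u, v), ⟨(u, v), ⟨?_, ?_⟩, rfl⟩, h⟩,
      (Δ₂.center, w), ⟨?_, ?_⟩, rfl⟩
    · rwa [mem_ball, dist_eq_norm]
    · exact mem_ball_zero_iff.2 hv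
    · exact mem_ball_self Δ₂.r_pos
    · exact mem_ball_zero_iff.2 hw

/-- If the heights of the bidisks are proportional to `‖(a, 1)‖` at the centre `a`, then the
contraction of heights near `L_∞` beats the variation of `‖(u, 1)‖` over small disks. -/
theorem exists_contracted_heights (hD : 0 < algDegree F)
    (hU : U ∈ Matrix.unitaryGroup (Fin 2) ℂ) {C M : ℝ} (hC : 1 < C)
    (hatt : ∀ x : Fin 2 → ℂ, M ≤ euclNorm x → C * euclNorm x ≤ euclNorm (polyMap F x)) :
    ∃ τ > 0, ∃ η₀ > 0, ∀ η, 0 < η → η ≤ η₀ → ∀ a u v : ℂ, ‖u - a‖ ≤ τ →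
      ‖v‖ ≤ η * euclNorm ![a, 1] → M * ‖v‖ < euclNorm ![u, 1] ∧
      ∀ a' u' v' : ℂ, ‖u' - a'‖ ≤ τ →
        ((chart U (u, v), chart U (u', v')) : P2 × P2) ∈ closure (regularGraph F) →
        ‖v'‖ < η * euclNorm ![a', 1] := by
  set τ : ℝ := min 1 ((C - 1) / 9) with hτ
  have hτ0 : 0 < τ := lt_min one_pos (by linarith)
  have hτ1 : τ ≤ 1 := min_le_left _ _
  have hτC : τ ≤ (C - 1) / 9 := min_le_right _ _
  refine ⟨τ, hτ0, 1 / (4 * (1 + |M|)), by positivity, ?_⟩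
  intro η hη hη0 a u v hu hv
  have hua : euclNorm ![a, 1] ≤ (1 + τ) * euclNorm ![u, 1] :=
    euclNorm_vec_one_le (by rwa [norm_sub_rev])
  have hNu := one_le_euclNorm_vec_one u
  have hv' : ‖v‖ ≤ η * (1 + τ) * euclNorm ![u, 1] := by
    refine hv.trans ?_
    rw [mul_assoc]
    exact mul_le_mul_of_nonneg_left hua hη.le
  have hM0 := abs_nonneg M
  have hM : M * ‖v‖ < euclNorm ![u, 1] := by
    have h1 : |M| * η ≤ 1 / 4 := by
      have h2 := mul_le_mul_of_nonneg_left hη0 hM0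
      have h3 : |M| * (1 / (4 * (1 + |M|))) ≤ 1 / 4 := by
        rw [mul_one_div, div_le_div_iff₀ (by positivity) (by norm_num)]
        linarith
      linarith
    have h4 : M * ‖v‖ ≤ |M| * ‖v‖ := mul_le_mul_of_nonneg_right (le_abs_self M) (norm_nonneg _)
    have h5 := mul_le_mul_of_nonneg_left hv' hM0
    have h6 : |M| * η * ((1 + τ) * euclNorm ![u, 1]) ≤ 1 / 4 * ((1 + τ) * euclNorm ![u, 1]) :=
      mul_le_mul_of_nonneg_right h1 (by positivity)
    nlinarith
  refine ⟨hM, fun a' u' v' hu' h => ?_⟩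
  -- `(1 + τ) ^ 2 < C' < C`: the two comparisons of norms cost less than the contraction gains
  set C' : ℝ := 1 + (C - 1) / 2 with hC'
  have hC'0 : 0 < C' := by linarith
  have hprod : 0 < η * (1 + τ) := by positivity
  have h1 := norm_le_of_mem_closure_regularGraph hD hU hatt (k := C' / (η * (1 + τ))) hM (by
    calc C' / (η * (1 + τ)) * ‖v‖ ≤ C' / (η * (1 + τ)) * (η * (1 + τ) * euclNorm ![u, 1]) :=
          mul_le_mul_of_nonneg_left hv' (by positivity)
      _ = C' * euclNorm ![u, 1] := by rw [← mul_assoc, div_mul_cancel₀ _ hprod.ne']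
      _ < _ := mul_lt_mul_of_pos_right (by linarith) (by linarith)) h
  have h2 := h1.trans (euclNorm_vec_one_le hu')
  rw [div_mul_eq_mul_div, div_le_iff₀ hprod] at h2
  have h3 : (1 + τ) * (1 + τ) < C' := by nlinarith
  have hN := one_le_euclNorm_vec_one a'
  refine lt_of_mul_lt_mul_left (lt_of_le_of_lt h2 ?_) hC'0.le
  have h4 : 0 < η * euclNorm ![a', 1] := by positivity
  nlinarith [mul_lt_mul_of_pos_right h3 h4]

end HorizontalLike

end

end PolyDyn

open PolyDyn in
/-- Unitary coordinates whose missed point avoids `J_∞ ∪ E` exist, and in all such coordinates there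
are arbitrarily small bidisks centred at the points of `E` with the asserted properties. -/
theorem proposition3p1
    (F : Fin 2 → MvPolynomial (Fin 2) ℂ) (L : PolyDyn.LeadingForm F)
    (hG : PolyDyn.InClassG F L)
    (hyp : L.IsHyperbolic)
    (hJ : ∀ p ∈ PolyDyn.indetPoints F, p ∉ PolyDyn.juliaSet L.fInfty)
    (hper : ∀ p ∈ PolyDyn.indetPoints F, p ∉ Function.periodicPts L.fInfty) :
    (∃ U ∈ Matrix.unitaryGroup (Fin 2) ℂ,
      PolyDyn.missedPoint U ∉ PolyDyn.juliaSet L.fInfty ∪ L.E) ∧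
    ∀ U ∈ Matrix.unitaryGroup (Fin 2) ℂ,
      PolyDyn.missedPoint U ∉ PolyDyn.juliaSet L.fInfty ∪ L.E →
      ∀ δ : ℝ, 0 < δ → ∃ Δ : PolyDyn.P1 → PolyDyn.Bidisk,
        (∀ p ∈ L.E, PolyDyn.chart U ((Δ p).center, 0) = PolyDyn.lineAtInfinity p ∧
          (Δ p).r < δ ∧ (Δ p).s < δ) ∧
        (∀ p ∈ PolyDyn.indetPoints F, ∀ q ∈ L.E,
          PolyDyn.IsHorizontalLike F U (Δ p) (Δ q)) ∧
        (∀ p ∈ L.E, p ∉ PolyDyn.indetPoints F →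
          PolyDyn.IsHorizontalLike F U (Δ p) (Δ (L.fInfty p))) ∧
        (∀ p ∈ PolyDyn.indetPoints F, ∀ q ∈ L.E, q ≠ p →
          Disjoint ((Δ p).carrier U) ((Δ q).carrier U)) ∧
        (∀ p ∈ L.E, ∀ q q' : PolyDyn.P1, L.fInfty q = p → L.fInfty q' = p → q ≠ q' →
          Disjoint ((Δ q).carrier U) ((Δ q').carrier U)) := by
  have hnc := hG.not_constant
  have hD := L.algDegree_pos hnc
  refine ⟨?_, fun U hU hm δ hδ => ?_⟩
  -- an attracting periodic point is in the Fatou set, and no point of `E` is periodic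
  · obtain ⟨n, p, hp⟩ := hyp.1
    obtain ⟨U, hU, hUp⟩ := exists_unitary_missedPoint p
    refine ⟨U, hU, ?_⟩
    rw [hUp]
    rintro (h | h)
    · exact h (mem_fatouSet_of_attracting hp)
    · exact L.not_periodic_of_mem_E hper h ⟨n, hp.1, hp.2.1⟩
  · obtain ⟨C, M, hC, hatt⟩ := hG.attracting
    obtain ⟨τ, hτ, η₁, hη₁, hheight⟩ := exists_contracted_heights hD hU hC hatt
    obtain ⟨r, μ, K, Q, hμ, hK, hr, hrK, hKI, hQ, hmargin, hdis, hdis'⟩ :=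
      exists_radii hyp hnc hJ hper hU hm (lt_min (lt_min hδ hτ) one_pos)
    obtain ⟨η₂, hη₂, hvert⟩ := exists_height L hD hU hK hKI hμ Q
    set N : ℝ := Real.sqrt (Q ^ 2 + 1) with hN
    have hN1 : 1 ≤ N := Real.one_le_sqrt.2 (by nlinarith [sq_nonneg Q])
    -- the centres are bounded, so that heights proportional to their norms are uniformly small
    set η : ℝ := min η₁ (min η₂ δ / (2 * N)) with hη
    have hη0 : 0 < η := lt_min hη₁ (div_pos (lt_min hη₂ hδ) (by positivity))
    have hηN : ∀ p ∈ L.E, 0 < η * euclNorm ![affCoord U p, 1] ∧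
        η * euclNorm ![affCoord U p, 1] < min η₂ δ := fun p hp => by
      have h1 := one_le_euclNorm_vec_one (affCoord U p)
      refine ⟨by positivity, ?_⟩
      have h2 : euclNorm ![affCoord U p, 1] ≤ N := by
        rw [euclNorm_vec_one]
        exact Real.sqrt_le_sqrt (by
          have := pow_le_pow_left₀ (norm_nonneg _) (hQ p hp) 2
          linarith)
      calc η * euclNorm ![affCoord U p, 1] ≤ min η₂ δ / (2 * N) * N :=
            mul_le_mul (min_le_right _ _) h2 (by linarith)
              (div_pos (lt_min hη₂ hδ) (by positivity)).le
        _ = min η₂ δ / 2 := by field_simp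
        _ < min η₂ δ := half_lt_self (lt_min hη₂ hδ)
    have haff : ∀ p ∈ L.E, aff U (affCoord U p) = p := fun p hp =>
      aff_affCoord hU fun h0 => hm (Or.inr (h0 ▸ hp))
    classical
    set Δ : P1 → Bidisk := fun p => if hp : p ∈ L.E then
      ⟨affCoord U p, r p, η * euclNorm ![affCoord U p, 1], (hr p hp).1, (hηN p hp).1⟩
      else ⟨0, 1, 1, one_pos, one_pos⟩ with hΔ
    have hΔc : ∀ p ∈ L.E, (Δ p).center = affCoord U p := fun p hp => by simp [hΔ, hp]
    have hΔr : ∀ p ∈ L.E, (Δ p).r = r p := fun p hp => by simp [hΔ, hp]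
    have hΔs : ∀ p ∈ L.E, (Δ p).s = η * euclNorm ![affCoord U p, 1] := fun p hp => by
      simp [hΔ, hp]
    have hrδ : ∀ p ∈ L.E, r p < δ := fun p hp =>
      (hr p hp).2.trans_le ((min_le_left _ _).trans (min_le_left _ _))
    have hrτ : ∀ p ∈ L.E, r p ≤ τ := fun p hp =>
      (hr p hp).2.le.trans ((min_le_left _ _).trans (min_le_right _ _))
    have hr1 : ∀ p ∈ L.E, r p ≤ 1 := fun p hp => (hr p hp).2.le.trans (min_le_right _ _)
    have hlike : ∀ p ∈ L.E, ∀ q ∈ L.E, (p ∈ indetPoints F ∨ q = L.fInfty p) →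
        (∃ u v w : ℂ, ‖u - affCoord U p‖ < r p ∧ ‖v‖ < η * euclNorm ![affCoord U p, 1] ∧
          ((chart U (u, v), chart U (affCoord U q, w)) : P2 × P2) ∈ closure (regularGraph F)) →
        IsHorizontalLike F U (Δ p) (Δ q) := by
      intro p hp q hq hpq hmeet
      refine isHorizontalLike_of (L.isDominating hnc) hU ?_ ?_ ?_
      · rw [hΔc p hp, hΔr p hp, hΔs p hp, hΔc q hq, hΔr q hq]
        intro u hu v hv
        exact hvert u (hrK p hp hu) v (hv.trans ((hηN p hp).2.trans_le (min_le_left _ _))) _ _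
          (hQ q hq) (hr q hq).1.le (hr1 q hq) (hmargin p hp q hq hpq u hu)
      · rw [hΔc p hp, hΔr p hp, hΔs p hp, hΔc q hq, hΔr q hq, hΔs q hq]
        intro u v u' v' hu hv hu' h
        exact (hheight η hη0 (min_le_left _ _) _ u v (hu.trans (hrτ p hp)) hv).2 _ u' v'
          (hu'.trans (hrτ q hq)) h
      · rw [hΔc p hp, hΔr p hp, hΔs p hp, hΔc q hq]
        exact hmeet
    refine ⟨Δ, fun p hp => ⟨?_, ?_, ?_⟩, fun p hp q hq => ?_, fun p hp hpI => ?_,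
      fun p hp q hq hqp => ?_, fun p hp q q' hq hq' hqq' => ?_⟩
    · rw [hΔc p hp]
      conv_rhs => rw [← haff p hp]
      rw [aff, lineAtInfinity_toProj (unitary_mulVec_ne_zero hU (vec_one_ne_zero _))]
      rfl
    · rw [hΔr p hp]; exact hrδ p hp
    · rw [hΔs p hp]; exact (hηN p hp).2.trans_le (min_le_right _ _)
    · have hpE := L.indetPoints_subset_E hp
      refine hlike p hpE q hq (Or.inl hp) ?_
      refine exists_mem_closure_regularGraph_near L hnc hU (by linarith) hatt
        (by rwa [haff p hpE]) _ (hr p hpE).1 (hηN p hpE).1 fun u v hu hv => ?_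
      exact (hheight η hη0 (min_le_left _ _) _ u v (hu.le.trans (hrτ p hpE)) hv.le).1
    · have hq := L.apply_mem_E hp hpI
      refine hlike p hp _ hq (Or.inr rfl) ⟨affCoord U p, 0, 0, ?_, ?_, subset_closure ?_⟩
      · rw [sub_self, norm_zero]; exact (hr p hp).1
      · rw [norm_zero]; exact (hηN p hp).1
      · refine mem_regularGraph_of_notMem_indetPoints L hD hU (by rwa [haff p hp]) ?_
        rw [haff p hp, haff _ hq]
    · have hpE := L.indetPoints_subset_E hp
      refine disjoint_carrier hU ?_
      rw [hΔc p hpE, hΔr p hpE, hΔc q hq, hΔr q hq]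
      exact hdis p hp q hq hqp
    · have hqE := L.mem_E_of_apply (hq ▸ hp)
      have hqE' := L.mem_E_of_apply (hq' ▸ hp)
      refine disjoint_carrier hU ?_
      rw [hΔc q hqE, hΔr q hqE, hΔc q' hqE', hΔr q' hqE']
      exact hdis' q hqE q' hqE' (hq.trans hq'.symm) hqq'
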